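/- Let $p,\lambda>0$ and $$E_{p,\lambda}=\{(x,y,z)\in\mathbb C^3:\ (|x|^{2p}+|y|^2)^{1/\lambda}+|z|^2<1\}.$$ Let $B$ be the Bergman kernel of $E_{p,\lambda}$ on the diagonal ($B=\sum_j|e_j|^2$ for an orthonormal basis $(e_j)$ of the space of square-integrable holomorphic functions), let $g_{i\bar j}=\partial_i\bar\partial_j\log B$ be the Bergman metric, and let $$R_{i\bar jk\bar l}=-\partial_k\bar\partial_l g_{i\bar j}+\sum_{a,b=1}^3 g^{b\bar a}(\partial_k g_{i\bar a})(\bar\partial_l g_{b\bar j})$$ be its curvature tensor. Let $X,Y,Z$ be obtained from the coordinate fields $\partial_1,\partial_2,\partial_3$ (in this order) by the Gram–Schmidt process with respect to $g$. Put $$u_1=(p-1)(\lambda(p-1)+p),\quad u_2=p(p-1)(\lambda-1),\quad u_3=(p+1)(\lambda+\lambda p+p),$$ $$u_4=p(p+1)(\lambda-1),\quad u_5=-2(\lambda(p^2-2)+p^2),\quad u_6=-2(\lambda-1)p^2,$$ $$q_0=p^2\lambda^2+3p^2\lambda+2p^2+2p\lambda^2+3p\lambda+\lambda^2,\quad q_1=p(\lambda-1)(4p\lambda+4p+3\lambda),\quad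 q_2=p^2(\lambda-2)(\lambda-1),$$ $$e_0=u_5+4u_3,\qquad e_1=u_6+4u_4,$$ and, for $0\le\delta<1$, $S=u_3+u_4\delta$, $Q=q_0+q_1\delta+q_2\delta^2$, $$A_1=\frac{u_5+u_6\delta}{S}+4,\qquad A_2=\frac1p+3+\frac{u_3u_4(1-\delta)^2}{S^2},\qquad A_4=\frac{Q}{p(\delta p(\lambda-1)+p\lambda+p+\lambda)},$$ $$\widetilde H_1=-8-\frac{4(u_1+u_2\delta)}{S}+\frac{2(u_5+u_6\delta)^2}{S^2},$$ $$\widetilde H_2=-A_1\left[\frac1p+(1-\delta)^2\left(\frac{e_0e_1}{(e_0+e_1\delta)^2}-\frac{u_3u_4}{S^2}\right)\right],$$ $$\widetilde H_5=-2A_2-(1-\delta)^2\left[\frac{2u_3u_4(u_3+u_4)\bigl(u_3(2\delta-1)+u_4\delta(2-\delta)\bigr)}{S^4}-\frac{4\delta(1-\delta)^2u_3^2u_4^2(u_3+u_4)^2}{S^6A_2}\right],$$ $$\widetilde F_1=-\lambda\left[\frac{A_1}p+\frac{\delta(1-\delta)(u_3u_6-u_4u_5)}{S^2}\right],$$ $$\widetilde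 F_2=-A_4\left[1+(1-\delta)^2\left(\frac{q_0q_1+4q_0q_2\delta+q_1q_2\delta^2}{Q^2}-\frac{u_3u_4}{S^2}\right)\right],$$ $$\widetilde F_3=-2\left[(1-\delta)A_4+\lambda^2\delta A_2\right].$$ Then: (1) At every point $(0,y,z)\in E_{p,\lambda}$ with $y,z$ real and $0\le y,z<1$, with $\delta=y^2/(1-z^2)^\lambda$, the frame $X,Y,Z$ is orthonormal for $g$ and $$R(X,\bar X,X,\bar X)=\frac{\widetilde H_1}{A_1^2},\qquad R(Y,\bar Y,Y,\bar Y)=\frac{\widetilde H_5}{A_2^2},\qquad R(Z,\bar Z,Z,\bar Z)=\frac{\widetilde F_3}{A_4^2},$$ $$R(X,\bar X,Y,\bar Y)=\frac{\widetilde H_2}{A_1A_2},\qquad R(X,\bar X,Z,\bar Z)=\frac{\widetilde F_1}{A_1A_4},\qquad R(Y,\bar Y,Z,\bar Z)=\frac{\widetilde F_2}{A_2A_4}.$$ Moreover, for $V,W\in\{X,Y,Z\}$, $R(V,\bar V,W,\bar W)=R(W,\bar W,V,\bar V)=R(V,\bar W,W,\bar V)$, and all other components vanish: for $V_1,V_2,V_3,V_4\in\{X,Y,Z\}$,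 $R(V_1,\bar V_2,V_3,\bar V_4)=0$ unless $V_1,V_3$ and $V_2,V_4$ agree as unordered pairs (with multiplicity). (2) Consequently the holomorphic sectional curvature stays bounded as such a point approaches the boundary: there is a constant $C=C(p,\lambda)$ such that $|R(v,\bar v,v,\bar v)|\le C$ for every such point $(0,y,z)\in E_{p,\lambda}$ and every $(1,0)$-vector $v$ at this point with $g(v,\bar v)=1$. -/

import Mathlib

open MeasureTheory

noncomputable section

namespace Bergman

/-! ### The Bergman kernel of a domain in `ℂⁿ` -/

/-- The Bergman space of `Ω`: classes in `L²(Ω)` (Lebesgue measure) that have a representative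
which is holomorphic on `Ω`. -/
def bergmanSpace {n : ℕ} (Ω : Set (Fin n → ℂ)) :
    Submodule ℂ (Lp ℂ 2 (volume.restrict Ω : Measure (Fin n → ℂ))) where
  carrier := {f | ∃ F : (Fin n → ℂ) → ℂ, DifferentiableOn ℂ F Ω ∧ f =ᵐ[volume.restrict Ω] F}
  add_mem' := by
    rintro f g ⟨F, hF, hfF⟩ ⟨G, hG, hgG⟩
    exact ⟨F + G, hF.add hG, (Lp.coeFn_add f g).trans (hfF.add hgG)⟩
  zero_mem' := ⟨0, differentiableOn_const 0, Lp.coeFn_zero ℂ 2 _⟩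
  smul_mem' := by
    rintro c f ⟨F, hF, hfF⟩
    exact ⟨c • F, hF.const_smul c, (Lp.coeFn_smul c f).trans (hfF.const_smul c)⟩

/-- The holomorphic function on `Ω` represented by an element of the Bergman space. -/
def holRep {n : ℕ} {Ω : Set (Fin n → ℂ)} (f : bergmanSpace Ω) : (Fin n → ℂ) → ℂ :=
  f.2.choose

/-- On an open set the holomorphic representative is unique. -/
theorem holRep_eqOn {n : ℕ} {Ω : Set (Fin n → ℂ)} (hΩ : IsOpen Ω) (f : bergmanSpace Ω)
    {F : (Fin n → ℂ) → ℂ} (hF : DifferentiableOn ℂ F Ω)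
    (h : (f : Lp ℂ 2 (volume.restrict Ω)) =ᵐ[volume.restrict Ω] F) :
    Set.EqOn (holRep f) F Ω :=
  Measure.eqOn_open_of_ae_eq (f.2.choose_spec.2.symm.trans h) hΩ
    f.2.choose_spec.1.continuousOn hF.continuousOn

/-- `s` is an orthonormal (Hilbert) basis of the Bergman space of `Ω`. -/
def IsOrthonormalBasis {n : ℕ} {Ω : Set (Fin n → ℂ)} (s : Set (bergmanSpace Ω)) : Prop :=
  Orthonormal ℂ (Subtype.val : s → bergmanSpace Ω) ∧
    (Submodule.span ℂ s).topologicalClosure = ⊤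

open Classical in
/-- The Bergman kernel on the diagonal, `B(z, z) = ∑ⱼ |eⱼ(z)|²`, for an orthonormal basis `(eⱼ)`
of the Bergman space; on `Ω` the value does not depend on the basis. -/
def bergmanKernel {n : ℕ} (Ω : Set (Fin n → ℂ)) (z : Fin n → ℂ) : ℝ :=
  if h : ∃ s : Set (bergmanSpace Ω), IsOrthonormalBasis s then
    ∑' f : h.choose, ‖holRep (f : bergmanSpace Ω) z‖ ^ 2
  else 0

/-! ### The Bergman metric and its curvature -/

/-- The Wirtinger derivative `∂f/∂zᵢ`. -/
def dz {n : ℕ} (i : Fin n) (f : (Fin n → ℂ) → ℂ) (z : Fin n → ℂ) : ℂ :=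
  (1 / 2) * (fderiv ℝ f z (Pi.single i 1) - Complex.I * fderiv ℝ f z (Pi.single i Complex.I))

/-- The Wirtinger derivative `∂f/∂z̄ᵢ`. -/
def dzbar {n : ℕ} (i : Fin n) (f : (Fin n → ℂ) → ℂ) (z : Fin n → ℂ) : ℂ :=
  (1 / 2) * (fderiv ℝ f z (Pi.single i 1) + Complex.I * fderiv ℝ f z (Pi.single i Complex.I))

/-- The Bergman metric `g_{i j̄} = ∂² log B / ∂zᵢ ∂z̄ⱼ`. -/
def bergmanMetric {n : ℕ} (Ω : Set (Fin n → ℂ)) (z : Fin n → ℂ) : Matrix (Fin n) (Fin n) ℂ :=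
  Matrix.of fun i j => dz i (dzbar j fun w => (Real.log (bergmanKernel Ω w) : ℂ)) z

/-- `g(u, v̄) = ∑ g_{i j̄} uᵢ v̄ⱼ` at the point `z`, for `(1,0)`-vectors `u = ∑ uᵢ ∂ᵢ`,
`v = ∑ vᵢ ∂ᵢ`. -/
def herm {n : ℕ} (g : (Fin n → ℂ) → Matrix (Fin n) (Fin n) ℂ) (z u v : Fin n → ℂ) : ℂ :=
  ∑ i, ∑ j, g z i j * u i * star (v j)

/-- `R_{i j̄ k l̄} = -∂ₖ∂̄ₗ g_{i j̄} + ∑_{a,b} g^{b ā} (∂ₖ g_{i ā}) (∂̄ₗ g_{b j̄})`, the components of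
the curvature tensor of the Chern connection of `g`. -/
def curvComp {n : ℕ} (g : (Fin n → ℂ) → Matrix (Fin n) (Fin n) ℂ) (z : Fin n → ℂ)
    (i j k l : Fin n) : ℂ :=
  -dz k (dzbar l fun w => g w i j) z +
    ∑ a, ∑ b, (g z)⁻¹ a b * dz k (fun w => g w i a) z * dzbar l (fun w => g w b j) z

/-- The curvature tensor `R(u, v̄, w, t̄)` at the point `z`. -/
def curv {n : ℕ} (g : (Fin n → ℂ) → Matrix (Fin n) (Fin n) ℂ) (z u v w t : Fin n → ℂ) : ℂ :=
  ∑ i, ∑ j, ∑ k, ∑ l, curvComp g z i j k l * u i * star (v j) * w k * star (t l)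

/-! ### The Gram–Schmidt frame of the coordinate fields on `ℂ³` -/

/-- `v / √g(v, v̄)`. -/
def normalize {n : ℕ} (g : (Fin n → ℂ) → Matrix (Fin n) (Fin n) ℂ) (z v : Fin n → ℂ) :
    Fin n → ℂ :=
  ((Real.sqrt (herm g z v v).re : ℝ) : ℂ)⁻¹ • v

/-- `X = ∂₁ / √g_{1 1̄}`. -/
def frameX (g : (Fin 3 → ℂ) → Matrix (Fin 3) (Fin 3) ℂ) (z : Fin 3 → ℂ) : Fin 3 → ℂ :=
  normalize g z (Pi.single 0 1)

/-- `Y`: with `v = ∂₂ / √g_{2 2̄}`, the normalization of `v - g(v, X̄) X`. -/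
def frameY (g : (Fin 3 → ℂ) → Matrix (Fin 3) (Fin 3) ℂ) (z : Fin 3 → ℂ) : Fin 3 → ℂ :=
  let v := normalize g z (Pi.single 1 1)
  normalize g z (v - herm g z v (frameX g z) • frameX g z)

/-- `Z`: with `v = ∂₃ / √g_{3 3̄}`, the normalization of `v - g(v, X̄) X - g(v, Ȳ) Y`. -/
def frameZ (g : (Fin 3 → ℂ) → Matrix (Fin 3) (Fin 3) ℂ) (z : Fin 3 → ℂ) : Fin 3 → ℂ :=
  let v := normalize g z (Pi.single 2 1)
  normalize g z
    (v - herm g z v (frameX g z) • frameX g z - herm g z v (frameY g z) • frameY g z)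

/-- The frame `(X, Y, Z)`. -/
def frame (g : (Fin 3 → ℂ) → Matrix (Fin 3) (Fin 3) ℂ) (z : Fin 3 → ℂ) :
    Fin 3 → (Fin 3 → ℂ) :=
  ![frameX g z, frameY g z, frameZ g z]

/-! ### The domain -/

/-- `E_{p,λ} = {(x, y, z) ∈ ℂ³ : (|x|^{2p} + |y|²)^{1/λ} + |z|² < 1}`. -/
def domainE (p lam : ℝ) : Set (Fin 3 → ℂ) :=
  {v | (‖v 0‖ ^ (2 * p) + ‖v 1‖ ^ 2) ^ (1 / lam) + ‖v 2‖ ^ 2 < 1}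

/-- The point `(0, y, z)`. -/
def pt (y z : ℝ) : Fin 3 → ℂ := ![0, (y : ℂ), (z : ℂ)]

/-! ### The explicit rational functions of `d = δ` -/

def u1 (p lam : ℝ) : ℝ := (p - 1) * (lam * (p - 1) + p)
def u2 (p lam : ℝ) : ℝ := p * (p - 1) * (lam - 1)
def u3 (p lam : ℝ) : ℝ := (p + 1) * (lam + lam * p + p)
def u4 (p lam : ℝ) : ℝ := p * (p + 1) * (lam - 1)
def u5 (p lam : ℝ) : ℝ := -2 * (lam * (p ^ 2 - 2) + p ^ 2)
def u6 (p lam : ℝ) : ℝ := -2 * (lam - 1) * p ^ 2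

/-- `S = u₃ + u₄ δ`. -/
def S (p lam d : ℝ) : ℝ := u3 p lam + u4 p lam * d

def A1 (p lam d : ℝ) : ℝ := (u5 p lam + u6 p lam * d) / S p lam d + 4

def A2 (p lam d : ℝ) : ℝ :=
  1 / p + 3 + u3 p lam * u4 p lam * (1 - d) ^ 2 / S p lam d ^ 2

def q0 (p lam : ℝ) : ℝ :=
  p ^ 2 * lam ^ 2 + 3 * p ^ 2 * lam + 2 * p ^ 2 + 2 * p * lam ^ 2 + 3 * p * lam + lam ^ 2
def q1 (p lam : ℝ) : ℝ := p * (lam - 1) * (4 * p * lam + 4 * p + 3 * lam)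
def q2 (p lam : ℝ) : ℝ := p ^ 2 * (lam - 2) * (lam - 1)

/-- `Q = q₀ + q₁ δ + q₂ δ²`, the numerator of `A₄`. -/
def Q (p lam d : ℝ) : ℝ := q0 p lam + q1 p lam * d + q2 p lam * d ^ 2

def A4 (p lam d : ℝ) : ℝ := Q p lam d / (p * (d * p * (lam - 1) + p * lam + p + lam))

/-- `H̃₁` -/
def H1 (p lam d : ℝ) : ℝ :=
  -(8 + 4 * ((u1 p lam + u2 p lam * d) / S p lam d)
    - 2 * ((u5 p lam + u6 p lam * d) ^ 2 / S p lam d ^ 2))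

/-- `e₀ + e₁ δ` is the numerator of `A₁`. -/
def e0 (p lam : ℝ) : ℝ := u5 p lam + 4 * u3 p lam
def e1 (p lam : ℝ) : ℝ := u6 p lam + 4 * u4 p lam

/-- `H̃₂` -/
def H2 (p lam d : ℝ) : ℝ :=
  -A1 p lam d * (1 / p + (1 - d) ^ 2 *
    (e0 p lam * e1 p lam / (e0 p lam + e1 p lam * d) ^ 2
      - u3 p lam * u4 p lam / S p lam d ^ 2))

/-- `H̃₅` -/
def H5 (p lam d : ℝ) : ℝ :=
  -2 * A2 p lam d - (1 - d) ^ 2 *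
    (2 * u3 p lam * u4 p lam * (u3 p lam + u4 p lam) *
        (u3 p lam * (2 * d - 1) + u4 p lam * d * (2 - d)) / S p lam d ^ 4
      - 4 * d * (1 - d) ^ 2 * u3 p lam ^ 2 * u4 p lam ^ 2 * (u3 p lam + u4 p lam) ^ 2 /
        (S p lam d ^ 6 * A2 p lam d))

/-- `F̃₁` -/
def F1 (p lam d : ℝ) : ℝ :=
  -lam * (A1 p lam d / p + d * (1 - d) *
    (u3 p lam * u6 p lam - u4 p lam * u5 p lam) / S p lam d ^ 2)

/-- `F̃₂` -/
def F2 (p lam d : ℝ) : ℝ :=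
  -A4 p lam d * (1 + (1 - d) ^ 2 *
    ((q0 p lam * q1 p lam + 4 * q0 p lam * q2 p lam * d + q1 p lam * q2 p lam * d ^ 2) /
        Q p lam d ^ 2
      - u3 p lam * u4 p lam / S p lam d ^ 2))

/-- `F̃₃` -/
def F3 (p lam d : ℝ) : ℝ :=
  -2 * ((1 - d) * A4 p lam d + lam ^ 2 * d * A2 p lam d)

end Bergman

end

open scoped ContDiff ComplexConjugate

namespace Bergman

/-! ### Wirtinger derivatives of functions of the squared moduli -/

/-! The domain is complete Reinhardt, so the normalized monomials form an orthonormal basis of the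
Bergman space and `B = ∑ |xᵃyᵇzᶜ|² / ‖xᵃyᵇzᶜ‖²`. The norms are products of Beta functions
(`lintegral_domainE`). Let `r, s, t` be the squared moduli, `σ = s(1-t)^(-λ)`, `ξ =
r(1-t)^(-λ/p)(1-σ)^(-1/p)` and `τ = p(1+σ(λ-1))`. Summing over `c`, then `b`, then `a`
(`hasSum_mono_div`), `B` is a constant times `(1-t)^(-(2+λ+λ/p)) (1-σ)^(-(3+1/p)) ∑ₙ
(n+1)(n+1+p)(λ(n+1+p)+τ) ξⁿ`, and the last series is a polynomial in `1/(1-ξ)`. Completeness of the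
monomials rests on the power series expansion `exists_powerSeries`; independence of the kernel from
the basis rests on Parseval's identity for the vector representing evaluation at a point
(`bergmanKernel_eq`).

Hence `log B = φ(r,s,t)`, and the metric and its derivatives are polynomials in the coordinates,
their conjugates and the partial derivatives of `φ`. At `x = 0` only the expansion of `φ` to second
order in `r` matters: `φ = C - c log(1-t) + h(σ) + r(1-t)^(-λ/p) a(σ) + r² m/2 + …`. The vectors
`∂₁`, `∂₂`, `∂₃ - λyz/(1-z²) ∂₂` are orthogonal there; the third is tangent to the level sets of
`σ`. In this frame the curvature is an explicit expression in derivatives of `h` and `a`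
(`curv_eq`). Gram–Schmidt only normalizes the frame (`frame_eq_of_orthogonal`). Up to elementary
factors, `A₁`, `A₂`, `A₄` are the squared lengths of the three vectors, and the identities `H1_eq`,
`H2_eq`, `H5_eq`, `F1_eq`, `F2_eq`, `F3_eq` turn the six nonzero components into the stated
quotients.

Geometrically, the automorphisms that move `z` by a disc automorphism and rescale `x` and `y` reduce
to `z = 0`, which is why only `δ` enters; invariance under rotations of `x` and `z` then forces the
vanishing of the other components. The proof checks both facts by computation.

For the bound, `A₁`, `A₂`, `A₄` and all other denominators stay positive on the closed interval `0 ≤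
δ ≤ 1`, so the curvature components are bounded by compactness, and a unit vector has coefficients
of modulus at most one in an orthonormal frame. -/

/-- The vector of squared moduli `(|z₁|², …, |zₙ|²)`. -/
def sqMod {n : ℕ} (z : Fin n → ℂ) : Fin n → ℝ := fun i => Complex.normSq (z i)

/-- The partial derivative `∂φ/∂vᵢ` of a function of real variables. -/
noncomputable def pd {n : ℕ} (i : Fin n) (φ : (Fin n → ℝ) → ℝ) (v : Fin n → ℝ) : ℝ :=
  fderiv ℝ φ v (Pi.single i 1)

theorem hasFDerivAt_sqMod {n : ℕ} (z : Fin n → ℂ) :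
    HasFDerivAt (sqMod (n := n)) (ContinuousLinearMap.pi fun i =>
      ((2 * (z i).re) • Complex.reCLM + (2 * (z i).im) • Complex.imCLM).comp
        (ContinuousLinearMap.proj (R := ℝ) (φ := fun _ : Fin n => ℂ) i)) z := by
  rw [hasFDerivAt_pi]
  intro i
  have h1 : HasFDerivAt (fun w : Fin n → ℂ => (w i).re) (Complex.reCLM.comp
      (ContinuousLinearMap.proj (R := ℝ) (φ := fun _ : Fin n => ℂ) i)) z :=
    (Complex.reCLM.comp (ContinuousLinearMap.proj (R := ℝ) (φ := fun _ : Fin n => ℂ) i)).hasFDerivAt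
  have h2 : HasFDerivAt (fun w : Fin n → ℂ => (w i).im) (Complex.imCLM.comp
      (ContinuousLinearMap.proj (R := ℝ) (φ := fun _ : Fin n => ℂ) i)) z :=
    (Complex.imCLM.comp (ContinuousLinearMap.proj (R := ℝ) (φ := fun _ : Fin n => ℂ) i)).hasFDerivAt
  have h := (h1.mul h1).add (h2.mul h2)
  refine HasFDerivAt.congr_fderiv (h.congr_of_eventuallyEq (Filter.Eventually.of_forall fun w => ?_)) ?_
  · simp [sqMod, Complex.normSq_apply]
  · ext w
    simp
    ring

theorem hasFDerivAt_ofReal_comp_sqMod {n : ℕ} {φ : (Fin n → ℝ) → ℝ} {z : Fin n → ℂ}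
    (h : DifferentiableAt ℝ φ (sqMod z)) :
    HasFDerivAt (fun w => (φ (sqMod w) : ℂ)) (Complex.ofRealCLM.comp ((fderiv ℝ φ (sqMod z)).comp
      (ContinuousLinearMap.pi fun i =>
      ((2 * (z i).re) • Complex.reCLM + (2 * (z i).im) • Complex.imCLM).comp
        (ContinuousLinearMap.proj (R := ℝ) (φ := fun _ : Fin n => ℂ) i)))) z :=
  (Complex.ofRealCLM.hasFDerivAt (x := φ (sqMod z))).comp z
    (h.hasFDerivAt.comp z (hasFDerivAt_sqMod z))

theorem fderiv_ofReal_comp_sqMod_single {n : ℕ} {φ : (Fin n → ℝ) → ℝ} {z : Fin n → ℂ}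
    (h : DifferentiableAt ℝ φ (sqMod z)) (i : Fin n) (c : ℂ) :
    fderiv ℝ (fun w => (φ (sqMod w) : ℂ)) z (Pi.single i c) =
      ((2 * (z i).re * c.re + 2 * (z i).im * c.im : ℝ) : ℂ) * pd i φ (sqMod z) := by
  rw [(hasFDerivAt_ofReal_comp_sqMod h).fderiv]
  have : (ContinuousLinearMap.pi fun i =>
      ((2 * (z i).re) • Complex.reCLM + (2 * (z i).im) • Complex.imCLM).comp
        (ContinuousLinearMap.proj (R := ℝ) (φ := fun _ : Fin n => ℂ) i)) (Pi.single i c) =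
      (2 * (z i).re * c.re + 2 * (z i).im * c.im) • (Pi.single i (1 : ℝ) : Fin n → ℝ) := by
    ext j
    by_cases hj : j = i
    · subst hj; simp
    · simp [hj]
  simp only [ContinuousLinearMap.comp_apply, this, map_smul, pd]
  simp

/-- Chain rule with `∂|zᵢ|²/∂zᵢ = z̄ᵢ`; the other squared moduli do not involve `zᵢ`. -/
theorem dz_ofReal_comp_sqMod {n : ℕ} {φ : (Fin n → ℝ) → ℝ} {z : Fin n → ℂ}
    (h : DifferentiableAt ℝ φ (sqMod z)) (i : Fin n) :
    dz i (fun w => (φ (sqMod w) : ℂ)) z = conj (z i) * pd i φ (sqMod z) := by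
  rw [dz, fderiv_ofReal_comp_sqMod_single h, fderiv_ofReal_comp_sqMod_single h,
    ← Complex.re_add_im (conj (z i))]
  push_cast
  simp
  ring

theorem dzbar_ofReal_comp_sqMod {n : ℕ} {φ : (Fin n → ℝ) → ℝ} {z : Fin n → ℂ}
    (h : DifferentiableAt ℝ φ (sqMod z)) (i : Fin n) :
    dzbar i (fun w => (φ (sqMod w) : ℂ)) z = z i * pd i φ (sqMod z) := by
  rw [dzbar, fderiv_ofReal_comp_sqMod_single h, fderiv_ofReal_comp_sqMod_single h]
  have h := Complex.re_add_im (z i)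
  push_cast
  simp only [Complex.one_re, Complex.one_im, Complex.I_re, Complex.I_im, Complex.ofReal_one,
    Complex.ofReal_zero]
  linear_combination (pd i φ (sqMod z) : ℂ) * h

theorem dz_congr {n : ℕ} {f g : (Fin n → ℂ) → ℂ} {z : Fin n → ℂ} (h : f =ᶠ[nhds z] g)
    (i : Fin n) : dz i f z = dz i g z := by
  simp only [dz, h.fderiv_eq]

theorem dzbar_congr {n : ℕ} {f g : (Fin n → ℂ) → ℂ} {z : Fin n → ℂ} (h : f =ᶠ[nhds z] g)
    (i : Fin n) : dzbar i f z = dzbar i g z := by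
  simp only [dzbar, h.fderiv_eq]

theorem dz_add {n : ℕ} {f g : (Fin n → ℂ) → ℂ} {z : Fin n → ℂ} (hf : DifferentiableAt ℝ f z)
    (hg : DifferentiableAt ℝ g z) (i : Fin n) :
    dz i (fun w => f w + g w) z = dz i f z + dz i g z := by
  simp only [dz, fderiv_fun_add hf hg, add_apply]
  ring

theorem dzbar_add {n : ℕ} {f g : (Fin n → ℂ) → ℂ} {z : Fin n → ℂ} (hf : DifferentiableAt ℝ f z)
    (hg : DifferentiableAt ℝ g z) (i : Fin n) :
    dzbar i (fun w => f w + g w) z = dzbar i f z + dzbar i g z := by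
  simp only [dzbar, fderiv_fun_add hf hg, add_apply]
  ring

theorem dz_mul {n : ℕ} {f g : (Fin n → ℂ) → ℂ} {z : Fin n → ℂ} (hf : DifferentiableAt ℝ f z)
    (hg : DifferentiableAt ℝ g z) (i : Fin n) :
    dz i (fun w => f w * g w) z = dz i f z * g z + f z * dz i g z := by
  simp only [dz, fderiv_fun_mul hf hg, add_apply, smul_apply, smul_eq_mul]
  ring

theorem dzbar_mul {n : ℕ} {f g : (Fin n → ℂ) → ℂ} {z : Fin n → ℂ} (hf : DifferentiableAt ℝ f z)
    (hg : DifferentiableAt ℝ g z) (i : Fin n) :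
    dzbar i (fun w => f w * g w) z = dzbar i f z * g z + f z * dzbar i g z := by
  simp only [dzbar, fderiv_fun_mul hf hg, add_apply, smul_apply, smul_eq_mul]
  ring

theorem hasFDerivAt_coord {n : ℕ} (z : Fin n → ℂ) (j : Fin n) :
    HasFDerivAt (fun w : Fin n → ℂ => w j)
      (ContinuousLinearMap.proj (R := ℝ) (φ := fun _ : Fin n => ℂ) j) z :=
  (ContinuousLinearMap.proj (R := ℝ) (φ := fun _ : Fin n => ℂ) j).hasFDerivAt

theorem hasFDerivAt_conj_coord {n : ℕ} (z : Fin n → ℂ) (j : Fin n) :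
    HasFDerivAt (fun w : Fin n → ℂ => conj (w j))
      ((Complex.conjCLE : ℂ →L[ℝ] ℂ).comp
        (ContinuousLinearMap.proj (R := ℝ) (φ := fun _ : Fin n => ℂ) j)) z :=
  ((Complex.conjCLE : ℂ →L[ℝ] ℂ).comp
    (ContinuousLinearMap.proj (R := ℝ) (φ := fun _ : Fin n => ℂ) j)).hasFDerivAt

theorem dz_coord {n : ℕ} (z : Fin n → ℂ) (i j : Fin n) :
    dz i (fun w => w j) z = if i = j then 1 else 0 := by
  rw [dz, (hasFDerivAt_coord z j).fderiv]
  by_cases h : i = j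
  · subst h; norm_num
  · simp [h, Ne.symm h]

theorem dzbar_coord {n : ℕ} (z : Fin n → ℂ) (i j : Fin n) :
    dzbar i (fun w => w j) z = 0 := by
  rw [dzbar, (hasFDerivAt_coord z j).fderiv]
  by_cases h : i = j
  · subst h; norm_num
  · simp [Ne.symm h]

theorem dz_conj_coord {n : ℕ} (z : Fin n → ℂ) (i j : Fin n) :
    dz i (fun w => conj (w j)) z = 0 := by
  rw [dz, (hasFDerivAt_conj_coord z j).fderiv]
  by_cases h : i = j
  · subst h; norm_num
  · simp [Ne.symm h]

theorem dzbar_conj_coord {n : ℕ} (z : Fin n → ℂ) (i j : Fin n) :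
    dzbar i (fun w => conj (w j)) z = if i = j then 1 else 0 := by
  rw [dzbar, (hasFDerivAt_conj_coord z j).fderiv]
  by_cases h : i = j
  · subst h; norm_num
  · simp [h, Ne.symm h]

theorem dz_const {n : ℕ} (z : Fin n → ℂ) (i : Fin n) (c : ℂ) : dz i (fun _ => c) z = 0 := by
  simp [dz]

theorem dzbar_const {n : ℕ} (z : Fin n → ℂ) (i : Fin n) (c : ℂ) : dzbar i (fun _ => c) z = 0 := by
  simp [dzbar]

theorem contDiffAt_pd {n : ℕ} {φ : (Fin n → ℝ) → ℝ} {v : Fin n → ℝ} (h : ContDiffAt ℝ ∞ φ v)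
    (i : Fin n) : ContDiffAt ℝ ∞ (pd i φ) v :=
  (h.fderiv_right (m := ∞) (by simp)).clm_apply contDiffAt_const

theorem pd_comm {n : ℕ} {φ : (Fin n → ℝ) → ℝ} {v : Fin n → ℝ} (h : ContDiffAt ℝ ∞ φ v)
    (i j : Fin n) : pd i (pd j φ) v = pd j (pd i φ) v := by
  have hd : DifferentiableAt ℝ (fderiv ℝ φ) v :=
    (h.fderiv_right (m := ∞) (by simp)).differentiableAt (by simp)
  have hsym : IsSymmSndFDerivAt ℝ φ v := h.isSymmSndFDerivAt (by simpa using (WithTop.coe_le_coe.2 (le_top : (2 : ℕ∞) ≤ ⊤)))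
  have key : ∀ a b : Fin n, Bergman.pd a (Bergman.pd b φ) v =
      fderiv ℝ (fderiv ℝ φ) v (Pi.single a 1) (Pi.single b 1) := by
    intro a b
    have : Bergman.pd b φ = fun w => fderiv ℝ φ w (Pi.single b 1) := rfl
    rw [Bergman.pd, this, fderiv_clm_apply hd (by fun_prop)]
    simp
  rw [key, key, hsym.eq]

/-- The function `z ↦ φ(|z₁|², …, |zₙ|²)` on an open set `U`. -/
structure IsRadialOn {n : ℕ} (U : Set (Fin n → ℂ)) (φ : (Fin n → ℝ) → ℝ) : Prop where
  isOpen : IsOpen U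
  contDiffAt : ∀ z ∈ U, ContDiffAt ℝ ∞ φ (sqMod z)

namespace IsRadialOn

variable {n : ℕ} {U : Set (Fin n → ℂ)} {φ : (Fin n → ℝ) → ℝ}

theorem pd (h : IsRadialOn U φ) (i : Fin n) : IsRadialOn U (pd i φ) :=
  ⟨h.isOpen, fun z hz => contDiffAt_pd (h.contDiffAt z hz) i⟩

theorem differentiableAt (h : IsRadialOn U φ) {z : Fin n → ℂ} (hz : z ∈ U) :
    DifferentiableAt ℝ φ (sqMod z) := (h.contDiffAt z hz).differentiableAt (by simp)

theorem differentiableAt_comp (h : IsRadialOn U φ) {z : Fin n → ℂ} (hz : z ∈ U) :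
    DifferentiableAt ℝ (fun w => (φ (sqMod w) : ℂ)) z :=
  (hasFDerivAt_ofReal_comp_sqMod (h.differentiableAt hz)).differentiableAt

theorem dzbar_comp (h : IsRadialOn U φ) {z : Fin n → ℂ} (hz : z ∈ U) (i : Fin n) :
    dzbar i (fun w => (φ (sqMod w) : ℂ)) z = z i * Bergman.pd i φ (sqMod z) :=
  dzbar_ofReal_comp_sqMod (h.differentiableAt hz) i

theorem dz_comp (h : IsRadialOn U φ) {z : Fin n → ℂ} (hz : z ∈ U) (i : Fin n) :
    dz i (fun w => (φ (sqMod w) : ℂ)) z = conj (z i) * Bergman.pd i φ (sqMod z) :=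
  dz_ofReal_comp_sqMod (h.differentiableAt hz) i

/-- Product rule applied to `zⱼ ∂ⱼφ`. The higher derivatives below follow the same pattern: a
derivative either hits an explicit coordinate, which gives a Kronecker symbol, or it hits a partial
of `φ`, which gives one more partial and one more coordinate factor. -/
theorem dz_dzbar (h : IsRadialOn U φ) {z : Fin n → ℂ} (hz : z ∈ U) (i j : Fin n) :
    dz i (dzbar j fun w => (φ (sqMod w) : ℂ)) z =
      (if i = j then (Bergman.pd j φ (sqMod z) : ℂ) else 0) +
        conj (z i) * z j * Bergman.pd i (Bergman.pd j φ) (sqMod z) := by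
  have h1 : (dzbar j fun w => (φ (sqMod w) : ℂ)) =ᶠ[nhds z]
      fun w => w j * (Bergman.pd j φ (sqMod w) : ℂ) := by
    filter_upwards [h.isOpen.mem_nhds hz] with w hw using h.dzbar_comp hw j
  rw [dz_congr h1, dz_mul (hasFDerivAt_coord z j).differentiableAt
    ((h.pd j).differentiableAt_comp hz), dz_coord, (h.pd j).dz_comp hz]
  split_ifs <;> ring

theorem differentiableAt_entry (h : IsRadialOn U φ) {z : Fin n → ℂ} (hz : z ∈ U) (i j : Fin n) :
    DifferentiableAt ℝ (fun w : Fin n → ℂ => conj (w i) * w j *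
      (Bergman.pd i (Bergman.pd j φ) (sqMod w) : ℂ)) z :=
  ((hasFDerivAt_conj_coord z i).differentiableAt.fun_mul (hasFDerivAt_coord z j).differentiableAt).fun_mul
    (((h.pd j).pd i).differentiableAt_comp hz)

/-- `∂ₖ` of the metric with potential `φ(|z₁|², …, |zₙ|²)`. -/
theorem dz_metric (h : IsRadialOn U φ) {g : (Fin n → ℂ) → ℂ} {z : Fin n → ℂ} (hz : z ∈ U)
    (i j k : Fin n)
    (hg : ∀ w ∈ U, g w = dz i (dzbar j fun w => (φ (sqMod w) : ℂ)) w) :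
    dz k g z = (if i = j then conj (z k) * (Bergman.pd k (Bergman.pd j φ) (sqMod z) : ℂ) else 0) +
        ((if k = j then conj (z i) * (Bergman.pd i (Bergman.pd j φ) (sqMod z) : ℂ) else 0) +
        conj (z i) * z j * conj (z k) *
          Bergman.pd k (Bergman.pd i (Bergman.pd j φ)) (sqMod z)) := by
  have h1 : g =ᶠ[nhds z] fun w => (if i = j then (Bergman.pd j φ (sqMod w) : ℂ) else 0) +
        conj (w i) * w j * Bergman.pd i (Bergman.pd j φ) (sqMod w) := by
    filter_upwards [h.isOpen.mem_nhds hz] with w hw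
    rw [hg w hw, h.dz_dzbar hw]
  have hA : DifferentiableAt ℝ
      (fun w => (if i = j then (Bergman.pd j φ (sqMod w) : ℂ) else 0)) z := by
    split_ifs
    · exact (h.pd j).differentiableAt_comp hz
    · exact differentiableAt_const _
  have hA' : dz k (fun w => (if i = j then (Bergman.pd j φ (sqMod w) : ℂ) else 0)) z =
      if i = j then conj (z k) * (Bergman.pd k (Bergman.pd j φ) (sqMod z) : ℂ) else 0 := by
    split_ifs
    · exact (h.pd j).dz_comp hz k
    · exact dz_const _ _ _
  rw [dz_congr h1, dz_add hA (h.differentiableAt_entry hz i j), hA', dz_mul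
    ((hasFDerivAt_conj_coord z i).differentiableAt.fun_mul (hasFDerivAt_coord z j).differentiableAt)
    (((h.pd j).pd i).differentiableAt_comp hz), dz_mul
    (hasFDerivAt_conj_coord z i).differentiableAt (hasFDerivAt_coord z j).differentiableAt,
    dz_conj_coord, dz_coord, ((h.pd j).pd i).dz_comp hz]
  split_ifs <;> ring

/-- `∂̄ₗ` of the metric with potential `φ(|z₁|², …, |zₙ|²)`. -/
theorem dzbar_metric (h : IsRadialOn U φ) {g : (Fin n → ℂ) → ℂ} {z : Fin n → ℂ} (hz : z ∈ U)
    (i j l : Fin n)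
    (hg : ∀ w ∈ U, g w = dz i (dzbar j fun w => (φ (sqMod w) : ℂ)) w) :
    dzbar l g z = (if i = j then z l * (Bergman.pd l (Bergman.pd j φ) (sqMod z) : ℂ) else 0) +
        ((if l = i then z j * (Bergman.pd i (Bergman.pd j φ) (sqMod z) : ℂ) else 0) +
        conj (z i) * z j * z l *
          Bergman.pd l (Bergman.pd i (Bergman.pd j φ)) (sqMod z)) := by
  have h1 : g =ᶠ[nhds z] fun w => (if i = j then (Bergman.pd j φ (sqMod w) : ℂ) else 0) +
        conj (w i) * w j * Bergman.pd i (Bergman.pd j φ) (sqMod w) := by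
    filter_upwards [h.isOpen.mem_nhds hz] with w hw
    rw [hg w hw, h.dz_dzbar hw]
  have hA : DifferentiableAt ℝ
      (fun w => (if i = j then (Bergman.pd j φ (sqMod w) : ℂ) else 0)) z := by
    split_ifs
    · exact (h.pd j).differentiableAt_comp hz
    · exact differentiableAt_const _
  have hA' : dzbar l (fun w => (if i = j then (Bergman.pd j φ (sqMod w) : ℂ) else 0)) z =
      if i = j then z l * (Bergman.pd l (Bergman.pd j φ) (sqMod z) : ℂ) else 0 := by
    split_ifs
    · exact (h.pd j).dzbar_comp hz l
    · exact dzbar_const _ _ _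
  rw [dzbar_congr h1, dzbar_add hA (h.differentiableAt_entry hz i j), hA', dzbar_mul
    ((hasFDerivAt_conj_coord z i).differentiableAt.fun_mul (hasFDerivAt_coord z j).differentiableAt)
    (((h.pd j).pd i).differentiableAt_comp hz), dzbar_mul
    (hasFDerivAt_conj_coord z i).differentiableAt (hasFDerivAt_coord z j).differentiableAt,
    dzbar_conj_coord, dzbar_coord, ((h.pd j).pd i).dzbar_comp hz]
  split_ifs <;> ring

/-- `∂ₖ∂̄ₗ` of the metric with potential `φ(|z₁|², …, |zₙ|²)`. -/
theorem dz_dzbar_metric (h : IsRadialOn U φ) {g : (Fin n → ℂ) → ℂ} {z : Fin n → ℂ} (hz : z ∈ U)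
    (i j k l : Fin n)
    (hg : ∀ w ∈ U, g w = dz i (dzbar j fun w => (φ (sqMod w) : ℂ)) w) :
    dz k (dzbar l g) z =
      (if i = j then (if k = l then (Bergman.pd l (Bergman.pd j φ) (sqMod z) : ℂ) else 0) +
        conj (z k) * z l * Bergman.pd k (Bergman.pd l (Bergman.pd j φ)) (sqMod z) else 0) +
      ((if l = i then (if k = j then (Bergman.pd i (Bergman.pd j φ) (sqMod z) : ℂ) else 0) +
        conj (z k) * z j * Bergman.pd k (Bergman.pd i (Bergman.pd j φ)) (sqMod z) else 0) +
      ((if k = j then conj (z i) * z l *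
          (Bergman.pd l (Bergman.pd i (Bergman.pd j φ)) (sqMod z) : ℂ) else 0) +
       (if k = l then conj (z i) * z j *
          (Bergman.pd l (Bergman.pd i (Bergman.pd j φ)) (sqMod z) : ℂ) else 0) +
        conj (z i) * z j * z l * conj (z k) *
          Bergman.pd k (Bergman.pd l (Bergman.pd i (Bergman.pd j φ))) (sqMod z))) := by
  have h1 : dzbar l g =ᶠ[nhds z] fun w =>
      (if i = j then w l * (Bergman.pd l (Bergman.pd j φ) (sqMod w) : ℂ) else 0) +
        ((if l = i then w j * (Bergman.pd i (Bergman.pd j φ) (sqMod w) : ℂ) else 0) +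
        conj (w i) * w j * w l *
          Bergman.pd l (Bergman.pd i (Bergman.pd j φ)) (sqMod w)) := by
    filter_upwards [h.isOpen.mem_nhds hz] with w hw using h.dzbar_metric hw i j l hg
  have hc := fun m => (hasFDerivAt_coord z m).differentiableAt
  have hb := fun m => (hasFDerivAt_conj_coord z m).differentiableAt
  -- The two conditional terms of `∂̄ₗ g` have the same shape, so both are differentiated at once.
  have key : ∀ (P : Prop) [Decidable P] (a b c : Fin n),
      DifferentiableAt ℝ (fun w : Fin n → ℂ =>
        (if P then w a * (Bergman.pd b (Bergman.pd c φ) (sqMod w) : ℂ) else 0)) z ∧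
      dz k (fun w : Fin n → ℂ =>
        (if P then w a * (Bergman.pd b (Bergman.pd c φ) (sqMod w) : ℂ) else 0)) z =
      (if P then (if k = a then (Bergman.pd b (Bergman.pd c φ) (sqMod z) : ℂ) else 0) +
        conj (z k) * z a * Bergman.pd k (Bergman.pd b (Bergman.pd c φ)) (sqMod z) else 0) := by
    intro P _ a b c
    split_ifs with hP hk
    · refine ⟨(hc a).fun_mul (((h.pd c).pd b).differentiableAt_comp hz), ?_⟩
      rw [dz_mul (hc a) (((h.pd c).pd b).differentiableAt_comp hz), dz_coord, if_pos hk,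
        ((h.pd c).pd b).dz_comp hz]
      ring
    · refine ⟨(hc a).fun_mul (((h.pd c).pd b).differentiableAt_comp hz), ?_⟩
      rw [dz_mul (hc a) (((h.pd c).pd b).differentiableAt_comp hz), dz_coord, if_neg hk,
        ((h.pd c).pd b).dz_comp hz]
      ring
    · exact ⟨differentiableAt_const _, dz_const _ _ _⟩
  have hlast := (((h.pd j).pd i).pd l).differentiableAt_comp hz
  have h3 := ((hb i).fun_mul (hc j)).fun_mul (hc l)
  have h4 := h3.fun_mul hlast
  rw [dz_congr h1, dz_add (key _ l l j).1 ((key _ j i j).1.fun_add h4), (key _ l l j).2,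
    dz_add (key _ j i j).1 h4, (key _ j i j).2, dz_mul h3 hlast, dz_mul ((hb i).fun_mul (hc j)) (hc l),
    dz_mul (hb i) (hc j), dz_conj_coord, dz_coord, dz_coord, (((h.pd j).pd i).pd l).dz_comp hz]
  congr 2
  split_ifs <;> ring

end IsRadialOn

/-! ### Algebra of the curvature tensor at a real point -/

/-- The metric with potential `φ(|z₁|², …)` at a real point `x`, in terms of the partial
derivatives `D₁, D₂` of `φ`. -/
def jetG {n : ℕ} (x : Fin n → ℝ) (D1 : Fin n → ℝ) (D2 : Fin n → Fin n → ℝ) (i j : Fin n) : ℝ :=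
  (if i = j then D1 j else 0) + x i * x j * D2 i j

/-- First derivatives `∂ₖ g_{i j̄}` at a real point. -/
def jetT {n : ℕ} (x : Fin n → ℝ) (D2 : Fin n → Fin n → ℝ) (D3 : Fin n → Fin n → Fin n → ℝ)
    (k i j : Fin n) : ℝ :=
  (if i = j then x k * D2 k j else 0) +
    ((if k = j then x i * D2 i j else 0) + x i * x j * x k * D3 k i j)

/-- First derivatives `∂̄ₗ g_{i j̄}` at a real point. -/
def jetTbar {n : ℕ} (x : Fin n → ℝ) (D2 : Fin n → Fin n → ℝ) (D3 : Fin n → Fin n → Fin n → ℝ)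
    (l i j : Fin n) : ℝ :=
  (if i = j then x l * D2 l j else 0) +
    ((if l = i then x j * D2 i j else 0) + x i * x j * x l * D3 l i j)

/-- Second derivatives `∂ₖ∂̄ₗ g_{i j̄}` at a real point. -/
def jetQ {n : ℕ} (x : Fin n → ℝ) (D2 : Fin n → Fin n → ℝ) (D3 : Fin n → Fin n → Fin n → ℝ)
    (D4 : Fin n → Fin n → Fin n → Fin n → ℝ) (i j k l : Fin n) : ℝ :=
  (if i = j then (if k = l then D2 l j else 0) + x k * x l * D3 k l j else 0) +
    ((if l = i then (if k = j then D2 i j else 0) + x k * x j * D3 k i j else 0) +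
      ((if k = j then x i * x l * D3 l i j else 0) + (if k = l then x i * x j * D3 l i j else 0) +
        x i * x j * x l * x k * D4 k l i j))

/-- The curvature at a real point, for a metric with inverse `∑ W_ε W_εᵀ / n_ε`. -/
noncomputable def jetR {n : ℕ} (x : Fin n → ℝ) (D2 : Fin n → Fin n → ℝ) (D3 : Fin n → Fin n → Fin n → ℝ)
    (D4 : Fin n → Fin n → Fin n → Fin n → ℝ) (W : Fin n → Fin n → ℝ) (N : Fin n → ℝ)
    (i j k l : Fin n) : ℝ :=
  -jetQ x D2 D3 D4 i j k l +
    ∑ a, ∑ b, (∑ e, W e a * W e b / N e) * jetT x D2 D3 k i a * jetTbar x D2 D3 l b j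

theorem sum_mul_sum_four {n : ℕ} (A B : Fin n → Fin n → ℝ) (u v w t : Fin n → ℝ) (c : ℝ) :
    ∑ i, ∑ j, ∑ k, ∑ l, (A k i * B l j * c) * u i * v j * w k * t l =
      (∑ i, ∑ k, A k i * u i * w k) * (∑ j, ∑ l, B l j * v j * t l) * c := by
  rw [Finset.sum_mul, Finset.sum_mul]
  refine Finset.sum_congr rfl fun i _ => ?_
  rw [Finset.sum_comm, Finset.sum_mul, Finset.sum_mul]
  refine Finset.sum_congr rfl fun k _ => ?_
  rw [Finset.mul_sum, Finset.sum_mul]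
  refine Finset.sum_congr rfl fun j _ => ?_
  rw [Finset.mul_sum, Finset.sum_mul]
  refine Finset.sum_congr rfl fun l _ => ?_
  ring

/-- For an inverse metric `∑ₑ Wₑ Wₑᵀ / Nₑ` the double contraction in the curvature becomes a single
sum over the frame, so `∂g` is needed only in frame components. -/
theorem sum_inverse_contract {n : ℕ} (W : Fin n → Fin n → ℝ) (N : Fin n → ℝ) (A B : Fin n → ℝ) :
    ∑ a, ∑ b, (∑ e, W e a * W e b / N e) * A a * B b =
      ∑ e, (∑ a, W e a * A a) * (∑ b, W e b * B b) * (N e)⁻¹ := by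
  simp only [Finset.sum_mul]
  rw [Finset.sum_congr rfl fun a _ => Finset.sum_comm, Finset.sum_comm]
  refine Finset.sum_congr rfl fun e _ => ?_
  refine Finset.sum_congr rfl fun a _ => ?_
  rw [Finset.mul_sum, Finset.sum_mul]
  refine Finset.sum_congr rfl fun b _ => ?_
  ring

theorem sum_sum_sum_comm {n : ℕ} (f : Fin n → Fin n → Fin n → ℝ) :
    ∑ i, ∑ k, ∑ a, f i k a = ∑ a, ∑ i, ∑ k, f i k a := by
  rw [Finset.sum_congr rfl fun i _ => Finset.sum_comm, Finset.sum_comm]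

/-- The components of the curvature in the orthogonal frame `W`. -/
theorem jetR_contract {n : ℕ} (x : Fin n → ℝ) (D2 : Fin n → Fin n → ℝ)
    (D3 : Fin n → Fin n → Fin n → ℝ)
    (D4 : Fin n → Fin n → Fin n → Fin n → ℝ) (W : Fin n → Fin n → ℝ) (N : Fin n → ℝ)
    (u v w t : Fin n → ℝ) :
    ∑ i, ∑ j, ∑ k, ∑ l, jetR x D2 D3 D4 W N i j k l * u i * v j * w k * t l =
      -(∑ i, ∑ j, ∑ k, ∑ l, jetQ x D2 D3 D4 i j k l * u i * v j * w k * t l) +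
      ∑ e, (∑ i, ∑ k, (∑ a, W e a * jetT x D2 D3 k i a) * u i * w k) *
        (∑ j, ∑ l, (∑ b, W e b * jetTbar x D2 D3 l b j) * v j * t l) * (N e)⁻¹ := by
  have h1 : ∀ i j k l, jetR x D2 D3 D4 W N i j k l * u i * v j * w k * t l =
      -(jetQ x D2 D3 D4 i j k l * u i * v j * w k * t l) +
      ∑ e, ((∑ a, W e a * jetT x D2 D3 k i a) *
        (∑ b, W e b * jetTbar x D2 D3 l b j) * (N e)⁻¹) * u i * v j * w k * t l := by
    intro i j k l
    rw [jetR, sum_inverse_contract]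
    simp only [← Finset.sum_mul]
    ring
  simp only [h1, Finset.sum_add_distrib, Finset.sum_neg_distrib]
  congr 1
  simp only [← sum_mul_sum_four]
  rw [Finset.sum_comm' (t' := Finset.univ) (s' := fun _ => Finset.univ) (by simp)]
  rw [← sum_sum_sum_comm (fun i j e => ∑ k, ∑ l, ((∑ a, W e a * jetT x D2 D3 k i a) *
        (∑ b, W e b * jetTbar x D2 D3 l b j) * (N e)⁻¹) * u i * v j * w k * t l)]
  rw [Finset.sum_comm]
  refine Finset.sum_congr rfl fun j _ => Finset.sum_congr rfl fun i _ => ?_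
  rw [sum_sum_sum_comm]

/-- The partial derivatives, at a point `(0, y², z²)`, of a potential of the form
`c·(-log(1-t)) + h(σ) + r·(1-t)^(-π)·a(σ) + r²·m/2 + O(r³)`, `σ = s (1-t)^(-λ)`. Here
`q = (1-t)^(-λ)`, `w = 1 - t`, `hᵢ` are the derivatives of `h`, `k = (1-t)^(-π) a`,
`b₁ = a'/a`, `b₂ = a''/a`. -/
structure IsFrameJet (x : Fin 3 → ℝ) (D1 : Fin 3 → ℝ) (D2 : Fin 3 → Fin 3 → ℝ)
    (D3 : Fin 3 → Fin 3 → Fin 3 → ℝ) (D4 : Fin 3 → Fin 3 → Fin 3 → Fin 3 → ℝ)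
    (y z q w lam c h1 h2 h3 h4 k π b1 b2 m : ℝ) : Prop where
  x0 : x 0 = 0
  x1 : x 1 = y
  x2 : x 2 = z
  d0 : D1 0 = k
  d1 : D1 1 = q * h1
  d2 : D1 2 = w⁻¹ * (lam * (y ^ 2 * q) * h1 + c)
  symm2 : ∀ i j, D2 i j = D2 j i
  d00 : D2 0 0 = m
  d01 : D2 0 1 = k * q * b1
  d02 : D2 0 2 = k * w⁻¹ * (π + lam * (y ^ 2 * q) * b1)
  d11 : D2 1 1 = q ^ 2 * h2
  d12 : D2 1 2 = lam * w⁻¹ * q * (h1 + y ^ 2 * q * h2)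
  d22 : D2 2 2 = w⁻¹ ^ 2 * (lam * (y ^ 2 * q) * h1 + c + lam ^ 2 * (y ^ 2 * q) * (h1 + y ^ 2 * q * h2))
  symm3 : ∀ i j l, D3 i j l = D3 j i l
  symm3' : ∀ i j l, D3 i j l = D3 i l j
  d011 : D3 0 1 1 = k * q ^ 2 * b2
  d012 : D3 0 1 2 = k * w⁻¹ * q * ((π + lam) * b1 + lam * (y ^ 2 * q) * b2)
  d022 : D3 0 2 2 = k * w⁻¹ ^ 2 * ((π + 1) * (π + lam * (y ^ 2 * q) * b1) +
    lam * (y ^ 2 * q) * ((π + lam) * b1 + lam * (y ^ 2 * q) * b2))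
  d111 : D3 1 1 1 = q ^ 3 * h3
  d112 : D3 1 1 2 = lam * w⁻¹ * q ^ 2 * (2 * h2 + y ^ 2 * q * h3)
  d122 : D3 1 2 2 = lam * w⁻¹ ^ 2 * q * ((1 + lam) * (h1 + y ^ 2 * q * h2) +
    lam * (y ^ 2 * q) * (2 * h2 + y ^ 2 * q * h3))
  d222 : D3 2 2 2 = w⁻¹ ^ 3 * (2 * (lam * (y ^ 2 * q) * h1 + c +
      lam ^ 2 * (y ^ 2 * q) * (h1 + y ^ 2 * q * h2)) +
    lam * (y ^ 2 * q) * (lam * (h1 + y ^ 2 * q * h2) + lam ^ 2 * ((h1 + y ^ 2 * q * h2) +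
      y ^ 2 * q * (2 * h2 + y ^ 2 * q * h3))))
  symm4 : ∀ i j l e, D4 i j l e = D4 j i l e
  symm4' : ∀ i j l e, D4 i j l e = D4 i l j e
  symm4'' : ∀ i j l e, D4 i j l e = D4 i j e l
  d1111 : D4 1 1 1 1 = q ^ 4 * h4
  d1112 : D4 1 1 1 2 = lam * w⁻¹ * q ^ 3 * (3 * h3 + y ^ 2 * q * h4)
  d1122 : D4 1 1 2 2 = lam * w⁻¹ ^ 2 * q ^ 2 * ((1 + 2 * lam) * (2 * h2 + y ^ 2 * q * h3) +
    lam * (y ^ 2 * q) * (3 * h3 + y ^ 2 * q * h4))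
  d1222 : D4 1 2 2 2 = lam * w⁻¹ ^ 3 * q * ((2 + lam) * ((1 + lam) * (h1 + y ^ 2 * q * h2) +
      lam * (y ^ 2 * q) * (2 * h2 + y ^ 2 * q * h3)) +
    lam * (y ^ 2 * q) * ((1 + lam) * (2 * h2 + y ^ 2 * q * h3) + lam * (2 * h2 + y ^ 2 * q * h3) +
      lam * (y ^ 2 * q) * (3 * h3 + y ^ 2 * q * h4)))
  d2222 : D4 2 2 2 2 = w⁻¹ ^ 4 * (3 * (2 * (lam * (y ^ 2 * q) * h1 + c +
      lam ^ 2 * (y ^ 2 * q) * (h1 + y ^ 2 * q * h2)) +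
    lam * (y ^ 2 * q) * (lam * (h1 + y ^ 2 * q * h2) + lam ^ 2 * ((h1 + y ^ 2 * q * h2) +
      y ^ 2 * q * (2 * h2 + y ^ 2 * q * h3)))) +
    lam * (y ^ 2 * q) * (2 * (lam * (h1 + y ^ 2 * q * h2) + lam ^ 2 * ((h1 + y ^ 2 * q * h2) +
      y ^ 2 * q * (2 * h2 + y ^ 2 * q * h3))) +
      lam * (lam * (h1 + y ^ 2 * q * h2) + lam ^ 2 * ((h1 + y ^ 2 * q * h2) +
      y ^ 2 * q * (2 * h2 + y ^ 2 * q * h3))) +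
      lam * (y ^ 2 * q) * (lam * (2 * h2 + y ^ 2 * q * h3) + lam ^ 2 *
        (2 * (2 * h2 + y ^ 2 * q * h3) + y ^ 2 * q * (3 * h3 + y ^ 2 * q * h4)))))

/-- The orthogonal frame `∂₁, ∂₂, ∂₃ - (g_{3 2̄} / g_{2 2̄}) ∂₂`. -/
def jetW (b : ℝ) : Fin 3 → Fin 3 → ℝ := ![![1, 0, 0], ![0, 1, 0], ![0, b, 1]]

/-- The components of `∂g` in the frame `jetW`. -/
noncomputable def jetTW (y z q w lam c h1 h2 h3 k π b1 : ℝ) : Fin 3 → Fin 3 → Fin 3 → ℝ :=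
  ![![![0, 0, 0], ![k * q * b1 * y, 0, 0], ![k * w⁻¹ * z * π, 0, 0]],
    ![![k * q * b1 * y, 0, 0], ![0, q ^ 2 * (2 * h2 + y ^ 2 * q * h3) * y, 0],
      ![0, lam * w⁻¹ * z * q * (h1 + y ^ 2 * q * h2),
        lam * w⁻¹ ^ 2 * q * (h1 + y ^ 2 * q * h2) * y]],
    ![![k * w⁻¹ * z * π, 0, 0], ![0, lam * w⁻¹ * z * q * (h1 + y ^ 2 * q * h2),
        lam * w⁻¹ ^ 2 * q * (h1 + y ^ 2 * q * h2) * y],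
      ![0, lam * w⁻¹ ^ 2 * z ^ 2 * y * (1 - lam) * q * (h1 + y ^ 2 * q * h2),
        2 * w⁻¹ ^ 3 * z * (lam * (y ^ 2 * q) * h1 + c)]]]

namespace IsFrameJet

variable {x : Fin 3 → ℝ} {D1 : Fin 3 → ℝ} {D2 : Fin 3 → Fin 3 → ℝ}
    {D3 : Fin 3 → Fin 3 → Fin 3 → ℝ} {D4 : Fin 3 → Fin 3 → Fin 3 → Fin 3 → ℝ}
    {y z q w lam c h1 h2 h3 h4 k π b1 b2 m : ℝ}

/-- The metric in the frame `jetW` is diagonal. -/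
theorem metric_eq (J : IsFrameJet x D1 D2 D3 D4 y z q w lam c h1 h2 h3 h4 k π b1 b2 m)
    (hw : w ≠ 0) (hwz : w = 1 - z ^ 2) (u v : Fin 3) :
    ∑ i, ∑ j, jetG x D1 D2 i j * jetW (-lam * w⁻¹ * y * z) u i * jetW (-lam * w⁻¹ * y * z) v j =
      if u = v then (![k, q * (h1 + y ^ 2 * q * h2),
        w⁻¹ ^ 2 * (lam * (y ^ 2 * q) * h1 + c)] : Fin 3 → ℝ) u else 0 := by
  -- The entries agree only modulo `z ^ 2 + w = 1`, so `z ^ 2` is eliminated before `ring`.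
  have hz : z ^ 2 = 1 - w := by rw [hwz]; ring
  have e10 := J.symm2 1 0
  have e20 := J.symm2 2 0
  have e21 := J.symm2 2 1
  fin_cases u <;> fin_cases v <;>
    simp [Fin.sum_univ_three, jetG, jetW, J.x0, J.x1, J.x2, J.d0, J.d1, J.d2, J.d11, J.d12,
      J.d22, e21] <;> field_simp <;> (try simp only [hz]) <;> ring

/-- `∂g` in the frame `jetW`. -/
theorem dz_metric_eq (J : IsFrameJet x D1 D2 D3 D4 y z q w lam c h1 h2 h3 h4 k π b1 b2 m)
    (hw : w ≠ 0) (hwz : w = 1 - z ^ 2) (u v e : Fin 3) :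
    ∑ i, ∑ l, (∑ a, jetW (-lam * w⁻¹ * y * z) e a * jetT x D2 D3 l i a) *
        jetW (-lam * w⁻¹ * y * z) u i * jetW (-lam * w⁻¹ * y * z) v l =
      jetTW y z q w lam c h1 h2 h3 k π b1 u v e := by
  have hz : z ^ 2 = 1 - w := by rw [hwz]; ring
  have e10 := J.symm2 1 0
  have e20 := J.symm2 2 0
  have e21 := J.symm2 2 1
  have e121 := J.symm3' 1 2 1
  have e211 := J.symm3 2 1 1
  have e212 := J.symm3 2 1 2
  have e221 := J.symm3' 2 2 1
  simp only [e212] at e221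
  simp only [e121] at e211
  fin_cases u <;> fin_cases v <;> fin_cases e <;>
    simp [Fin.sum_univ_three, jetT, jetW, jetTW, J.x0, J.x1, J.x2, J.d01, J.d02, J.d11, J.d12,
      J.d22, e10, e20, e21, e121, e211, e212, e221, J.d111, J.d112, J.d122, J.d222] <;>
    field_simp <;> (try simp only [hz]) <;> ring

/-- `∂̄g` in the frame `jetW`. -/
theorem dzbar_metric_eq (J : IsFrameJet x D1 D2 D3 D4 y z q w lam c h1 h2 h3 h4 k π b1 b2 m)
    (hw : w ≠ 0) (hwz : w = 1 - z ^ 2) (u v e : Fin 3) :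
    ∑ j, ∑ l, (∑ b, jetW (-lam * w⁻¹ * y * z) e b * jetTbar x D2 D3 l b j) *
        jetW (-lam * w⁻¹ * y * z) u j * jetW (-lam * w⁻¹ * y * z) v l =
      jetTW y z q w lam c h1 h2 h3 k π b1 u v e := by
  rw [← J.dz_metric_eq hw hwz]
  refine Finset.sum_congr rfl fun j _ => Finset.sum_congr rfl fun l _ => ?_
  congr 3
  ext b
  -- At a real point the symmetry of the partial derivatives gives `∂̄ₗ g_{b j̄} = ∂ₗ g_{j b̄}`.
  have h1 : jetTbar x D2 D3 l b j = jetT x D2 D3 l j b := by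
    rw [jetTbar, jetT, J.symm2 b j, J.symm3' l b j]
    rcases eq_or_ne b j with rfl | hbj
    · split_ifs <;> ring
    · rw [if_neg hbj, if_neg hbj.symm]
      split_ifs <;> ring
  rw [h1]

end IsFrameJet

/-- The nonzero components of the curvature in the frame `jetW`. -/
noncomputable def jetV (y q w lam c h1 h2 h3 h4 k π b1 b2 m : ℝ) : Fin 3 → Fin 3 → ℝ :=
  let s := y ^ 2 * q
  let A := h1 + s * h2
  let A' := 2 * h2 + s * h3
  let A'' := 3 * h3 + s * h4
  let M := lam * s * h1 + c
  ![![-2 * m, -k * q * (b1 + s * (b2 - b1 ^ 2)), -k * w⁻¹ ^ 2 * (π + lam * s * b1)],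
    ![-k * q * (b1 + s * (b2 - b1 ^ 2)), -q ^ 2 * (A' + s * A'' - s * A' ^ 2 / A),
      -q * w⁻¹ ^ 2 * lam * (A + s * A' - lam * s * A ^ 2 / M)],
    ![-k * w⁻¹ ^ 2 * (π + lam * s * b1), -q * w⁻¹ ^ 2 * lam * (A + s * A' - lam * s * A ^ 2 / M),
      -2 * w⁻¹ ^ 4 * (M + lam ^ 2 * s * A)]]

namespace IsFrameJet

variable {x : Fin 3 → ℝ} {D1 : Fin 3 → ℝ} {D2 : Fin 3 → Fin 3 → ℝ}
    {D3 : Fin 3 → Fin 3 → Fin 3 → ℝ} {D4 : Fin 3 → Fin 3 → Fin 3 → Fin 3 → ℝ}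
    {y z q w lam c h1 h2 h3 h4 k π b1 b2 m : ℝ}

-- All 81 components are computed. The term quadratic in `∂g` is read off from the sparse table
-- `jetTW` with the diagonal metric; only `∂∂̄g` still has to be expanded.
set_option maxHeartbeats 4000000 in
theorem curv_eq (J : IsFrameJet x D1 D2 D3 D4 y z q w lam c h1 h2 h3 h4 k π b1 b2 m)
    (hw : w ≠ 0) (hwz : w = 1 - z ^ 2) (hk : k ≠ 0) (hq : q ≠ 0)
    (hA : h1 + y ^ 2 * q * h2 ≠ 0) (hM : lam * (y ^ 2 * q) * h1 + c ≠ 0) (u v s t : Fin 3) :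
    ∑ i, ∑ j, ∑ l, ∑ e, jetR x D2 D3 D4 (jetW (-lam * w⁻¹ * y * z)) (![k, q * (h1 + y ^ 2 * q * h2),
        w⁻¹ ^ 2 * (lam * (y ^ 2 * q) * h1 + c)]) i j l e * jetW (-lam * w⁻¹ * y * z) u i *
        jetW (-lam * w⁻¹ * y * z) v j * jetW (-lam * w⁻¹ * y * z) s l *
        jetW (-lam * w⁻¹ * y * z) t e =
      if (u = v ∧ s = t) ∨ (u = t ∧ s = v) then
        jetV y q w lam c h1 h2 h3 h4 k π b1 b2 m u s else 0 := by
  rw [jetR_contract]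
  simp only [J.dz_metric_eq hw hwz, J.dzbar_metric_eq hw hwz]
  -- The jet records one ordering of each set of indices; these symmetries bring the other orderings
  -- to it.
  have e10 := J.symm2 1 0
  have e20 := J.symm2 2 0
  have e21 := J.symm2 2 1
  have e101 := J.symm3 1 0 1
  have e110 := J.symm3' 1 1 0
  have e021 := J.symm3' 0 2 1
  have e102 := J.symm3 1 0 2
  have e120 := J.symm3' 1 2 0
  have e201 := J.symm3 2 0 1
  have e210 := J.symm3' 2 1 0
  have e202 := J.symm3 2 0 2
  have e220 := J.symm3' 2 2 0
  have e121 := J.symm3' 1 2 1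
  have e211 := J.symm3 2 1 1
  have e212 := J.symm3 2 1 2
  have e221 := J.symm3' 2 2 1
  have f1121 := J.symm4'' 1 1 2 1
  have f1211 := J.symm4' 1 2 1 1
  have f2111 := J.symm4 2 1 1 1
  have f1212 := J.symm4' 1 2 1 2
  have f1221 := J.symm4'' 1 2 2 1
  have f2112 := J.symm4 2 1 1 2
  have f2121 := J.symm4 2 1 2 1
  have f2211 := J.symm4' 2 2 1 1
  have f2122 := J.symm4 2 1 2 2
  have f2212 := J.symm4' 2 2 1 2
  have f2221 := J.symm4'' 2 2 2 1
  have hz : z ^ 2 = 1 - w := by rw [hwz]; ring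
  -- The same condition in the form in which `field_simp` meets this denominator.
  have hM' : y ^ 2 * lam * q * h1 + c ≠ 0 := by convert hM using 1; ring
  fin_cases u <;> fin_cases v <;> fin_cases s <;> fin_cases t <;>
    simp [Fin.sum_univ_three, jetQ, jetW, jetTW, jetV, J.x0, J.x1, J.x2, J.d00, J.d01, J.d02,
      J.d11, J.d12, J.d22, e10, e20, e21, e101, e110, e021, e102, e120, e201, e210, e202, e220,
      e121, e211, e212, e221, J.d011, J.d012, J.d022, J.d111, J.d112, J.d122, J.d222,
      f1121, f1211, f2111, f1212, f1221, f2112, f2121, f2211, f2122, f2212, f2221, J.d1111,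
      J.d1112, J.d1122, J.d1222, J.d2222] <;> field_simp <;> (try simp only [hz]) <;> ring

end IsFrameJet

/-! ### Partial derivatives of the potential on the plane `v₀ = 0` -/

theorem pd_congr {n : ℕ} {O : Set (Fin n → ℝ)} (hO : IsOpen O) {f g : (Fin n → ℝ) → ℝ}
    {v : Fin n → ℝ} (hv : v ∈ O) (h : ∀ u ∈ O, f u = g u) (i : Fin n) : pd i f v = pd i g v := by
  have : f =ᶠ[nhds v] g := by filter_upwards [hO.mem_nhds hv] with u hu using h u hu
  simp only [pd, this.fderiv_eq]

theorem hasDerivAt_update {n : ℕ} {f : (Fin n → ℝ) → ℝ} {v : Fin n → ℝ}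
    (hf : DifferentiableAt ℝ f v) (i : Fin n) :
    HasDerivAt (fun τ => f (Function.update v i τ)) (pd i f v) (v i) := by
  have h2 : HasFDerivAt f (fderiv ℝ f v) (Function.update v i (v i)) := by
    rw [Function.update_eq_self]; exact hf.hasFDerivAt
  exact h2.comp_hasDerivAt (v i) (_root_.hasDerivAt_update v i (v i))

/-- On the part of `O` in the plane `v₀ = 0`, the function `Ψ` equals
`(1 - t)^(-μ) a(s (1 - t)^(-λ))` where `s = v₁`, `t = v₂`. -/
def PlaneEq (O : Set (Fin 3 → ℝ)) (lam : ℝ) (Ψ : (Fin 3 → ℝ) → ℝ) (μ : ℝ) (a : ℝ → ℝ) : Prop :=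
  ∀ v ∈ O, v 0 = 0 → Ψ v = (1 - v 2) ^ (-μ) * a (v 1 * (1 - v 2) ^ (-lam))

/-- The directions `1` and `2` are tangent to the plane `v₀ = 0`, so these partial derivatives see
only the values on the plane. -/
theorem pd_one_of_plane {O : Set (Fin 3 → ℝ)} (hO : IsOpen O) {Ψ : (Fin 3 → ℝ) → ℝ}
    {ψ : ℝ → ℝ → ℝ} {v : Fin 3 → ℝ} (hv : v ∈ O) (h0 : v 0 = 0) (hΨ : DifferentiableAt ℝ Ψ v)
    (h : ∀ u ∈ O, u 0 = 0 → Ψ u = ψ (u 1) (u 2)) {d : ℝ}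
    (hd : HasDerivAt (fun s => ψ s (v 2)) d (v 1)) : pd 1 Ψ v = d := by
  refine (hasDerivAt_update hΨ 1).unique (hd.congr_of_eventuallyEq ?_)
  have hc : ContinuousAt (fun τ => Function.update v 1 τ) (v 1) := by fun_prop
  have : ∀ᶠ τ in nhds (v 1), Function.update v 1 τ ∈ O :=
    hc.eventually_mem (hO.mem_nhds (by simpa using hv))
  filter_upwards [this] with τ hτ
  rw [h _ hτ (by simpa using h0)]
  simp

theorem pd_two_of_plane {O : Set (Fin 3 → ℝ)} (hO : IsOpen O) {Ψ : (Fin 3 → ℝ) → ℝ}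
    {ψ : ℝ → ℝ → ℝ} {v : Fin 3 → ℝ} (hv : v ∈ O) (h0 : v 0 = 0) (hΨ : DifferentiableAt ℝ Ψ v)
    (h : ∀ u ∈ O, u 0 = 0 → Ψ u = ψ (u 1) (u 2)) {d : ℝ}
    (hd : HasDerivAt (fun t => ψ (v 1) t) d (v 2)) : pd 2 Ψ v = d := by
  refine (hasDerivAt_update hΨ 2).unique (hd.congr_of_eventuallyEq ?_)
  have hc : ContinuousAt (fun τ => Function.update v 2 τ) (v 2) := by fun_prop
  have : ∀ᶠ τ in nhds (v 2), Function.update v 2 τ ∈ O :=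
    hc.eventually_mem (hO.mem_nhds (by simpa using hv))
  filter_upwards [this] with τ hτ
  rw [h _ hτ (by simpa using h0)]
  simp

theorem hasDerivAt_one_sub_rpow {t : ℝ} (ht : t < 1) (μ : ℝ) :
    HasDerivAt (fun t : ℝ => (1 - t) ^ (-μ)) (μ * (1 - t) ^ (-(μ + 1))) t := by
  have h := ((hasDerivAt_id t).const_sub 1).rpow_const (p := -μ) (Or.inl (by simpa using (sub_pos.2 ht).ne'))
  refine h.congr_deriv ?_
  simp only [id]
  rw [show -μ - 1 = -(μ + 1) by ring]
  ring

namespace PlaneEq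

variable {O : Set (Fin 3 → ℝ)} {lam : ℝ} {Ψ : (Fin 3 → ℝ) → ℝ} {μ : ℝ} {a a' : ℝ → ℝ}

/-- Functions `(1-t)^(-μ) a(σ)` are closed under both tangential derivatives: `∂ₛ` sends `(μ, a)` to
`(μ+λ, a')`, and `∂ₜ` sends it to `(μ+1, μa + λσa')`. Iterating these two rules yields every
derivative of order up to four that is needed. -/
theorem pd_one (hO : IsOpen O) (ht : ∀ v ∈ O, v 2 < 1) (hΨ : ∀ v ∈ O, DifferentiableAt ℝ Ψ v)
    (ha : ∀ v ∈ O, HasDerivAt a (a' (v 1 * (1 - v 2) ^ (-lam))) (v 1 * (1 - v 2) ^ (-lam)))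
    (h : PlaneEq O lam Ψ μ a) : PlaneEq O lam (pd 1 Ψ) (μ + lam) a' := by
  intro v hv h0
  refine pd_one_of_plane hO hv h0 (hΨ v hv)
    (ψ := fun s t => (1 - t) ^ (-μ) * a (s * (1 - t) ^ (-lam))) h ?_
  have h1 : HasDerivAt (fun s => s * (1 - v 2) ^ (-lam)) ((1 - v 2) ^ (-lam)) (v 1) := by
    simpa using (hasDerivAt_id (v 1)).mul_const ((1 - v 2) ^ (-lam))
  have h2 := ((ha v hv).comp (v 1) h1).const_mul ((1 - v 2) ^ (-μ))
  refine h2.congr_deriv ?_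
  rw [neg_add, Real.rpow_add (sub_pos.2 (ht v hv))]
  ring

theorem pd_two (hO : IsOpen O) (ht : ∀ v ∈ O, v 2 < 1) (hΨ : ∀ v ∈ O, DifferentiableAt ℝ Ψ v)
    (ha : ∀ v ∈ O, HasDerivAt a (a' (v 1 * (1 - v 2) ^ (-lam))) (v 1 * (1 - v 2) ^ (-lam)))
    (h : PlaneEq O lam Ψ μ a) :
    PlaneEq O lam (pd 2 Ψ) (μ + 1) (fun σ => μ * a σ + lam * σ * a' σ) := by
  intro v hv h0
  refine pd_two_of_plane hO hv h0 (hΨ v hv)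
    (ψ := fun s t => (1 - t) ^ (-μ) * a (s * (1 - t) ^ (-lam))) h ?_
  have h1 := (hasDerivAt_one_sub_rpow (ht v hv) lam).const_mul (v 1)
  have h2 := (hasDerivAt_one_sub_rpow (ht v hv) μ).mul ((ha v hv).comp (v 2) h1)
  refine h2.congr_deriv ?_
  rw [neg_add, neg_add, Real.rpow_add (sub_pos.2 (ht v hv)), Real.rpow_add (sub_pos.2 (ht v hv))]
  simp only [Function.comp]
  ring

end PlaneEq

/-- A potential that is smooth on `O`, together with its expansion to first order in `v₀`
on the plane `v₀ = 0`. -/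
structure IsPlanePotential (O : Set (Fin 3 → ℝ)) (φ : (Fin 3 → ℝ) → ℝ) (lam c C π : ℝ)
    (h h1 h2 h3 h4 a a1 a2 : ℝ → ℝ) : Prop where
  isOpen : IsOpen O
  lt_one : ∀ v ∈ O, v 2 < 1
  contDiffAt : ∀ v ∈ O, ContDiffAt ℝ ∞ φ v
  eq : ∀ v ∈ O, v 0 = 0 → φ v = C - c * Real.log (1 - v 2) + h (v 1 * (1 - v 2) ^ (-lam))
  pd_eq : PlaneEq O lam (pd 0 φ) π a
  deriv0 : ∀ v ∈ O, HasDerivAt h (h1 (v 1 * (1 - v 2) ^ (-lam))) (v 1 * (1 - v 2) ^ (-lam))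
  deriv1 : ∀ v ∈ O, HasDerivAt h1 (h2 (v 1 * (1 - v 2) ^ (-lam))) (v 1 * (1 - v 2) ^ (-lam))
  deriv2 : ∀ v ∈ O, HasDerivAt h2 (h3 (v 1 * (1 - v 2) ^ (-lam))) (v 1 * (1 - v 2) ^ (-lam))
  deriv3 : ∀ v ∈ O, HasDerivAt h3 (h4 (v 1 * (1 - v 2) ^ (-lam))) (v 1 * (1 - v 2) ^ (-lam))
  derivA0 : ∀ v ∈ O, HasDerivAt a (a1 (v 1 * (1 - v 2) ^ (-lam))) (v 1 * (1 - v 2) ^ (-lam))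
  derivA1 : ∀ v ∈ O, HasDerivAt a1 (a2 (v 1 * (1 - v 2) ^ (-lam))) (v 1 * (1 - v 2) ^ (-lam))

namespace IsPlanePotential

variable {O : Set (Fin 3 → ℝ)} {φ : (Fin 3 → ℝ) → ℝ} {lam c C π : ℝ}
  {h h1 h2 h3 h4 a a1 a2 : ℝ → ℝ}

/-- Because of the logarithm and the constant, `φ` itself is not assumed to be of the form
`PlaneEq`; its first derivatives are, and from there the closure rules apply. -/
theorem pd_one (H : IsPlanePotential O φ lam c C π h h1 h2 h3 h4 a a1 a2) :
    PlaneEq O lam (pd 1 φ) lam h1 := by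
  intro v hv h0
  refine pd_one_of_plane H.isOpen hv h0 ((H.contDiffAt v hv).differentiableAt (by simp))
    (ψ := fun s t => C - c * Real.log (1 - t) + h (s * (1 - t) ^ (-lam))) H.eq ?_
  have h1 : HasDerivAt (fun s => s * (1 - v 2) ^ (-lam)) ((1 - v 2) ^ (-lam)) (v 1) := by
    simpa using (hasDerivAt_id (v 1)).mul_const ((1 - v 2) ^ (-lam))
  have h2 := ((H.deriv0 v hv).comp (v 1) h1).const_add (C - c * Real.log (1 - v 2))
  refine h2.congr_deriv ?_
  ring

theorem pd_two (H : IsPlanePotential O φ lam c C π h h1 h2 h3 h4 a a1 a2) :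
    PlaneEq O lam (pd 2 φ) 1 (fun σ => lam * σ * h1 σ + c) := by
  intro v hv h0
  refine pd_two_of_plane H.isOpen hv h0 ((H.contDiffAt v hv).differentiableAt (by simp))
    (ψ := fun s t => C - c * Real.log (1 - t) + h (s * (1 - t) ^ (-lam))) H.eq ?_
  have hpos := sub_pos.2 (H.lt_one v hv)
  have h1 := (hasDerivAt_one_sub_rpow (H.lt_one v hv) lam).const_mul (v 1)
  have h3 := ((hasDerivAt_id (v 2)).const_sub 1).log (by simpa using hpos.ne')
  have h2 := ((h3.const_mul c).const_sub C).add ((H.deriv0 v hv).comp (v 2) h1)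
  refine h2.congr_deriv ?_
  rw [neg_add, Real.rpow_add hpos, Real.rpow_neg_one]
  simp only [id]
  field_simp
  ring

theorem rpow_eq {w lam : ℝ} (hw : 0 < w) (i j : ℕ) :
    w ^ (-(i * lam + j)) = (w ^ (-lam)) ^ i * w⁻¹ ^ j := by
  rw [neg_add, Real.rpow_add hw, ← Real.rpow_natCast (w ^ (-lam)), ← Real.rpow_mul hw.le,
    inv_pow, Real.rpow_neg hw.le j, Real.rpow_natCast]
  congr 2
  ring

/-- Derivatives in directions `1` and `2` come from the closure rules. In a mixed derivative `∂₀` is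
commuted to the innermost place, where `pd_eq` describes it on the plane. The pure second derivative
`∂₀∂₀φ` stays as the parameter `m`. -/
theorem isFrameJet (H : IsPlanePotential O φ lam c C π h h1 h2 h3 h4 a a1 a2) {x v : Fin 3 → ℝ}
    (hv : v ∈ O) (hx : x 0 = 0) (hvx : ∀ i, v i = x i ^ 2)
    (ha : a (x 1 ^ 2 * (1 - x 2 ^ 2) ^ (-lam)) ≠ 0) {q w σ k : ℝ}
    (hw : w = 1 - x 2 ^ 2) (hq : q = w ^ (-lam)) (hσ : σ = x 1 ^ 2 * q)
    (hk : k = w ^ (-π) * a σ) :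
    IsFrameJet x (fun i => pd i φ v) (fun i j => pd i (pd j φ) v)
      (fun i j l => pd i (pd j (pd l φ)) v) (fun i j l e => pd i (pd j (pd l (pd e φ))) v)
      (x 1) (x 2) q w lam c (h1 σ) (h2 σ) (h3 σ) (h4 σ) k π (a1 σ / a σ) (a2 σ / a σ)
      (pd 0 (pd 0 φ) v) := by
  have hO := H.isOpen
  have ht := H.lt_one
  have hv0 : v 0 = 0 := by rw [hvx, hx]; ring
  have hwpos : 0 < w := by
    have := ht v hv
    rw [hvx] at this; rw [hw]; linarith
  have hσv : v 1 * (1 - v 2) ^ (-lam) = σ := by rw [hvx, hvx, ← hw, ← hq, hσ]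
  have hwv : 1 - v 2 = w := by rw [hvx, hw]
  have haσ : a σ ≠ 0 := by rw [hσ, hq, hw]; exact ha
  have c1 : ∀ i, ∀ v ∈ O, ContDiffAt ℝ ∞ (pd i φ) v := fun i v hv =>
    contDiffAt_pd (H.contDiffAt v hv) i
  have c2 : ∀ i j, ∀ v ∈ O, ContDiffAt ℝ ∞ (pd i (pd j φ)) v := fun i j v hv =>
    contDiffAt_pd (c1 j v hv) i
  have c3 : ∀ i j l, ∀ v ∈ O, ContDiffAt ℝ ∞ (pd i (pd j (pd l φ))) v := fun i j l v hv =>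
    contDiffAt_pd (c2 j l v hv) i
  have s1 : ∀ i, ∀ v ∈ O, DifferentiableAt ℝ (pd i φ) v := fun i v hv =>
    (c1 i v hv).differentiableAt (by simp)
  have s2 : ∀ i j, ∀ v ∈ O, DifferentiableAt ℝ (pd i (pd j φ)) v := fun i j v hv =>
    (c2 i j v hv).differentiableAt (by simp)
  have s3 : ∀ i j l, ∀ v ∈ O, DifferentiableAt ℝ (pd i (pd j (pd l φ))) v := fun i j l v hv =>
    (c3 i j l v hv).differentiableAt (by simp)
  have did : ∀ v ∈ O, HasDerivAt (fun σ : ℝ => σ) 1 (v 1 * (1 - v 2) ^ (-lam)) :=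
    fun v _ => hasDerivAt_id _
  -- derivatives of the one-variable coefficient functions
  have dA : ∀ v ∈ O, HasDerivAt (fun σ => lam * σ * h1 σ + c)
      ((fun σ => lam * (h1 σ + σ * h2 σ)) (v 1 * (1 - v 2) ^ (-lam)))
      (v 1 * (1 - v 2) ^ (-lam)) := fun v hv => by
    refine HasDerivAt.congr_deriv ((((did v hv).const_mul lam).fun_mul (H.deriv1 v hv)).add_const c) ?_
    ring
  have dA1 : ∀ v ∈ O, HasDerivAt (fun σ => lam * (h1 σ + σ * h2 σ))
      ((fun σ => lam * (2 * h2 σ + σ * h3 σ)) (v 1 * (1 - v 2) ^ (-lam)))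
      (v 1 * (1 - v 2) ^ (-lam)) := fun v hv => by
    refine HasDerivAt.congr_deriv (((H.deriv1 v hv).fun_add ((did v hv).fun_mul (H.deriv2 v hv))).const_mul lam) ?_
    ring
  have dA2 : ∀ v ∈ O, HasDerivAt (fun σ => lam * (2 * h2 σ + σ * h3 σ))
      ((fun σ => lam * (3 * h3 σ + σ * h4 σ)) (v 1 * (1 - v 2) ^ (-lam)))
      (v 1 * (1 - v 2) ^ (-lam)) := fun v hv => by
    refine HasDerivAt.congr_deriv ((((H.deriv2 v hv).const_mul 2).fun_add
      ((did v hv).fun_mul (H.deriv3 v hv))).const_mul lam) ?_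
    ring
  have dU : ∀ v ∈ O, HasDerivAt
      (fun σ => 1 * (lam * σ * h1 σ + c) + lam * σ * (lam * (h1 σ + σ * h2 σ)))
      ((fun σ => (1 + lam) * (lam * (h1 σ + σ * h2 σ)) + lam * σ * (lam * (2 * h2 σ + σ * h3 σ)))
        (v 1 * (1 - v 2) ^ (-lam))) (v 1 * (1 - v 2) ^ (-lam)) := fun v hv => by
    refine HasDerivAt.congr_deriv (((dA v hv).const_mul 1).fun_add (((did v hv).const_mul lam).fun_mul (dA1 v hv))) ?_
    ring
  have dU1 : ∀ v ∈ O, HasDerivAt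
      (fun σ => (1 + lam) * (lam * (h1 σ + σ * h2 σ)) + lam * σ * (lam * (2 * h2 σ + σ * h3 σ)))
      ((fun σ => (1 + 2 * lam) * (lam * (2 * h2 σ + σ * h3 σ)) +
        lam * σ * (lam * (3 * h3 σ + σ * h4 σ)))
        (v 1 * (1 - v 2) ^ (-lam))) (v 1 * (1 - v 2) ^ (-lam)) := fun v hv => by
    refine HasDerivAt.congr_deriv (((dA1 v hv).const_mul (1 + lam)).fun_add
      (((did v hv).const_mul lam).fun_mul (dA2 v hv))) ?_
    ring
  have dB : ∀ v ∈ O, HasDerivAt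
      (fun σ => (1 + 1) * (1 * (lam * σ * h1 σ + c) + lam * σ * (lam * (h1 σ + σ * h2 σ))) +
        lam * σ * ((1 + lam) * (lam * (h1 σ + σ * h2 σ)) + lam * σ * (lam * (2 * h2 σ + σ * h3 σ))))
      ((fun σ => (2 + lam) * ((1 + lam) * (lam * (h1 σ + σ * h2 σ)) +
          lam * σ * (lam * (2 * h2 σ + σ * h3 σ))) +
        lam * σ * ((1 + 2 * lam) * (lam * (2 * h2 σ + σ * h3 σ)) +
        lam * σ * (lam * (3 * h3 σ + σ * h4 σ))))
        (v 1 * (1 - v 2) ^ (-lam))) (v 1 * (1 - v 2) ^ (-lam)) := fun v hv => by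
    refine HasDerivAt.congr_deriv (((dU v hv).const_mul (1 + 1)).fun_add
      (((did v hv).const_mul lam).fun_mul (dU1 v hv))) ?_
    ring
  have dL : ∀ v ∈ O, HasDerivAt (fun σ => π * a σ + lam * σ * a1 σ)
      ((fun σ => (π + lam) * a1 σ + lam * σ * a2 σ) (v 1 * (1 - v 2) ^ (-lam)))
      (v 1 * (1 - v 2) ^ (-lam)) := fun v hv => by
    refine HasDerivAt.congr_deriv (((H.derivA0 v hv).const_mul π).fun_add
      (((did v hv).const_mul lam).fun_mul (H.derivA1 v hv))) ?_
    ring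
  -- the partial derivatives on the plane
  have e11 := PlaneEq.pd_one hO ht (s1 1) H.deriv1 H.pd_one
  have e111 := PlaneEq.pd_one hO ht (s2 1 1) H.deriv2 e11
  have e1111 := PlaneEq.pd_one hO ht (s3 1 1 1) H.deriv3 e111
  have e12 := PlaneEq.pd_one
    (a' := (fun σ => lam * (h1 σ + σ * h2 σ)))
    hO ht (s1 2) dA H.pd_two
  have e112 := PlaneEq.pd_one
    (a' := (fun σ => lam * (2 * h2 σ + σ * h3 σ)))
    hO ht (s2 1 2) dA1 e12
  have e1112 := PlaneEq.pd_one
    (a' := (fun σ => lam * (3 * h3 σ + σ * h4 σ)))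
    hO ht (s3 1 1 2) dA2 e112
  have e22 := PlaneEq.pd_two
    (a' := (fun σ => lam * (h1 σ + σ * h2 σ)))
    hO ht (s1 2) dA H.pd_two
  have e122 := PlaneEq.pd_one
    (a' := (fun σ => (1 + lam) * (lam * (h1 σ + σ * h2 σ)) + lam * σ * (lam * (2 * h2 σ + σ * h3 σ))))
    hO ht (s2 2 2) dU e22
  have e1122 := PlaneEq.pd_one
    (a' := (fun σ => (1 + 2 * lam) * (lam * (2 * h2 σ + σ * h3 σ)) + lam * σ * (lam * (3 * h3 σ + σ * h4 σ))))
    hO ht (s3 1 2 2) dU1 e122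
  have e222 := PlaneEq.pd_two
    (a' := (fun σ => (1 + lam) * (lam * (h1 σ + σ * h2 σ)) + lam * σ * (lam * (2 * h2 σ + σ * h3 σ))))
    hO ht (s2 2 2) dU e22
  have e1222 := PlaneEq.pd_one
    (a' := (fun σ => (2 + lam) * ((1 + lam) * (lam * (h1 σ + σ * h2 σ)) + lam * σ * (lam * (2 * h2 σ + σ * h3 σ))) + lam * σ * ((1 + 2 * lam) * (lam * (2 * h2 σ + σ * h3 σ)) + lam * σ * (lam * (3 * h3 σ + σ * h4 σ)))))
    hO ht (s3 2 2 2) dB e222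
  have e2222 := PlaneEq.pd_two
    (a' := (fun σ => (2 + lam) * ((1 + lam) * (lam * (h1 σ + σ * h2 σ)) + lam * σ * (lam * (2 * h2 σ + σ * h3 σ))) + lam * σ * ((1 + 2 * lam) * (lam * (2 * h2 σ + σ * h3 σ)) + lam * σ * (lam * (3 * h3 σ + σ * h4 σ)))))
    hO ht (s3 2 2 2) dB e222
  have e10 := PlaneEq.pd_one hO ht (s1 0) H.derivA0 H.pd_eq
  have e20 := PlaneEq.pd_two hO ht (s1 0) H.derivA0 H.pd_eq
  have e110 := PlaneEq.pd_one hO ht (s2 1 0) H.derivA1 e10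
  have e120 := PlaneEq.pd_one
    (a' := (fun σ => (π + lam) * a1 σ + lam * σ * a2 σ))
    hO ht (s2 2 0) dL e20
  have e220 := PlaneEq.pd_two
    (a' := (fun σ => (π + lam) * a1 σ + lam * σ * a2 σ))
    hO ht (s2 2 0) dL e20
  have m2 : ∀ i j, ∀ v ∈ O, pd i (pd j φ) v = pd j (pd i φ) v := fun i j v hv =>
    pd_comm (H.contDiffAt v hv) i j
  have m3 : ∀ i j l, ∀ v ∈ O, pd i (pd j (pd l φ)) v = pd j (pd i (pd l φ)) v :=
    fun i j l v hv => pd_comm (c1 l v hv) i j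
  have m3' : ∀ i j l, ∀ v ∈ O, pd i (pd j (pd l φ)) v = pd i (pd l (pd j φ)) v :=
    fun i j l v hv => pd_congr hO hv (m2 j l) i
  -- Every exponent that occurs is `iλ + j`, shifted by `π` when `∂₀` is involved; so the powers of
  -- `w` become monomials in `q` and `w⁻¹`, times `k / a σ` in the shifted case.
  have rp : ∀ (i j : ℕ) (μ : ℝ), μ = i * lam + j → w ^ (-μ) = q ^ i * w⁻¹ ^ j := by
    rintro i j _ rfl
    rw [rpow_eq hwpos, hq]
  have rpk : ∀ (i j : ℕ) (μ : ℝ), μ = π + (i * lam + j) →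
      w ^ (-μ) = k / a σ * q ^ i * w⁻¹ ^ j := by
    rintro i j _ rfl
    rw [neg_add, Real.rpow_add hwpos, rpow_eq hwpos, hk, hq]
    field_simp
  have key : ∀ {Ψ : (Fin 3 → ℝ) → ℝ} {μ : ℝ} {b : ℝ → ℝ}, PlaneEq O lam Ψ μ b →
      Ψ v = w ^ (-μ) * b σ := by
    intro Ψ μ b hb
    rw [hb v hv hv0, hσv, hwv]
  have z0 : pd 0 (pd 1 φ) v = pd 1 (pd 0 φ) v := m2 0 1 v hv
  have z1 : pd 0 (pd 2 φ) v = pd 2 (pd 0 φ) v := m2 0 2 v hv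
  have z2 : pd 0 (pd 1 (pd 1 φ)) v = pd 1 (pd 1 (pd 0 φ)) v :=
    (m3 0 1 1 v hv).trans (m3' 1 0 1 v hv)
  have z3 : pd 0 (pd 1 (pd 2 φ)) v = pd 1 (pd 2 (pd 0 φ)) v :=
    (m3 0 1 2 v hv).trans (m3' 1 0 2 v hv)
  have z4 : pd 0 (pd 2 (pd 2 φ)) v = pd 2 (pd 2 (pd 0 φ)) v :=
    (m3 0 2 2 v hv).trans (m3' 2 0 2 v hv)
  exact
  { x0 := hx
    x1 := rfl
    x2 := rfl
    d0 := by rw [key H.pd_eq, hk]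
    d1 := by rw [key H.pd_one, hq]
    d2 := by rw [key H.pd_two, rp 0 1 _ (by push_cast; ring), ← hσ]; ring
    symm2 := fun i j => m2 i j v hv
    d00 := rfl
    d01 := by
      rw [z0, key e10, rpk 1 0 _ (by push_cast; ring)]; field_simp
    d02 := by
      rw [z1, key e20, rpk 0 1 _ (by push_cast; ring), ← hσ]; field_simp
    d11 := by rw [key e11, rp 2 0 _ (by push_cast; ring)]; ring
    d12 := by rw [key e12, rp 1 1 _ (by push_cast; ring), ← hσ]; ring
    d22 := by rw [key e22, rp 0 2 _ (by push_cast; ring), ← hσ]; ring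
    symm3 := fun i j l => m3 i j l v hv
    symm3' := fun i j l => m3' i j l v hv
    d011 := by rw [z2, key e110, rpk 2 0 _ (by push_cast; ring)]; field_simp
    d012 := by rw [z3, key e120, rpk 1 1 _ (by push_cast; ring), ← hσ]; field_simp
    d022 := by rw [z4, key e220, rpk 0 2 _ (by push_cast; ring), ← hσ]; field_simp
    d111 := by rw [key e111, rp 3 0 _ (by push_cast; ring)]; ring
    d112 := by rw [key e112, rp 2 1 _ (by push_cast; ring), ← hσ]; ring
    d122 := by rw [key e122, rp 1 2 _ (by push_cast; ring), ← hσ]; ring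
    d222 := by rw [key e222, rp 0 3 _ (by push_cast; ring), ← hσ]; ring
    symm4 := fun i j l e => pd_comm (c2 l e v hv) i j
    symm4' := fun i j l e => pd_congr hO hv (m3 j l e) i
    symm4'' := fun i j l e => pd_congr hO hv (m3' j l e) i
    d1111 := by rw [key e1111, rp 4 0 _ (by push_cast; ring)]; ring
    d1112 := by rw [key e1112, rp 3 1 _ (by push_cast; ring), ← hσ]; ring
    d1122 := by rw [key e1122, rp 2 2 _ (by push_cast; ring), ← hσ]; ring
    d1222 := by rw [key e1222, rp 1 3 _ (by push_cast; ring), ← hσ]; ring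
    d2222 := by rw [key e2222, rp 0 4 _ (by push_cast; ring), ← hσ]; ring }

end IsPlanePotential

/-! ### The potential of the Bergman metric of `E_{p,λ}` -/

/-- `∑ₐ (a+1)(a+1+p)(λ(a+1+p)+τ) ξᵃ` as a polynomial in `i = 1/(1-ξ)`. -/
def serP (p lam τ i : ℝ) : ℝ :=
  6 * lam * i ^ 4 + 2 * (lam * (2 * p - 3) + τ) * i ^ 3 + (lam * (p - 1) ^ 2 + τ * (p - 1)) * i ^ 2

/-- The first derivative of `serP` in `ξ`. -/
def serP' (p lam τ i : ℝ) : ℝ :=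
  24 * lam * i ^ 5 + 6 * (lam * (2 * p - 3) + τ) * i ^ 4 +
    2 * (lam * (p - 1) ^ 2 + τ * (p - 1)) * i ^ 3

/-- The second derivative of `serP` in `ξ`. -/
def serP'' (p lam τ i : ℝ) : ℝ :=
  120 * lam * i ^ 6 + 24 * (lam * (2 * p - 3) + τ) * i ^ 5 +
    6 * (lam * (p - 1) ^ 2 + τ * (p - 1)) * i ^ 4

/-- `σ = s (1-t)^(-λ)` -/
noncomputable def sigF (lam : ℝ) (v : Fin 3 → ℝ) : ℝ := v 1 * (1 - v 2) ^ (-lam)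

/-- `τ = p (1 + σ (λ - 1))` -/
noncomputable def tauF (p lam : ℝ) (v : Fin 3 → ℝ) : ℝ := p * (1 + sigF lam v * (lam - 1))

/-- The factor of `r` in `ξ`. -/
noncomputable def rhoF (p lam : ℝ) (v : Fin 3 → ℝ) : ℝ :=
  (1 - v 2) ^ (-(lam / p)) * (1 - sigF lam v) ^ (-(1 / p))

/-- `1 / (1 - ξ)` -/
noncomputable def invF (p lam : ℝ) (v : Fin 3 → ℝ) : ℝ := (1 - v 0 * rhoF p lam v)⁻¹

/-- The logarithm of the Bergman kernel as a function of the squared moduli. -/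
noncomputable def potF (p lam C : ℝ) (v : Fin 3 → ℝ) : ℝ :=
  C - (2 + lam + lam / p) * Real.log (1 - v 2) - (3 + 1 / p) * Real.log (1 - sigF lam v) +
    Real.log (serP p lam (tauF p lam v) (invF p lam v))

/-- The points near which `potF` is smooth. -/
structure IsGood (p lam : ℝ) (v : Fin 3 → ℝ) : Prop where
  t_lt : 0 < 1 - v 2
  sig_lt : 0 < 1 - sigF lam v
  xi_lt : 0 < 1 - v 0 * rhoF p lam v
  ser_pos : 0 < serP p lam (tauF p lam v) (invF p lam v)
  S_pos : 0 < S p lam (sigF lam v)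
  e_pos : 0 < e0 p lam + e1 p lam * sigF lam v

theorem contDiffAt_coord {n : ℕ} (i : Fin n) (v : Fin n → ℝ) :
    ContDiffAt ℝ ∞ (fun v : Fin n → ℝ => v i) v :=
  (contDiff_apply ℝ ℝ i).contDiffAt

namespace IsGood

variable {p lam C : ℝ} {v : Fin 3 → ℝ}

theorem contDiffAt_sigF (h : IsGood p lam v) : ContDiffAt ℝ ∞ (sigF lam) v :=
  (contDiffAt_coord 1 v).mul
    ((contDiffAt_const.sub (contDiffAt_coord 2 v)).rpow_const_of_ne h.t_lt.ne')

theorem contDiffAt_tauF (h : IsGood p lam v) : ContDiffAt ℝ ∞ (tauF p lam) v :=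
  contDiffAt_const.mul (contDiffAt_const.add (h.contDiffAt_sigF.mul contDiffAt_const))

theorem contDiffAt_rhoF (h : IsGood p lam v) : ContDiffAt ℝ ∞ (rhoF p lam) v :=
  ((contDiffAt_const.sub (contDiffAt_coord 2 v)).rpow_const_of_ne h.t_lt.ne').mul
    ((contDiffAt_const.sub h.contDiffAt_sigF).rpow_const_of_ne h.sig_lt.ne')

theorem contDiffAt_xi (h : IsGood p lam v) :
    ContDiffAt ℝ ∞ (fun v => 1 - v 0 * rhoF p lam v) v :=
  contDiffAt_const.sub ((contDiffAt_coord 0 v).mul h.contDiffAt_rhoF)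

theorem contDiffAt_serP (h : IsGood p lam v) :
    ContDiffAt ℝ ∞ (fun v => serP p lam (tauF p lam v) (invF p lam v)) v := by
  have h1 : ContDiffAt ℝ ∞ (invF p lam) v := h.contDiffAt_xi.inv h.xi_lt.ne'
  have h2 := h.contDiffAt_tauF
  unfold serP
  fun_prop

theorem contDiffAt_potF (h : IsGood p lam v) : ContDiffAt ℝ ∞ (potF p lam C) v := by
  have h1 := h.contDiffAt_serP.log h.ser_pos.ne'
  have h2 := (contDiffAt_const (c := (1 : ℝ)).sub h.contDiffAt_sigF).log h.sig_lt.ne'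
  have h3 := (contDiffAt_const (c := (1 : ℝ)).sub (contDiffAt_coord 2 v)).log h.t_lt.ne'
  unfold potF
  exact ((contDiffAt_const.sub (contDiffAt_const.mul h3)).sub (contDiffAt_const.mul h2)).add h1

/-- The squared moduli of points of the domain satisfy `r ≥ 0`, so they contain no neighbourhood of
a point with `r = 0`. The open conditions in `IsGood` provide a neighbourhood in `ℝ³` on which to
differentiate. -/
theorem eventually (h : IsGood p lam v) : ∀ᶠ u in nhds v, IsGood p lam u := by
  have hs := h.contDiffAt_sigF.continuousAt
  have e1 := ((continuousAt_const (y := (1 : ℝ))).sub (contDiffAt_coord 2 v).continuousAt).eventually_const_lt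
    h.t_lt
  have e2 := ((continuousAt_const (y := (1 : ℝ))).sub hs).eventually_const_lt h.sig_lt
  have e3 := h.contDiffAt_xi.continuousAt.eventually_const_lt h.xi_lt
  have e4 := h.contDiffAt_serP.continuousAt.eventually_const_lt h.ser_pos
  have e5 := ((continuousAt_const (y := u3 p lam)).add
    ((continuousAt_const (y := u4 p lam)).mul hs)).eventually_const_lt h.S_pos
  have e6 := ((continuousAt_const (y := e0 p lam)).add
    ((continuousAt_const (y := Bergman.e1 p lam)).mul hs)).eventually_const_lt h.e_pos
  filter_upwards [e1, e2, e3, e4, e5, e6] with u g1 g2 g3 g4 g5 g6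
  exact ⟨g1, g2, g3, g4, g5, g6⟩

theorem sigF_update (τ : ℝ) : sigF lam (Function.update v 0 τ) = sigF lam v := by
  simp [sigF]

/-- With `i = 1/(1-ξ)` one has `di/dξ = i²`, so `iⁿ` differentiates to `n iⁿ⁺¹`; this is the passage
from `serP` to `serP'` and `serP''`. -/
theorem hasDerivAt_invF (h : IsGood p lam v) :
    HasDerivAt (fun τ => (1 - τ * rhoF p lam v)⁻¹) (rhoF p lam v * invF p lam v ^ 2) (v 0) := by
  have h1 := ((((hasDerivAt_id (v 0)).mul_const (rhoF p lam v)).const_sub 1).inv h.xi_lt.ne')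
  refine h1.congr_deriv ?_
  simp only [id, invF]
  field_simp

/-- `σ`, `τ` and `ρ` do not depend on `r`, so only `invF` varies. -/
theorem pd_zero_potF (h : IsGood p lam v) :
    pd 0 (potF p lam C) v = rhoF p lam v * serP' p lam (tauF p lam v) (invF p lam v) /
      serP p lam (tauF p lam v) (invF p lam v) := by
  have hd := hasDerivAt_update (h.contDiffAt_potF (C := C).differentiableAt (by simp)) 0
  refine hd.unique ?_
  have hfun : (fun τ => potF p lam C (Function.update v 0 τ)) = fun τ =>
      C - (2 + lam + lam / p) * Real.log (1 - v 2) - (3 + 1 / p) * Real.log (1 - sigF lam v) +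
      Real.log (serP p lam (tauF p lam v) ((1 - τ * rhoF p lam v)⁻¹)) := by
    ext τ
    simp [potF, tauF, rhoF, invF, sigF_update]
  rw [hfun]
  have hi := h.hasDerivAt_invF
  have hs : HasDerivAt (fun τ => serP p lam (tauF p lam v) ((1 - τ * rhoF p lam v)⁻¹))
      (rhoF p lam v * serP' p lam (tauF p lam v) (invF p lam v)) (v 0) := by
    unfold serP
    refine ((((hi.fun_pow 4).const_mul _).fun_add ((hi.fun_pow 3).const_mul _)).fun_add
      ((hi.fun_pow 2).const_mul _)).congr_deriv ?_
    simp only [serP', invF]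
    push_cast
    ring
  exact (hs.log h.ser_pos.ne').const_add _

theorem pd_zero_zero_potF (h : IsGood p lam v) :
    pd 0 (pd 0 (potF p lam C)) v = rhoF p lam v ^ 2 *
      (serP'' p lam (tauF p lam v) (invF p lam v) * serP p lam (tauF p lam v) (invF p lam v) -
        serP' p lam (tauF p lam v) (invF p lam v) ^ 2) /
      serP p lam (tauF p lam v) (invF p lam v) ^ 2 := by
  have hd := hasDerivAt_update
    ((contDiffAt_pd (h.contDiffAt_potF (C := C)) 0).differentiableAt (by simp)) 0
  refine hd.unique ?_
  have hc : ContinuousAt (fun τ => Function.update v 0 τ) (v 0) := by fun_prop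
  have hev : ∀ᶠ τ in nhds (v 0), IsGood p lam (Function.update v 0 τ) := by
    refine hc.eventually ?_
    change ∀ᶠ u in nhds (Function.update v 0 (v 0)), IsGood p lam u
    rw [Function.update_eq_self]
    exact h.eventually
  have hfun : (fun τ => pd 0 (potF p lam C) (Function.update v 0 τ)) =ᶠ[nhds (v 0)] fun τ =>
      rhoF p lam v * serP' p lam (tauF p lam v) ((1 - τ * rhoF p lam v)⁻¹) /
        serP p lam (tauF p lam v) ((1 - τ * rhoF p lam v)⁻¹) := by
    filter_upwards [hev] with τ hτ
    rw [hτ.pd_zero_potF]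
    simp [tauF, rhoF, invF, sigF_update]
  refine HasDerivAt.congr_of_eventuallyEq ?_ hfun
  have hi := h.hasDerivAt_invF
  have hs : HasDerivAt (fun τ => serP p lam (tauF p lam v) ((1 - τ * rhoF p lam v)⁻¹))
      (rhoF p lam v * serP' p lam (tauF p lam v) (invF p lam v)) (v 0) := by
    unfold serP
    refine ((((hi.fun_pow 4).const_mul _).fun_add ((hi.fun_pow 3).const_mul _)).fun_add
      ((hi.fun_pow 2).const_mul _)).congr_deriv ?_
    simp only [serP', invF]
    push_cast
    ring
  have hs' : HasDerivAt (fun τ => serP' p lam (tauF p lam v) ((1 - τ * rhoF p lam v)⁻¹))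
      (rhoF p lam v * serP'' p lam (tauF p lam v) (invF p lam v)) (v 0) := by
    unfold serP'
    refine ((((hi.fun_pow 5).const_mul _).fun_add ((hi.fun_pow 4).const_mul _)).fun_add
      ((hi.fun_pow 3).const_mul _)).congr_deriv ?_
    simp only [serP'', invF]
    push_cast
    ring
  refine ((hs'.const_mul (rhoF p lam v)).fun_div hs h.ser_pos.ne').congr_deriv ?_
  simp only [invF]
  ring

theorem invF_plane (h0 : v 0 = 0) : invF p lam v = 1 := by simp [invF, h0]

/-- At `ξ = 0` the series `∑ₙ (n+1)(n+1+p)(λ(n+1+p)+τ) ξⁿ` and its first two derivatives reduce to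
single terms, those with `n = 0, 1, 2`. This is the origin of `S`, of `e₀ + e₁σ` and of the
expression for `serP''` below. -/
theorem serP_plane (h0 : v 0 = 0) :
    serP p lam (tauF p lam v) (invF p lam v) = S p lam (sigF lam v) := by
  rw [invF_plane h0]
  simp only [serP, S, u3, u4, tauF]
  ring

theorem serP'_plane (h0 : v 0 = 0) :
    serP' p lam (tauF p lam v) (invF p lam v) = e0 p lam + e1 p lam * sigF lam v := by
  rw [invF_plane h0]
  simp only [serP', e0, e1, u3, u4, u5, u6, tauF]
  ring

theorem serP''_plane (h0 : v 0 = 0) :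
    serP'' p lam (tauF p lam v) (invF p lam v) =
      6 * (p + 3) * (lam * (p + 3) + p * (1 + sigF lam v * (lam - 1))) := by
  rw [invF_plane h0]
  simp only [serP'', tauF]
  ring

end IsGood

/-- The logarithmic derivative of the coefficient of `r`. -/
noncomputable def coefB (p lam σ : ℝ) : ℝ :=
  1 / p / (1 - σ) + e1 p lam / (e0 p lam + e1 p lam * σ) - u4 p lam / S p lam σ

/-- The derivative of `coefB`. -/
noncomputable def coefB' (p lam σ : ℝ) : ℝ :=
  1 / p / (1 - σ) ^ 2 - e1 p lam ^ 2 / (e0 p lam + e1 p lam * σ) ^ 2 + u4 p lam ^ 2 / S p lam σ ^ 2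

/-- The coefficient of `r` in the potential. -/
noncomputable def coefA (p lam σ : ℝ) : ℝ :=
  (1 - σ) ^ (-(1 / p)) * ((e0 p lam + e1 p lam * σ) / S p lam σ)

theorem hasDerivAt_S (p lam σ : ℝ) : HasDerivAt (S p lam) (u4 p lam) σ := by
  have := ((hasDerivAt_id σ).const_mul (u4 p lam)).const_add (u3 p lam)
  rw [mul_one] at this
  exact this

theorem hasDerivAt_e (p lam σ : ℝ) :
    HasDerivAt (fun σ => e0 p lam + e1 p lam * σ) (e1 p lam) σ := by
  have := ((hasDerivAt_id σ).const_mul (e1 p lam)).const_add (e0 p lam)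
  rw [mul_one] at this
  exact this

theorem hasDerivAt_one_sub (σ : ℝ) : HasDerivAt (fun σ : ℝ => 1 - σ) (-1) σ :=
  (hasDerivAt_id σ).const_sub 1

theorem hasDerivAt_coefA {p lam σ : ℝ} (hσ : 0 < 1 - σ) (hS : 0 < S p lam σ)
    (he : 0 < e0 p lam + e1 p lam * σ) :
    HasDerivAt (coefA p lam) (coefA p lam σ * coefB p lam σ) σ := by
  have h1 := (hasDerivAt_one_sub σ).rpow_const (p := -(1 / p)) (Or.inl hσ.ne')
  refine (h1.fun_mul ((hasDerivAt_e p lam σ).fun_div (hasDerivAt_S p lam σ) hS.ne')).congr_deriv ?_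
  have he' := he.ne'
  rw [Real.rpow_sub_one hσ.ne', coefA, coefB]
  generalize e0 p lam + e1 p lam * σ = E at he'
  field_simp
  ring

theorem hasDerivAt_coefB {p lam σ : ℝ} (hσ : 0 < 1 - σ) (hS : 0 < S p lam σ)
    (he : 0 < e0 p lam + e1 p lam * σ) :
    HasDerivAt (coefB p lam) (coefB' p lam σ) σ := by
  refine (((((hasDerivAt_const σ (1 / p)).fun_div (hasDerivAt_one_sub σ) hσ.ne').fun_add
    ((hasDerivAt_const σ (e1 p lam)).fun_div (hasDerivAt_e p lam σ) he.ne'))).fun_sub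
    ((hasDerivAt_const σ (u4 p lam)).fun_div (hasDerivAt_S p lam σ) hS.ne')).congr_deriv ?_
  rw [coefB']
  ring

/-- For `r = 0` the series is `S(σ)`, which gives `h(σ) = -(3+1/p) log(1-σ) + log S(σ)`. The
coefficient of `r` is `ρ (e₀+e₁σ)/S`, and the power of `1-t` in `ρ` gives `π = λ/p`. -/
theorem isPlanePotential_potF (p lam C : ℝ) :
    IsPlanePotential (interior {v | IsGood p lam v}) (potF p lam C) lam (2 + lam + lam / p) C
      (lam / p) (fun σ => -(3 + 1 / p) * Real.log (1 - σ) + Real.log (S p lam σ))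
      (fun σ => (3 + 1 / p) / (1 - σ) + u4 p lam / S p lam σ)
      (fun σ => (3 + 1 / p) / (1 - σ) ^ 2 - u4 p lam ^ 2 / S p lam σ ^ 2)
      (fun σ => 2 * (3 + 1 / p) / (1 - σ) ^ 3 + 2 * u4 p lam ^ 3 / S p lam σ ^ 3)
      (fun σ => 6 * (3 + 1 / p) / (1 - σ) ^ 4 - 6 * u4 p lam ^ 4 / S p lam σ ^ 4)
      (coefA p lam) (fun σ => coefA p lam σ * coefB p lam σ)
      (fun σ => coefA p lam σ * (coefB p lam σ ^ 2 + coefB' p lam σ)) := by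
  have hg : ∀ {v}, v ∈ interior {v | IsGood p lam v} → IsGood p lam v := fun h =>
    interior_subset h
  constructor
  · exact isOpen_interior
  · intro v hv; have := (hg hv).t_lt; linarith
  · intro v hv; exact (hg hv).contDiffAt_potF
  · intro v _ h0
    rw [potF, IsGood.serP_plane h0]
    simp only [sigF]
    ring
  · intro v hv h0
    rw [(hg hv).pd_zero_potF, IsGood.serP_plane h0, IsGood.serP'_plane h0, rhoF, coefA]
    simp only [sigF]
    ring
  · intro v hv
    have h := hg hv
    have hs := h.sig_lt
    have hS := h.S_pos
    simp only [sigF] at hs hS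
    refine ((((hasDerivAt_one_sub _).log hs.ne').const_mul (-(3 + 1 / p))).fun_add
      ((hasDerivAt_S p lam _).log hS.ne')).congr_deriv ?_
    ring
  · intro v hv
    have h := hg hv
    have hs := h.sig_lt
    have hS := h.S_pos
    simp only [sigF] at hs hS
    refine (((hasDerivAt_const _ (3 + 1 / p)).fun_div (hasDerivAt_one_sub _) hs.ne').fun_add
      ((hasDerivAt_const _ (u4 p lam)).fun_div (hasDerivAt_S p lam _) hS.ne')).congr_deriv ?_
    ring
  · intro v hv
    have h := hg hv
    have hs := h.sig_lt
    have hS := h.S_pos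
    simp only [sigF] at hs hS
    refine (((hasDerivAt_const _ (3 + 1 / p)).fun_div ((hasDerivAt_one_sub _).fun_pow 2)
      (pow_pos hs 2).ne').fun_sub ((hasDerivAt_const _ (u4 p lam ^ 2)).fun_div
      ((hasDerivAt_S p lam _).fun_pow 2) (pow_pos hS 2).ne')).congr_deriv ?_
    field_simp
    ring
  · intro v hv
    have h := hg hv
    have hs := h.sig_lt
    have hS := h.S_pos
    simp only [sigF] at hs hS
    refine (((hasDerivAt_const _ (2 * (3 + 1 / p))).fun_div ((hasDerivAt_one_sub _).fun_pow 3)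
      (pow_pos hs 3).ne').fun_add ((hasDerivAt_const _ (2 * u4 p lam ^ 3)).fun_div
      ((hasDerivAt_S p lam _).fun_pow 3) (pow_pos hS 3).ne')).congr_deriv ?_
    field_simp
    ring
  · intro v hv
    exact hasDerivAt_coefA (hg hv).sig_lt (hg hv).S_pos (hg hv).e_pos
  · intro v hv
    refine ((hasDerivAt_coefA (hg hv).sig_lt (hg hv).S_pos (hg hv).e_pos).fun_mul
      (hasDerivAt_coefB (hg hv).sig_lt (hg hv).S_pos (hg hv).e_pos)).congr_deriv ?_
    simp only [sigF]
    ring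

/-! ### The rational functions of `δ` -/

theorem linear_pos {a b d : ℝ} (ha : 0 < a) (hab : 0 < a + b) (h0 : 0 ≤ d) (h1 : d ≤ 1) :
    0 < a + b * d := by
  rcases eq_or_lt_of_le h1 with rfl | h1
  · simpa using hab
  · have := add_pos_of_pos_of_nonneg (mul_pos (sub_pos.2 h1) ha) (mul_nonneg h0 hab.le)
    linarith

variable {p lam d : ℝ}

theorem S_pos (hp : 0 < p) (hlam : 0 < lam) (h0 : 0 ≤ d) (h1 : d ≤ 1) : 0 < S p lam d := by
  refine linear_pos ?_ ?_ h0 h1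
  · rw [u3]; positivity
  · have : u3 p lam + u4 p lam = (p + 1) * (lam * (1 + 2 * p)) := by rw [u3, u4]; ring
    rw [this]; positivity

theorem e_pos (hp : 0 < p) (hlam : 0 < lam) (h0 : 0 ≤ d) (h1 : d ≤ 1) :
    0 < e0 p lam + e1 p lam * d := by
  refine linear_pos ?_ ?_ h0 h1
  · have : e0 p lam = 2 * lam * p ^ 2 + 2 * p ^ 2 + 8 * lam * p + 8 * lam + 4 * p := by
      rw [e0, u3, u5]; ring
    rw [this]; positivity
  · have : e0 p lam + e1 p lam = 4 * lam * p ^ 2 + 12 * lam * p + 8 * lam := by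
      rw [e0, e1, u3, u4, u5, u6]; ring
    rw [this]; positivity

theorem A1_eq (hS : S p lam d ≠ 0) : A1 p lam d = (e0 p lam + e1 p lam * d) / S p lam d := by
  rw [A1, e0, e1]
  field_simp
  rw [S]
  ring

theorem A1_pos (hp : 0 < p) (hlam : 0 < lam) (h0 : 0 ≤ d) (h1 : d ≤ 1) : 0 < A1 p lam d := by
  have hS := S_pos hp hlam h0 h1
  rw [A1_eq hS.ne']
  exact div_pos (e_pos hp hlam h0 h1) hS

/-- For `λ < 1` the last term of `A₂` is negative. It is at least `-1` because `S(δ)² + u₃u₄(1-δ)² =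
S(1)(δS(δ) + u₃(1-δ))` is nonnegative. -/
theorem A2_pos (hp : 0 < p) (hlam : 0 < lam) (h0 : 0 ≤ d) (h1 : d ≤ 1) : 0 < A2 p lam d := by
  have hS := S_pos hp hlam h0 h1
  have hS1 := S_pos hp hlam zero_le_one le_rfl
  have hS0 := S_pos hp hlam le_rfl zero_le_one
  have h : -1 ≤ u3 p lam * u4 p lam * (1 - d) ^ 2 / S p lam d ^ 2 := by
    rw [le_div_iff₀ (by positivity)]
    have e : S p lam d ^ 2 + u3 p lam * u4 p lam * (1 - d) ^ 2 =
        S p lam 1 * (d * S p lam d + u3 p lam * (1 - d)) := by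
      simp only [S]; ring
    have h3 : 0 < u3 p lam := by simpa [S] using hS0
    have : 0 ≤ S p lam 1 * (d * S p lam d + u3 p lam * (1 - d)) :=
      mul_nonneg hS1.le (add_nonneg (mul_nonneg h0 hS.le) (mul_nonneg h3.le (sub_nonneg.2 h1)))
    linarith
  have : 0 < 1 / p := by positivity
  rw [A2]; linarith

/-- The linear factor of the denominator of `A₄`. -/
def linL (p lam d : ℝ) : ℝ := d * p * (lam - 1) + p * lam + p + lam

theorem S_eq_linL : S p lam d = (p + 1) * linL p lam d := by
  rw [S, u3, u4, linL]; ring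

theorem linL_pos (hp : 0 < p) (hlam : 0 < lam) (h0 : 0 ≤ d) (h1 : d ≤ 1) : 0 < linL p lam d := by
  have h := S_pos hp hlam h0 h1
  rw [S_eq_linL] at h
  exact pos_of_mul_pos_right h (by positivity)

/-- The three summands are those of `λδh' + (2+λ+λ/p)` multiplied by `p(1-δ)` and `linL`; compare
`potM_eq`. -/
theorem Q_eq : Q p lam d = lam * d * (3 * p + 1) * linL p lam d +
    lam * d * (1 - d) * (p * (p * (lam - 1))) +
    (1 - d) * (2 * p + lam * p + lam) * linL p lam d := by
  rw [Q, q0, q1, q2, linL]; ring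

theorem Q_pos (hp : 0 < p) (hlam : 0 < lam) (h0 : 0 ≤ d) (h1 : d ≤ 1) : 0 < Q p lam d := by
  have hL := linL_pos hp hlam h0 h1
  -- The middle summand is negative for `λ < 1`. Lending it `λδp·linL` from the first turns it into
  -- a multiple of `λ(1+2p)`, which is positive.
  have e : Q p lam d = lam * d * (2 * p + 1) * linL p lam d +
      lam * d * p * (linL p lam d + (1 - d) * (p * (lam - 1))) +
      (1 - d) * (2 * p + lam * p + lam) * linL p lam d := by rw [Q_eq]; ring
  have e2 : linL p lam d + (1 - d) * (p * (lam - 1)) = lam * (1 + 2 * p) := by rw [linL]; ring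
  rw [e, e2]
  have h1' := sub_nonneg.2 h1
  -- The last summand vanishes at `δ = 1` and the others at `δ = 0`, so strictness needs the case
  -- distinction.
  rcases eq_or_lt_of_le h0 with rfl | h0
  · have : 0 < (1 - 0) * (2 * p + lam * p + lam) * linL p lam 0 := by
      rw [sub_zero, one_mul]; positivity
    simpa using this
  · positivity

theorem A4_eq : A4 p lam d = Q p lam d / (p * linL p lam d) := rfl

theorem A4_pos (hp : 0 < p) (hlam : 0 < lam) (h0 : 0 ≤ d) (h1 : d ≤ 1) : 0 < A4 p lam d := by
  rw [A4_eq]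
  exact div_pos (Q_pos hp hlam h0 h1) (mul_pos hp (linL_pos hp hlam h0 h1))

/-- `h'` for `h(σ) = -(3 + 1/p) log (1 - σ) + log S(σ)`. -/
noncomputable def pot1 (p lam d : ℝ) : ℝ := (3 + 1 / p) / (1 - d) + u4 p lam / S p lam d
/-- The derivative of `pot1`. -/
noncomputable def pot2 (p lam d : ℝ) : ℝ :=
  (3 + 1 / p) / (1 - d) ^ 2 - u4 p lam ^ 2 / S p lam d ^ 2
/-- The derivative of `pot2`. -/
noncomputable def pot3 (p lam d : ℝ) : ℝ :=
  2 * (3 + 1 / p) / (1 - d) ^ 3 + 2 * u4 p lam ^ 3 / S p lam d ^ 3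
/-- The derivative of `pot3`. -/
noncomputable def pot4 (p lam d : ℝ) : ℝ :=
  6 * (3 + 1 / p) / (1 - d) ^ 4 - 6 * u4 p lam ^ 4 / S p lam d ^ 4

/-- The left side is `(σh')'`, and the next two identities are its successive derivatives.
Substituting `u₃ = S - u₄δ` lets `S` be treated as an independent variable. -/
theorem potA_eq (hd : 1 - d ≠ 0) (hS : S p lam d ≠ 0) (hp : p ≠ 0) :
    pot1 p lam d + d * pot2 p lam d = A2 p lam d / (1 - d) ^ 2 := by
  have hu : u3 p lam = S p lam d - u4 p lam * d := by rw [S]; ring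
  rw [pot1, pot2, A2, hu]
  field_simp
  ring

/-- The derivative of `A₂`. -/
noncomputable def A2' (p lam d : ℝ) : ℝ :=
  -2 * u3 p lam * u4 p lam * (1 - d) * (u3 p lam + u4 p lam) / S p lam d ^ 3

theorem potA'_eq (hd : 1 - d ≠ 0) (hS : S p lam d ≠ 0) (hp : p ≠ 0) :
    2 * pot2 p lam d + d * pot3 p lam d =
      A2' p lam d / (1 - d) ^ 2 + 2 * A2 p lam d / (1 - d) ^ 3 := by
  have hu : u3 p lam = S p lam d - u4 p lam * d := by rw [S]; ring
  rw [pot2, pot3, A2', A2, hu]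
  field_simp
  ring

theorem potA''_eq (hd : 1 - d ≠ 0) (hS : S p lam d ≠ 0) (hp : p ≠ 0) :
    3 * pot3 p lam d + d * pot4 p lam d =
      2 * u3 p lam * u4 p lam * (u3 p lam + u4 p lam) *
        (S p lam d + 3 * u4 p lam * (1 - d)) / S p lam d ^ 4 / (1 - d) ^ 2 +
      4 * A2' p lam d / (1 - d) ^ 3 + 6 * A2 p lam d / (1 - d) ^ 4 := by
  have hu : u3 p lam = S p lam d - u4 p lam * d := by rw [S]; ring
  rw [pot3, pot4, A2', A2, hu]
  field_simp
  ring

theorem potM_eq (hd : 1 - d ≠ 0) (hL : linL p lam d ≠ 0) (hp : p ≠ 0) (hp1 : p + 1 ≠ 0) :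
    lam * d * pot1 p lam d + (2 + lam + lam / p) = A4 p lam d / (1 - d) := by
  rw [pot1, A4_eq, S_eq_linL, Q_eq, u4]
  field_simp

/-- The left side is a diagonal entry of `jetV` divided by the square of the corresponding squared
length, with the powers of `q` cancelled. The following identities have the same origin for the
other entries. -/
theorem H5_eq (hd : 1 - d ≠ 0) (hS : S p lam d ≠ 0) (hp : p ≠ 0) (hA2 : A2 p lam d ≠ 0) :
    -((2 * pot2 p lam d + d * pot3 p lam d) + d * (3 * pot3 p lam d + d * pot4 p lam d) -
      d * (2 * pot2 p lam d + d * pot3 p lam d) ^ 2 / (pot1 p lam d + d * pot2 p lam d)) /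
      (pot1 p lam d + d * pot2 p lam d) ^ 2 = H5 p lam d / A2 p lam d ^ 2 := by
  rw [potA_eq hd hS hp, potA'_eq hd hS hp, potA''_eq hd hS hp, H5, A2']
  have hu : u3 p lam = S p lam d - u4 p lam * d := by rw [S]; ring
  generalize A2 p lam d = a at *
  rw [hu]
  generalize S p lam d = s at *
  field_simp
  ring

theorem H1_eq (hS : S p lam d ≠ 0) (he : e0 p lam + e1 p lam * d ≠ 0) :
    -2 * (6 * (p + 3) * (lam * (p + 3) + p * (1 + d * (lam - 1))) * S p lam d -
      (e0 p lam + e1 p lam * d) ^ 2) / (e0 p lam + e1 p lam * d) ^ 2 =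
      H1 p lam d / A1 p lam d ^ 2 := by
  rw [A1_eq hS, H1]
  have hE : u5 p lam + u6 p lam * d = (e0 p lam + e1 p lam * d) - 4 * S p lam d := by
    rw [e0, e1, S]; ring
  -- The quadratic `(n+p)(λ(n+p)+τ)` takes the values `u₁+u₂δ`, `S`, `(e₀+e₁δ)/2` and
  -- `(p+3)(λ(p+3)+τ)` at `n = -1, 1, 2, 3`, where `τ = p(1+δ(λ-1))`. This is Lagrange extrapolation
  -- from `1, 2, 3` to `-1`.
  have hU : u1 p lam + u2 p lam * d = 3 * (p + 3) * (lam * (p + 3) + p * (1 + d * (lam - 1))) -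
      4 * (e0 p lam + e1 p lam * d) + 6 * S p lam d := by
    rw [e0, e1, S, u1, u2, u3, u4, u5, u6]; ring
  rw [hE, hU]
  generalize e0 p lam + e1 p lam * d = E at *
  generalize S p lam d = s at *
  field_simp
  ring

theorem H2_eq (hd : 1 - d ≠ 0) (hS : S p lam d ≠ 0) (hp : p ≠ 0)
    (he : e0 p lam + e1 p lam * d ≠ 0) (hA1 : A1 p lam d ≠ 0) (hA2 : A2 p lam d ≠ 0) :
    -(coefB p lam d + d * coefB' p lam d) / (pot1 p lam d + d * pot2 p lam d) =
      H2 p lam d / (A1 p lam d * A2 p lam d) := by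
  rw [potA_eq hd hS hp, H2, coefB, coefB']
  have hu : u3 p lam = S p lam d - u4 p lam * d := by rw [S]; ring
  obtain ⟨E, hE⟩ : ∃ E, E = e0 p lam + e1 p lam * d := ⟨_, rfl⟩
  have he0 : e0 p lam = E - e1 p lam * d := by rw [hE]; ring
  rw [← hE] at he ⊢
  rw [hu, he0]
  generalize A2 p lam d = a at *
  generalize A1 p lam d = a at *
  generalize S p lam d = s at *
  field_simp
  ring

theorem F1_eq (hd : 1 - d ≠ 0) (hS : S p lam d ≠ 0) (hp : p ≠ 0) (hp1 : p + 1 ≠ 0)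
    (he : e0 p lam + e1 p lam * d ≠ 0) (hA4 : A4 p lam d ≠ 0) :
    -(lam / p + lam * d * coefB p lam d) / (lam * d * pot1 p lam d + (2 + lam + lam / p)) =
      F1 p lam d / (A1 p lam d * A4 p lam d) := by
  have hL : linL p lam d ≠ 0 := by
    rw [S_eq_linL] at hS; exact right_ne_zero_of_mul hS
  rw [potM_eq hd hL hp hp1, F1, coefB]
  -- Passing from `u₅, u₆` to `e₀, e₁` adds `4u₃, 4u₄`, which does not change the determinant.
  have hn : u3 p lam * u6 p lam - u4 p lam * u5 p lam =
      u3 p lam * e1 p lam - u4 p lam * e0 p lam := by rw [e0, e1]; ring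
  rw [hn, A1_eq hS]
  have hu : u3 p lam = S p lam d - u4 p lam * d := by rw [S]; ring
  obtain ⟨E, hE⟩ : ∃ E, E = e0 p lam + e1 p lam * d := ⟨_, rfl⟩
  have he0 : e0 p lam = E - e1 p lam * d := by rw [hE]; ring
  rw [← hE] at he ⊢
  rw [hu, he0]
  generalize A4 p lam d = a at *
  generalize S p lam d = s at *
  field_simp
  ring

theorem F3_eq (hd : 1 - d ≠ 0) (hS : S p lam d ≠ 0) (hp : p ≠ 0) (hp1 : p + 1 ≠ 0)
    (hA4 : A4 p lam d ≠ 0) :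
    -2 * ((lam * d * pot1 p lam d + (2 + lam + lam / p)) +
      lam ^ 2 * d * (pot1 p lam d + d * pot2 p lam d)) /
      (lam * d * pot1 p lam d + (2 + lam + lam / p)) ^ 2 = F3 p lam d / A4 p lam d ^ 2 := by
  have hL : linL p lam d ≠ 0 := by
    rw [S_eq_linL] at hS; exact right_ne_zero_of_mul hS
  rw [potM_eq hd hL hp hp1, potA_eq hd hS hp, F3]
  field_simp

/-- The logarithmic derivative of `A₄ / (1 - δ)`. -/
noncomputable def logM' (p lam d : ℝ) : ℝ :=
  (q1 p lam + 2 * q2 p lam * d) / Q p lam d - p * (lam - 1) / linL p lam d + 1 / (1 - d)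

/-- Put `M = λσh' + c = A₄/(1-σ)`. Then `M' = λ(σh')'`, and the right side is `M (log M)'`. -/
theorem lam_mul_potA_eq (hd : 1 - d ≠ 0) (hL : linL p lam d ≠ 0) (hp : p ≠ 0) (hp1 : p + 1 ≠ 0)
    (hQ : Q p lam d ≠ 0) :
    lam * (pot1 p lam d + d * pot2 p lam d) = A4 p lam d / (1 - d) * logM' p lam d := by
  have hS : S p lam d ≠ 0 := by rw [S_eq_linL]; exact mul_ne_zero hp1 hL
  rw [potA_eq hd hS hp, A4_eq, logM', A2, S_eq_linL]
  field_simp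
  simp only [Q, q0, q1, q2, u3, u4, linL]
  ring

/-- The derivative of `logM'`. -/
noncomputable def logM'' (p lam d : ℝ) : ℝ :=
  2 * q2 p lam / Q p lam d - (q1 p lam + 2 * q2 p lam * d) ^ 2 / Q p lam d ^ 2 +
    p ^ 2 * (lam - 1) ^ 2 / linL p lam d ^ 2 + 1 / (1 - d) ^ 2

/-- The second derivative of the same `M`, since `M'' = M((log M)'² + (log M)'')`. -/
theorem lam_mul_potA'_eq (hd : 1 - d ≠ 0) (hL : linL p lam d ≠ 0) (hp : p ≠ 0) (hp1 : p + 1 ≠ 0)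
    (hQ : Q p lam d ≠ 0) :
    lam * (2 * pot2 p lam d + d * pot3 p lam d) =
      A4 p lam d / (1 - d) * (logM' p lam d ^ 2 + logM'' p lam d) := by
  have hS : S p lam d ≠ 0 := by rw [S_eq_linL]; exact mul_ne_zero hp1 hL
  have e : A4 p lam d / (1 - d) * (logM' p lam d ^ 2 + logM'' p lam d) =
      (2 * q2 p lam * linL p lam d ^ 2 * (1 - d) ^ 2
        - 2 * (q1 p lam + 2 * q2 p lam * d) * (p * (lam - 1)) * linL p lam d * (1 - d) ^ 2
        + 2 * (q1 p lam + 2 * q2 p lam * d) * linL p lam d ^ 2 * (1 - d)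
        + 2 * (p * (lam - 1)) ^ 2 * Q p lam d * (1 - d) ^ 2
        - 2 * (p * (lam - 1)) * Q p lam d * linL p lam d * (1 - d)
        + 2 * Q p lam d * linL p lam d ^ 2) / (p * linL p lam d ^ 3 * (1 - d) ^ 3) := by
    rw [A4_eq, logM', logM'']
    generalize linL p lam d = l at *
    generalize Q p lam d = q at *
    field_simp
    ring
  rw [potA'_eq hd hS hp, e, A2', A2, S_eq_linL]
  field_simp
  simp only [Q, q0, q1, q2, u3, u4, linL]
  ring

/-- With `M = λσh' + c` the numerator is `-(M' + σM'' - σM'²/M) = -M((log M)' + σ(log M)'')`, so the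
squares of logarithmic derivatives cancel. What remains is evaluated in `key`. -/
theorem F2_eq (hd : 1 - d ≠ 0) (hL : linL p lam d ≠ 0) (hp : p ≠ 0) (hp1 : p + 1 ≠ 0)
    (hQ : Q p lam d ≠ 0) (hA2 : A2 p lam d ≠ 0) (hA4 : A4 p lam d ≠ 0) :
    -lam * ((pot1 p lam d + d * pot2 p lam d) + d * (2 * pot2 p lam d + d * pot3 p lam d) -
      lam * d * (pot1 p lam d + d * pot2 p lam d) ^ 2 /
        (lam * d * pot1 p lam d + (2 + lam + lam / p))) /
      ((pot1 p lam d + d * pot2 p lam d) * (lam * d * pot1 p lam d + (2 + lam + lam / p))) =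
      F2 p lam d / (A2 p lam d * A4 p lam d) := by
  have hS : S p lam d ≠ 0 := by rw [S_eq_linL]; exact mul_ne_zero hp1 hL
  have hM := potM_eq hd hL hp hp1
  have e1 := lam_mul_potA_eq hd hL hp hp1 hQ
  have e2 := lam_mul_potA'_eq hd hL hp hp1 hQ
  have e3 := potA_eq hd hS hp
  have key : logM' p lam d + d * logM'' p lam d =
      (q0 p lam * q1 p lam + 4 * q0 p lam * q2 p lam * d + q1 p lam * q2 p lam * d ^ 2) /
        Q p lam d ^ 2 - u3 p lam * u4 p lam / S p lam d ^ 2 + 1 / (1 - d) ^ 2 := by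
    have hu4 : p * (lam - 1) = u4 p lam / (p + 1) := by rw [u4]; field_simp
    have hl : linL p lam d = S p lam d / (p + 1) := by rw [S_eq_linL]; field_simp
    have hu : u3 p lam = S p lam d - u4 p lam * d := by rw [S]; ring
    have hq : q0 p lam = Q p lam d - q1 p lam * d - q2 p lam * d ^ 2 := by rw [Q]; ring
    rw [logM', logM'', ← mul_pow, hu4, hl, hu, hq]
    generalize S p lam d = s at *
    generalize Q p lam d = q at *
    field_simp
    ring
  have e4 : (1 - d) ^ 2 * ((q0 p lam * q1 p lam + 4 * q0 p lam * q2 p lam * d +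
      q1 p lam * q2 p lam * d ^ 2) / Q p lam d ^ 2 - u3 p lam * u4 p lam / S p lam d ^ 2) =
      (1 - d) ^ 2 * (logM' p lam d + d * logM'' p lam d) - 1 := by
    rw [key]; field_simp; ring
  rw [F2, e4, hM]
  generalize pot1 p lam d + d * pot2 p lam d = A at *
  generalize 2 * pot2 p lam d + d * pot3 p lam d = A' at *
  have hA : A ≠ 0 := by rw [e3]; exact div_ne_zero hA2 (pow_ne_zero 2 hd)
  have hA2' : A2 p lam d = A * (1 - d) ^ 2 := by rw [e3]; field_simp
  have step : -lam * (A + d * A' - lam * d * A ^ 2 / (A4 p lam d / (1 - d))) =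
      -(lam * A + d * (lam * A') - d * (lam * A) ^ 2 / (A4 p lam d / (1 - d))) := by ring
  rw [step, e1, e2, hA2']
  generalize A4 p lam d = a at *
  field_simp
  ring

/-! ### The frame and the curvature at a real point -/

/-- A real vector as a complex vector. -/
def toC {n : ℕ} (u : Fin n → ℝ) : Fin n → ℂ := fun i => (u i : ℂ)

section Linear

variable {n : ℕ} (g : (Fin n → ℂ) → Matrix (Fin n) (Fin n) ℂ) (z : Fin n → ℂ)

theorem herm_add_left (u v w : Fin n → ℂ) : herm g z (u + v) w = herm g z u w + herm g z v w := by
  simp only [herm, Pi.add_apply, mul_add, add_mul, Finset.sum_add_distrib]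

theorem herm_smul_left (a : ℂ) (u w : Fin n → ℂ) : herm g z (a • u) w = a * herm g z u w := by
  simp only [herm, Pi.smul_apply, smul_eq_mul, Finset.mul_sum]
  exact Finset.sum_congr rfl fun _ _ => Finset.sum_congr rfl fun _ _ => by ring

theorem herm_add_right (u v w : Fin n → ℂ) : herm g z w (u + v) = herm g z w u + herm g z w v := by
  simp only [herm, Pi.add_apply, star_add, mul_add, Finset.sum_add_distrib]

theorem herm_smul_right (a : ℂ) (u w : Fin n → ℂ) :
    herm g z w (a • u) = star a * herm g z w u := by
  simp only [herm, Pi.smul_apply, smul_eq_mul, Finset.mul_sum, star_mul]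
  exact Finset.sum_congr rfl fun _ _ => Finset.sum_congr rfl fun _ _ => by ring

theorem curv_smul (a b c d : ℂ) (u v w t : Fin n → ℂ) :
    curv g z (a • u) (b • v) (c • w) (d • t) = a * star b * c * star d * curv g z u v w t := by
  simp only [curv, Pi.smul_apply, smul_eq_mul, Finset.mul_sum, star_mul]
  exact Finset.sum_congr rfl fun _ _ => Finset.sum_congr rfl fun _ _ =>
    Finset.sum_congr rfl fun _ _ => Finset.sum_congr rfl fun _ _ => by ring

theorem herm_sum_sum {m : ℕ} (c e : Fin m → ℂ) (V : Fin m → Fin n → ℂ) :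
    herm g z (∑ α, c α • V α) (∑ α, e α • V α) =
      ∑ α, ∑ β, c α * star (e β) * herm g z (V α) (V β) := by
  have hl : ∀ (s : Finset (Fin m)) (w : Fin n → ℂ), herm g z (∑ α ∈ s, c α • V α) w =
      ∑ α ∈ s, c α * herm g z (V α) w := by
    classical
    intro s w
    induction s using Finset.induction_on with
    | empty => simp [herm]
    | insert a s ha ih => rw [Finset.sum_insert ha, Finset.sum_insert ha, herm_add_left,
        herm_smul_left, ih]
  have hr : ∀ (s : Finset (Fin m)) (w : Fin n → ℂ), herm g z w (∑ α ∈ s, e α • V α) =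
      ∑ α ∈ s, star (e α) * herm g z w (V α) := by
    classical
    intro s w
    induction s using Finset.induction_on with
    | empty => simp [herm]
    | insert a s ha ih => rw [Finset.sum_insert ha, Finset.sum_insert ha, herm_add_right,
        herm_smul_right, ih]
  rw [hl]
  refine Finset.sum_congr rfl fun α _ => ?_
  rw [hr, Finset.mul_sum]
  exact Finset.sum_congr rfl fun β _ => by ring

theorem herm_toC {G : Fin n → Fin n → ℝ} (hG : ∀ i j, g z i j = G i j) (u v : Fin n → ℝ) :
    herm g z (toC u) (toC v) = ((∑ i, ∑ j, G i j * u i * v j : ℝ) : ℂ) := by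
  simp [herm, toC, hG]

theorem curv_toC {R : Fin n → Fin n → Fin n → Fin n → ℝ}
    (hR : ∀ i j k l, curvComp g z i j k l = R i j k l) (u v w t : Fin n → ℝ) :
    curv g z (toC u) (toC v) (toC w) (toC t) =
      ((∑ i, ∑ j, ∑ k, ∑ l, R i j k l * u i * v j * w k * t l : ℝ) : ℂ) := by
  simp [curv, toC, hR]

theorem normalize_of_herm_eq {u : Fin n → ℂ} {N : ℝ} (h : herm g z u u = N) :
    normalize g z u = ((Real.sqrt N : ℝ) : ℂ)⁻¹ • u := by
  rw [normalize, h, Complex.ofReal_re]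

/-- The Gram–Schmidt frame normalizes the coordinate field before projecting; this positive factor
disappears in the final normalization. -/
theorem normalize_smul_of_pos {u : Fin n → ℂ} {N c : ℝ} (h : herm g z u u = N) (hc : 0 < c) :
    normalize g z ((c : ℂ) • u) = ((Real.sqrt N : ℝ) : ℂ)⁻¹ • u := by
  have h1 : herm g z ((c : ℂ) • u) ((c : ℂ) • u) = ((c ^ 2 * N : ℝ) : ℂ) := by
    rw [herm_smul_left, herm_smul_right, h]
    simp
    ring
  have hc' : (c : ℂ) ≠ 0 := by exact_mod_cast hc.ne'
  rw [normalize_of_herm_eq g z h1, Real.sqrt_mul (sq_nonneg c), Real.sqrt_sq hc.le, smul_smul]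
  congr 1
  push_cast
  rw [mul_inv]
  field_simp

end Linear

/-- The Gram–Schmidt frame in terms of an orthogonal frame obtained from the coordinate fields by
a unipotent change of basis. -/
theorem frame_eq_of_orthogonal (g : (Fin 3 → ℂ) → Matrix (Fin 3) (Fin 3) ℂ) (z : Fin 3 → ℂ) (b : ℝ)
    {N : Fin 3 → ℝ} (hN : ∀ α, 0 < N α)
    (hW : ∀ α β, herm g z (toC (jetW b α)) (toC (jetW b β)) = if α = β then (N α : ℂ) else 0)
    (α : Fin 3) : frame g z α = ((Real.sqrt (N α) : ℝ) : ℂ)⁻¹ • toC (jetW b α) := by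
  have hWW : ∀ α, herm g z (toC (jetW b α)) (toC (jetW b α)) = N α := fun α => by
    rw [hW, if_pos rfl]
  have w0 : (Pi.single 0 1 : Fin 3 → ℂ) = toC (jetW b 0) := by
    ext i; fin_cases i <;> simp [toC, jetW]
  have w1 : (Pi.single 1 1 : Fin 3 → ℂ) = toC (jetW b 1) := by
    ext i; fin_cases i <;> simp [toC, jetW]
  have w2 : (Pi.single 2 1 : Fin 3 → ℂ) = toC (jetW b 2) + (-(b : ℂ)) • toC (jetW b 1) := by
    ext i; fin_cases i <;> simp [toC, jetW]
  have hX : frameX g z = ((Real.sqrt (N 0) : ℝ) : ℂ)⁻¹ • toC (jetW b 0) := by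
    rw [frameX, w0, normalize_of_herm_eq g z (hWW 0)]
  have hs : ∀ α, ((Real.sqrt (N α) : ℝ) : ℂ) ≠ 0 := fun α => by
    exact_mod_cast (Real.sqrt_pos.2 (hN α)).ne'
  have hY : frameY g z = ((Real.sqrt (N 1) : ℝ) : ℂ)⁻¹ • toC (jetW b 1) := by
    have h10 : herm g z (((Real.sqrt (N 1) : ℝ) : ℂ)⁻¹ • toC (jetW b 1)) (frameX g z) = 0 := by
      rw [hX, herm_smul_left, herm_smul_right, hW, if_neg (by decide)]
      simp
    simp only [frameY]
    rw [w1, normalize_of_herm_eq g z (hWW 1), h10, zero_smul, sub_zero]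
    rw [← Complex.ofReal_inv, normalize_smul_of_pos g z (hWW 1)
      (inv_pos.2 (Real.sqrt_pos.2 (hN 1)))]
    rw [Complex.ofReal_inv]
  have hZ : frameZ g z = ((Real.sqrt (N 2) : ℝ) : ℂ)⁻¹ • toC (jetW b 2) := by
    have h22 : herm g z (Pi.single 2 1) (Pi.single 2 1) = ((N 2 + b ^ 2 * N 1 : ℝ) : ℂ) := by
      rw [w2]
      simp only [herm_add_left, herm_add_right, herm_smul_left, herm_smul_right, hW]
      simp
      ring
    have hpos : 0 < N 2 + b ^ 2 * N 1 := by
      have := hN 2; have := hN 1; positivity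
    obtain ⟨c, hc⟩ : ∃ c : ℝ, c = (Real.sqrt (N 2 + b ^ 2 * N 1))⁻¹ := ⟨_, rfl⟩
    have hcpos : 0 < c := by rw [hc]; exact inv_pos.2 (Real.sqrt_pos.2 hpos)
    have hv : normalize g z (Pi.single 2 1) = (c : ℂ) • (Pi.single 2 1 : Fin 3 → ℂ) := by
      rw [normalize_of_herm_eq g z h22, hc, Complex.ofReal_inv]
    have hv0 : herm g z ((c : ℂ) • (Pi.single 2 1 : Fin 3 → ℂ)) (frameX g z) = 0 := by
      rw [hX, w2, herm_smul_left, herm_smul_right, herm_add_left, herm_smul_left, hW, hW,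
        if_neg (by decide), if_neg (by decide)]
      simp
    -- Projection onto `Y` gives exactly the `jetW b 1` part of `∂₃`; subtracting it leaves a
    -- positive multiple of `jetW b 2`.
    have hv1 : herm g z ((c : ℂ) • (Pi.single 2 1 : Fin 3 → ℂ)) (frameY g z) • frameY g z =
        (c : ℂ) • (-(b : ℂ)) • toC (jetW b 1) := by
      rw [hY, w2, herm_smul_left, herm_smul_right, herm_add_left, herm_smul_left, hW, hW,
        if_neg (by decide), if_pos rfl, smul_smul, smul_smul]
      congr 1
      have h1 : ((Real.sqrt (N 1) : ℝ) : ℂ) * ((Real.sqrt (N 1) : ℝ) : ℂ) = N 1 := by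
        rw [← Complex.ofReal_mul, Real.mul_self_sqrt (hN 1).le]
      have h2 := hs 1
      rw [← h1, star_inv₀]
      simp
      field_simp
    simp only [frameZ]
    rw [hv, hv0, hv1, zero_smul, sub_zero, ← smul_sub, w2, add_sub_cancel_right,
      normalize_smul_of_pos g z (hWW 2) hcpos]
  fin_cases α
  · exact hX
  · exact hY
  · exact hZ

namespace IsRadialOn

variable {n : ℕ} {Ω U : Set (Fin n → ℂ)} {φ : (Fin n → ℝ) → ℝ}

theorem bergmanMetric_eq (h : IsRadialOn U φ)
    (hB : ∀ z ∈ U, Real.log (bergmanKernel Ω z) = φ (sqMod z)) {z : Fin n → ℂ} (hz : z ∈ U)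
    (i j : Fin n) :
    bergmanMetric Ω z i j = dz i (dzbar j fun w => (φ (sqMod w) : ℂ)) z := by
  rw [bergmanMetric, Matrix.of_apply]
  refine dz_congr ?_ i
  filter_upwards [h.isOpen.mem_nhds hz] with w hw
  refine dzbar_congr ?_ j
  filter_upwards [h.isOpen.mem_nhds hw] with u hu
  rw [hB u hu]

theorem bergmanMetric_toC (h : IsRadialOn U φ)
    (hB : ∀ z ∈ U, Real.log (bergmanKernel Ω z) = φ (sqMod z)) {x : Fin n → ℝ} (hx : toC x ∈ U)
    (i j : Fin n) :
    bergmanMetric Ω (toC x) i j = ((jetG x (fun i => Bergman.pd i φ (sqMod (toC x)))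
      (fun i j => Bergman.pd i (Bergman.pd j φ) (sqMod (toC x))) i j : ℝ) : ℂ) := by
  rw [h.bergmanMetric_eq hB hx, h.dz_dzbar hx, jetG]
  simp only [toC, Complex.conj_ofReal]
  push_cast [apply_ite Complex.ofReal]
  rfl

theorem curvComp_toC (h : IsRadialOn U φ)
    (hB : ∀ z ∈ U, Real.log (bergmanKernel Ω z) = φ (sqMod z)) {x : Fin n → ℝ} (hx : toC x ∈ U)
    {W : Fin n → Fin n → ℝ} {N : Fin n → ℝ}
    (hinv : ∀ a b, (bergmanMetric Ω (toC x))⁻¹ a b = ((∑ e, W e a * W e b / N e : ℝ) : ℂ))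
    (i j k l : Fin n) :
    curvComp (bergmanMetric Ω) (toC x) i j k l = ((jetR x
      (fun i j => Bergman.pd i (Bergman.pd j φ) (sqMod (toC x)))
      (fun i j l => Bergman.pd i (Bergman.pd j (Bergman.pd l φ)) (sqMod (toC x)))
      (fun i j l e => Bergman.pd i (Bergman.pd j (Bergman.pd l (Bergman.pd e φ))) (sqMod (toC x)))
      W N i j k l : ℝ) : ℂ) := by
  have hg : ∀ i j, ∀ w ∈ U, (fun w => bergmanMetric Ω w i j) w =
      dz i (dzbar j fun w => (φ (sqMod w) : ℂ)) w := fun i j w hw => h.bergmanMetric_eq hB hw i j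
  rw [curvComp, h.dz_dzbar_metric hx i j k l (hg i j), jetR]
  simp only [hinv, h.dz_metric hx _ _ _ (hg _ _), h.dzbar_metric hx _ _ _ (hg _ _), jetQ, jetT,
    jetTbar]
  push_cast [apply_ite Complex.ofReal]
  simp only [toC, Complex.conj_ofReal]

end IsRadialOn

/-- From `W G Wᵀ = D` with `D` diagonal one gets `G⁻¹ = Wᵀ D⁻¹ W`; a one-sided inverse of a square
matrix is two-sided. -/
theorem inv_apply_of_orthogonal {n : ℕ} {G : Matrix (Fin n) (Fin n) ℂ} {W : Fin n → Fin n → ℝ}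
    {N : Fin n → ℝ} (hN : ∀ α, N α ≠ 0)
    (hW : ∀ α β, ∑ i, ∑ j, G i j * W α i * W β j = if α = β then (N α : ℂ) else 0) (a b : Fin n) :
    G⁻¹ a b = ((∑ e, W e a * W e b / N e : ℝ) : ℂ) := by
  set Wm : Matrix (Fin n) (Fin n) ℂ := Matrix.of fun α i => (W α i : ℂ) with hWm
  set D : Matrix (Fin n) (Fin n) ℂ := Matrix.diagonal fun α => ((N α : ℂ))⁻¹ with hD
  have h1 : Wm * (G * (Wm.transpose * D)) = 1 := by
    have h2 : Wm * G * Wm.transpose = Matrix.diagonal fun α => (N α : ℂ) := by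
      ext α β
      rw [Matrix.mul_assoc, Matrix.mul_apply, Matrix.diagonal_apply, ← hW]
      refine Finset.sum_congr rfl fun i _ => ?_
      rw [Matrix.mul_apply, Finset.mul_sum]
      refine Finset.sum_congr rfl fun j _ => ?_
      simp [hWm]
      ring
    rw [← Matrix.mul_assoc, ← Matrix.mul_assoc, h2, hD, Matrix.diagonal_mul_diagonal,
      ← Matrix.diagonal_one]
    congr 1
    ext α
    exact mul_inv_cancel₀ (by exact_mod_cast hN α)
  have h3 : G * (Wm.transpose * D * Wm) = 1 := by
    rw [← Matrix.mul_assoc]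
    exact mul_eq_one_comm.1 h1
  rw [Matrix.inv_eq_right_inv h3, Matrix.mul_apply]
  push_cast
  refine Finset.sum_congr rfl fun e _ => ?_
  rw [hD, Matrix.mul_diagonal]
  simp [hWm]
  ring

/-! ### The domain in terms of the squared moduli -/

theorem norm_rpow_two_mul (z : ℂ) (p : ℝ) : ‖z‖ ^ (2 * p) = Complex.normSq z ^ p := by
  rw [Real.rpow_mul (norm_nonneg z), Real.rpow_two, ← Complex.normSq_eq_norm_sq]

theorem mem_domainE_iff {p lam : ℝ} (hlam : 0 < lam) {z : Fin 3 → ℂ} :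
    z ∈ domainE p lam ↔ sqMod z 2 < 1 ∧ sqMod z 0 ^ p + sqMod z 1 < (1 - sqMod z 2) ^ lam := by
  have hX : 0 ≤ sqMod z 0 ^ p + sqMod z 1 :=
    add_nonneg (Real.rpow_nonneg (Complex.normSq_nonneg _) _) (Complex.normSq_nonneg _)
  rw [domainE, Set.mem_ofPred_eq, norm_rpow_two_mul, ← Complex.normSq_eq_norm_sq,
    ← Complex.normSq_eq_norm_sq, one_div]
  change (sqMod z 0 ^ p + sqMod z 1) ^ lam⁻¹ + sqMod z 2 < 1 ↔ _
  constructor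
  · intro h
    have h1 := lt_sub_iff_add_lt.2 h
    have h0 : 0 ≤ 1 - sqMod z 2 := (Real.rpow_nonneg hX _).trans h1.le
    refine ⟨by have := Real.rpow_nonneg hX lam⁻¹; linarith, ?_⟩
    exact (Real.rpow_inv_lt_iff_of_pos hX h0 hlam).1 h1
  · rintro ⟨h0, h1⟩
    exact lt_sub_iff_add_lt.1 ((Real.rpow_inv_lt_iff_of_pos hX (sub_pos.2 h0).le hlam).2 h1)

theorem isOpen_domainE {p lam : ℝ} (hp : 0 < p) (hlam : 0 < lam) : IsOpen (domainE p lam) := by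
  refine isOpen_lt ?_ continuous_const
  refine ((((continuous_norm.comp (continuous_apply 0)).rpow_const fun _ => Or.inr
    (by positivity)).add ((continuous_norm.comp (continuous_apply 1)).pow 2)).rpow_const
    fun _ => Or.inr (by positivity)).add ((continuous_norm.comp (continuous_apply 2)).pow 2)

theorem one_sub_sigF {lam : ℝ} {v : Fin 3 → ℝ} (ht : v 2 < 1) :
    (1 - v 2) ^ lam - v 1 = (1 - v 2) ^ lam * (1 - sigF lam v) := by
  have h := Real.rpow_pos_of_pos (sub_pos.2 ht) lam
  rw [sigF, Real.rpow_neg (sub_pos.2 ht).le]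
  field_simp

/-- In this form `ξ = r ρ = r / ((1-t)^λ - s)^(1/p)`, so `ξ < 1` is the defining inequality of the
domain (`xi_sqMod_lt`). -/
theorem rhoF_eq {p lam : ℝ} {v : Fin 3 → ℝ} (ht : v 2 < 1) (hs : 0 < 1 - sigF lam v) :
    rhoF p lam v = ((1 - v 2) ^ lam - v 1) ^ (-(1 / p)) := by
  have h := Real.rpow_pos_of_pos (sub_pos.2 ht) lam
  rw [one_sub_sigF ht, Real.mul_rpow h.le hs.le, ← Real.rpow_mul (sub_pos.2 ht).le, rhoF]
  congr 2
  ring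

theorem tau_pos {p lam d : ℝ} (hp : 0 < p) (hlam : 0 < lam) (h0 : 0 ≤ d) (h1 : d ≤ 1) :
    0 < p * (1 + d * (lam - 1)) := by
  have := linear_pos (a := 1) (b := lam - 1) one_pos (by linarith) h0 h1
  rw [mul_comm d]
  positivity

/-- The coefficients in `i` can be negative; those of the expansion at `i = 1`, after removing the
factor `i²`, are not. -/
theorem serP_pos {p lam τ i : ℝ} (hp : 0 < p) (hlam : 0 < lam) (hτ : 0 < τ) (hi : 1 ≤ i) :
    0 < serP p lam τ i := by
  obtain ⟨j, rfl⟩ : ∃ j, i = 1 + j := ⟨i - 1, by ring⟩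
  have hj : 0 ≤ j := by linarith
  have : serP p lam τ (1 + j) = (1 + j) ^ 2 *
      (lam * (6 * j ^ 2 + (6 + 4 * p) * j + (p + 1) ^ 2) + τ * (p + 1 + 2 * j)) := by
    rw [serP]; ring
  rw [this]
  positivity

/-- The facts about the squared moduli of a point of the domain. -/
theorem sigF_sqMod_mem {p lam : ℝ} (hlam : 0 < lam) {z : Fin 3 → ℂ}
    (hz : z ∈ domainE p lam) : 0 ≤ sigF lam (sqMod z) ∧ sigF lam (sqMod z) < 1 := by
  obtain ⟨ht, h⟩ := (mem_domainE_iff hlam).1 hz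
  have hr : 0 ≤ sqMod z 0 ^ p := Real.rpow_nonneg (Complex.normSq_nonneg _) _
  have hs : 0 ≤ sqMod z 1 := Complex.normSq_nonneg _
  have ht' := sub_pos.2 ht
  refine ⟨mul_nonneg hs (Real.rpow_nonneg ht'.le _), ?_⟩
  rw [sigF, Real.rpow_neg ht'.le, ← div_eq_mul_inv, div_lt_one (Real.rpow_pos_of_pos ht' _)]
  linarith

theorem xi_sqMod_lt {p lam : ℝ} (hp : 0 < p) (hlam : 0 < lam) {z : Fin 3 → ℂ}
    (hz : z ∈ domainE p lam) : sqMod z 0 * rhoF p lam (sqMod z) < 1 := by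
  obtain ⟨ht, h⟩ := (mem_domainE_iff hlam).1 hz
  have hs := sub_pos.2 (sigF_sqMod_mem hlam hz).2
  have hr : 0 ≤ sqMod z 0 := Complex.normSq_nonneg _
  have hD : 0 < (1 - sqMod z 2) ^ lam - sqMod z 1 := by
    rw [one_sub_sigF ht]
    exact mul_pos (Real.rpow_pos_of_pos (sub_pos.2 ht) _) hs
  have h1 : sqMod z 0 < ((1 - sqMod z 2) ^ lam - sqMod z 1) ^ p⁻¹ :=
    (Real.lt_rpow_inv_iff_of_pos hr hD.le hp).2 (by linarith)
  rw [rhoF_eq ht hs, one_div, Real.rpow_neg hD.le, ← div_eq_mul_inv,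
    div_lt_one (Real.rpow_pos_of_pos hD _)]
  exact h1

theorem isGood_sqMod {p lam : ℝ} (hp : 0 < p) (hlam : 0 < lam) {z : Fin 3 → ℂ}
    (hz : z ∈ domainE p lam) : IsGood p lam (sqMod z) := by
  obtain ⟨h0, h1⟩ := sigF_sqMod_mem hlam hz
  have hx := xi_sqMod_lt hp hlam hz
  have ht := ((mem_domainE_iff hlam).1 hz).1
  refine ⟨sub_pos.2 ht, sub_pos.2 h1, sub_pos.2 hx, ?_, S_pos hp hlam h0 h1.le,
    e_pos hp hlam h0 h1.le⟩
  refine serP_pos hp hlam (tau_pos hp hlam h0 h1.le) ?_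
  rw [invF]
  refine (one_le_inv₀ (sub_pos.2 hx)).2 ?_
  have : 0 ≤ sqMod z 0 * rhoF p lam (sqMod z) := mul_nonneg (Complex.normSq_nonneg _)
    (mul_nonneg (Real.rpow_nonneg (sub_pos.2 ht).le _) (Real.rpow_nonneg (sub_pos.2 h1).le _))
  linarith

theorem isRadialOn_potF {p lam : ℝ} (hp : 0 < p) (hlam : 0 < lam) (C : ℝ) :
    IsRadialOn (domainE p lam) (potF p lam C) :=
  ⟨isOpen_domainE hp hlam, fun _ hz => (isGood_sqMod hp hlam hz).contDiffAt_potF⟩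

/-! ### Curvature at the points `(0, y, z)` -/

theorem pt_eq_toC (y z : ℝ) : pt y z = toC ![0, y, z] := by
  ext i; fin_cases i <;> simp [pt, toC]

theorem sqMod_toC {n : ℕ} (x : Fin n → ℝ) (i : Fin n) : sqMod (toC x) i = x i ^ 2 := by
  simp [sqMod, toC, Complex.normSq_ofReal, sq]

/-- The values of the curvature on the frame. -/
noncomputable def curvTable (p lam d : ℝ) : Fin 3 → Fin 3 → ℝ :=
  ![![H1 p lam d / A1 p lam d ^ 2, H2 p lam d / (A1 p lam d * A2 p lam d),
      F1 p lam d / (A1 p lam d * A4 p lam d)],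
    ![H2 p lam d / (A1 p lam d * A2 p lam d), H5 p lam d / A2 p lam d ^ 2,
      F2 p lam d / (A2 p lam d * A4 p lam d)],
    ![F1 p lam d / (A1 p lam d * A4 p lam d), F2 p lam d / (A2 p lam d * A4 p lam d),
      F3 p lam d / A4 p lam d ^ 2]]

/-- The factors `k`, `q` and `w` in `jetV` are those of the squared lengths of the frame, so the
quotient depends on `δ` alone. The shape of `m` comes from `pd_zero_zero_potF` with `ρ = k / A₁`. -/
theorem jetV_eq {p lam d y q w k m : ℝ} (hD : 1 - d ≠ 0) (hS : 0 < S p lam d)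
    (he : 0 < e0 p lam + e1 p lam * d) (hL : 0 < linL p lam d) (hQ : 0 < Q p lam d) (hp : 0 < p)
    (hA1 : 0 < A1 p lam d) (hA2 : 0 < A2 p lam d) (hA4 : 0 < A4 p lam d) (hdq : d = y ^ 2 * q)
    (hk : 0 < k) (hq : 0 < q) (hw : 0 < w)
    (hA : 0 < pot1 p lam d + y ^ 2 * q * pot2 p lam d)
    (hM : 0 < lam * (y ^ 2 * q) * pot1 p lam d + (2 + lam + lam / p))
    (hm : m = (k / A1 p lam d) ^ 2 * (6 * (p + 3) * (lam * (p + 3) + p * (1 + d * (lam - 1))) *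
      S p lam d - (e0 p lam + e1 p lam * d) ^ 2) / S p lam d ^ 2) (α γ : Fin 3) :
    jetV y q w lam (2 + lam + lam / p) (pot1 p lam d) (pot2 p lam d) (pot3 p lam d)
      (pot4 p lam d) k (lam / p) (coefB p lam d) (coefB p lam d ^ 2 + coefB' p lam d) m α γ =
      curvTable p lam d α γ * ((![k, q * (pot1 p lam d + y ^ 2 * q * pot2 p lam d),
        w⁻¹ ^ 2 * (lam * (y ^ 2 * q) * pot1 p lam d + (2 + lam + lam / p))] : Fin 3 → ℝ) α *
        (![k, q * (pot1 p lam d + y ^ 2 * q * pot2 p lam d),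
        w⁻¹ ^ 2 * (lam * (y ^ 2 * q) * pot1 p lam d + (2 + lam + lam / p))] : Fin 3 → ℝ) γ) := by
  have hp1 : p + 1 ≠ 0 := by positivity
  have h1 := H1_eq hS.ne' he.ne'
  have h2 := H2_eq hD hS.ne' hp.ne' he.ne' hA1.ne' hA2.ne'
  have h5 := H5_eq hD hS.ne' hp.ne' hA2.ne'
  have f1 := F1_eq hD hS.ne' hp.ne' hp1 he.ne' hA4.ne'
  have f2 := F2_eq hD hL.ne' hp.ne' hp1 hQ.ne' hA2.ne' hA4.ne'
  have f3 := F3_eq hD hS.ne' hp.ne' hp1 hA4.ne'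
  have hA1S : A1 p lam d = (e0 p lam + e1 p lam * d) / S p lam d := A1_eq hS.ne'
  rw [← hdq] at hA hM ⊢
  have hA := hA.ne'
  have hM := hM.ne'
  have he := he.ne'
  simp only [jetV, curvTable, ← hdq, ← h1, ← h2, ← h5, ← f1, ← f2, ← f3]
  have hmm : -2 * m = -2 * (6 * (p + 3) * (lam * (p + 3) + p * (1 + d * (lam - 1))) * S p lam d -
      (e0 p lam + e1 p lam * d) ^ 2) / (e0 p lam + e1 p lam * d) ^ 2 * (k * k) := by
    rw [hm, hA1S]
    generalize e0 p lam + e1 p lam * d = E at *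
    field_simp
  clear h1 h2 h5 f1 f2 f3 hm hA1S
  generalize 2 * pot2 p lam d + d * pot3 p lam d = A' at *
  generalize 3 * pot3 p lam d + d * pot4 p lam d = A'' at *
  generalize pot1 p lam d + d * pot2 p lam d = A at *
  generalize lam * d * pot1 p lam d + (2 + lam + lam / p) = M at *
  fin_cases α <;> fin_cases γ <;> simp
  · rw [← neg_mul, hmm]; ring
  all_goals
    field_simp
    try ring

/-- The potential supplies the jet at `(0, y², z²)`, `curv_eq` gives the curvature in the orthogonal
frame, and dividing by the squared lengths gives it in the Gram–Schmidt frame. -/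
theorem frame_and_curv {p lam C : ℝ} (hp : 0 < p) (hlam : 0 < lam)
    (hB : ∀ z ∈ domainE p lam, Real.log (bergmanKernel (domainE p lam) z) =
      potF p lam C (sqMod z))
    {y z d : ℝ} (hP : pt y z ∈ domainE p lam) (hd : d = y ^ 2 / (1 - z ^ 2) ^ lam) :
    0 ≤ d ∧ d < 1 ∧
    (∀ α β, herm (bergmanMetric (domainE p lam)) (pt y z)
      (frame (bergmanMetric (domainE p lam)) (pt y z) α)
      (frame (bergmanMetric (domainE p lam)) (pt y z) β) = if α = β then 1 else 0) ∧
    ∀ α β γ η, curv (bergmanMetric (domainE p lam)) (pt y z)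
      (frame (bergmanMetric (domainE p lam)) (pt y z) α)
      (frame (bergmanMetric (domainE p lam)) (pt y z) β)
      (frame (bergmanMetric (domainE p lam)) (pt y z) γ)
      (frame (bergmanMetric (domainE p lam)) (pt y z) η) =
      if (α = β ∧ γ = η) ∨ (α = η ∧ γ = β) then (curvTable p lam d α γ : ℂ) else 0 := by
  set x : Fin 3 → ℝ := ![0, y, z] with hx
  have hPx := pt_eq_toC y z
  rw [← hx] at hPx
  rw [hPx] at hP ⊢
  have hsq := sqMod_toC x
  have hgood := isGood_sqMod hp hlam hP
  have hrad := isRadialOn_potF hp hlam C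
  have hv : sqMod (toC x) ∈ interior {v | IsGood p lam v} :=
    mem_interior_iff_mem_nhds.2 hgood.eventually
  have ht := hgood.t_lt
  rw [hsq] at ht
  have hz : 0 < 1 - z ^ 2 := by simpa [hx] using ht
  have hσ : sigF lam (sqMod (toC x)) = d := by
    rw [sigF, hsq, hsq, hd]
    simp only [hx, Matrix.cons_val_one, Matrix.cons_val_zero, Matrix.cons_val]
    rw [Real.rpow_neg hz.le, div_eq_mul_inv]
  obtain ⟨hd0, hd1⟩ := sigF_sqMod_mem hlam hP
  rw [hσ] at hd0 hd1
  refine ⟨hd0, hd1, ?_⟩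
  have hD : 1 - d ≠ 0 := (sub_pos.2 hd1).ne'
  have hS := S_pos hp hlam hd0 hd1.le
  have he := e_pos hp hlam hd0 hd1.le
  have hL := linL_pos hp hlam hd0 hd1.le
  have hQ := Q_pos hp hlam hd0 hd1.le
  have hA1 := A1_pos hp hlam hd0 hd1.le
  have hA2 := A2_pos hp hlam hd0 hd1.le
  have hA4 := A4_pos hp hlam hd0 hd1.le
  have hp1 : p + 1 ≠ 0 := by positivity
  obtain ⟨w, hw⟩ : ∃ w, w = 1 - z ^ 2 := ⟨_, rfl⟩
  have hwpos : 0 < w := by rw [hw]; exact hz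
  obtain ⟨q, hq⟩ : ∃ q, q = w ^ (-lam) := ⟨_, rfl⟩
  have hqpos : 0 < q := by rw [hq]; exact Real.rpow_pos_of_pos hwpos _
  have hdq : d = y ^ 2 * q := by
    rw [hd, ← hw, hq, Real.rpow_neg hwpos.le, div_eq_mul_inv]
  have hcA : 0 < coefA p lam d :=
    mul_pos (Real.rpow_pos_of_pos (sub_pos.2 hd1) _) (div_pos he hS)
  obtain ⟨k, hk⟩ : ∃ k, k = w ^ (-(lam / p)) * coefA p lam d := ⟨_, rfl⟩
  have hkpos : 0 < k := by rw [hk]; exact mul_pos (Real.rpow_pos_of_pos hwpos _) hcA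
  have x1 : x 1 = y := by simp [hx]
  have x2 : x 2 = z := by simp [hx]
  have J := (isPlanePotential_potF p lam C).isFrameJet (x := x) hv (by simp [hx]) hsq
    (by rw [x1, x2, ← hw, ← hq, ← hdq]; exact hcA.ne') (w := w) (q := q) (σ := d) (k := k)
    (by rw [x2, hw]) hq (by rw [x1, hdq]) hk
  rw [x1, x2] at J
  have hv0 : sqMod (toC x) 0 = 0 := by rw [hsq]; simp [hx]
  have hm := hgood.pd_zero_zero_potF (C := C)
  rw [IsGood.serP_plane hv0, IsGood.serP'_plane hv0, IsGood.serP''_plane hv0, hσ] at hm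
  -- The coefficient of `r` is `ρ serP'/serP`, and on the plane `serP'/serP = A₁`.
  have hrho : rhoF p lam (sqMod (toC x)) = k / A1 p lam d := by
    rw [hk, coefA, ← A1_eq hS.ne', rhoF, hσ, hsq, x2, ← hw]
    field_simp
  rw [hrho] at hm
  have hA : pot1 p lam d + y ^ 2 * q * pot2 p lam d = A2 p lam d / (1 - d) ^ 2 := by
    rw [← hdq]; exact potA_eq hD hS.ne' hp.ne'
  have hM : lam * (y ^ 2 * q) * pot1 p lam d + (2 + lam + lam / p) = A4 p lam d / (1 - d) := by
    rw [← hdq]; exact potM_eq hD hL.ne' hp.ne' hp1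
  have hApos : 0 < pot1 p lam d + y ^ 2 * q * pot2 p lam d := by
    rw [hA]; exact div_pos hA2 (pow_pos (sub_pos.2 hd1) 2)
  have hMpos : 0 < lam * (y ^ 2 * q) * pot1 p lam d + (2 + lam + lam / p) := by
    rw [hM]; exact div_pos hA4 (sub_pos.2 hd1)
  have hmet := J.metric_eq hwpos.ne' hw
  have hcurv := J.curv_eq hwpos.ne' hw hkpos.ne' hqpos.ne' hApos.ne' hMpos.ne'
  set N : Fin 3 → ℝ := ![k, q * (pot1 p lam d + y ^ 2 * q * pot2 p lam d),
        w⁻¹ ^ 2 * (lam * (y ^ 2 * q) * pot1 p lam d + (2 + lam + lam / p))] with hN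
  have hNpos : ∀ α, 0 < N α := by
    intro α
    fin_cases α
    · exact hkpos
    · exact mul_pos hqpos hApos
    · exact mul_pos (by positivity) hMpos
  change ∀ u v, _ = if u = v then N u else 0 at hmet
  set g := bergmanMetric (domainE p lam) with hg
  have hgG := hrad.bergmanMetric_toC hB hP
  rw [← hg] at hgG
  have hW : ∀ α β, herm g (toC x) (toC (jetW (-lam * w⁻¹ * y * z) α))
      (toC (jetW (-lam * w⁻¹ * y * z) β)) = if α = β then (N α : ℂ) else 0 := by
    intro α β
    rw [herm_toC g (toC x) hgG, hmet]
    split_ifs <;> simp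
  have hinv : ∀ a b, (g (toC x))⁻¹ a b = ((∑ e, jetW (-lam * w⁻¹ * y * z) e a *
      jetW (-lam * w⁻¹ * y * z) e b / N e : ℝ) : ℂ) := by
    refine inv_apply_of_orthogonal (fun α => (hNpos α).ne') fun α β => ?_
    rw [← hW α β]
    simp [herm, toC]
  have hR := hrad.curvComp_toC hB hP hinv
  have hfr := frame_eq_of_orthogonal g (toC x) _ hNpos hW
  have hs : ∀ α, ((Real.sqrt (N α) : ℝ) : ℂ) ≠ 0 := fun α => by
    exact_mod_cast (Real.sqrt_pos.2 (hNpos α)).ne'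
  have hss : ∀ α, ((Real.sqrt (N α) : ℝ) : ℂ) * ((Real.sqrt (N α) : ℝ) : ℂ) = N α := fun α => by
    rw [← Complex.ofReal_mul, Real.mul_self_sqrt (hNpos α).le]
  constructor
  · intro α β
    rw [hfr, hfr, herm_smul_left, herm_smul_right, hW]
    split_ifs with h
    · subst h
      rw [← hss α, star_inv₀]
      have := hs α
      simp
      field_simp
    · simp
  · intro α β γ η
    rw [hfr, hfr, hfr, hfr, curv_smul, curv_toC g (toC x) hR]
    erw [hcurv]
    split_ifs with h
    swap
    · simp
    have hval : (jetV y q w lam (2 + lam + lam / p) (pot1 p lam d) (pot2 p lam d) (pot3 p lam d)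
        (pot4 p lam d) k (lam / p) (coefA p lam d * coefB p lam d / coefA p lam d)
        (coefA p lam d * (coefB p lam d ^ 2 + coefB' p lam d) / coefA p lam d)
        (pd 0 (pd 0 (potF p lam C)) (sqMod (toC x))) α γ) = curvTable p lam d α γ * (N α * N γ) := by
      rw [mul_div_cancel_left₀ _ hcA.ne', mul_div_cancel_left₀ _ hcA.ne']
      exact jetV_eq hD hS he hL hQ hp hA1 hA2 hA4 hdq hkpos hqpos hwpos hApos hMpos hm α γ
    -- In either admissible pattern of indices the four normalizing factors pair up to `1/(N α N
    -- γ)`.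
    have hfac : ((Real.sqrt (N α) : ℝ) : ℂ)⁻¹ * star ((Real.sqrt (N β) : ℝ) : ℂ)⁻¹ *
        ((Real.sqrt (N γ) : ℝ) : ℂ)⁻¹ * star ((Real.sqrt (N η) : ℝ) : ℂ)⁻¹ =
        ((N α : ℂ) * N γ)⁻¹ := by
      simp only [star_inv₀, Complex.star_def, Complex.conj_ofReal]
      rw [← hss α, ← hss γ]
      rcases h with ⟨rfl, rfl⟩ | ⟨rfl, rfl⟩ <;> field_simp
    rw [hfac]
    have hα : (N α : ℂ) ≠ 0 := by exact_mod_cast (hNpos α).ne'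
    have hγ : (N γ : ℂ) ≠ 0 := by exact_mod_cast (hNpos γ).ne'
    have := congrArg (fun r : ℝ => (r : ℂ)) hval
    simp only [Complex.ofReal_mul] at this
    erw [this]
    field_simp

/-! ### Boundedness of the holomorphic sectional curvature -/

theorem sum_smul_eq_of_additive {m : ℕ} {M : Type*} [AddCommGroup M] [Module ℂ M] {f : M → ℂ}
    {s : ℂ → ℂ} (hadd : ∀ u v, f (u + v) = f u + f v) (hsmul : ∀ a u, f (a • u) = s a * f u)
    (c : Fin m → ℂ) (V : Fin m → M) : f (∑ α, c α • V α) = ∑ α, s (c α) * f (V α) := by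
  have h0 : f 0 = 0 := by simpa using hadd 0 0
  simp only [← hsmul]
  exact map_sum (⟨⟨f, h0⟩, hadd⟩ : M →+ ℂ) _ _

theorem curv_sum {n m : ℕ} (g : (Fin n → ℂ) → Matrix (Fin n) (Fin n) ℂ) (z : Fin n → ℂ)
    (c : Fin m → ℂ) (V : Fin m → Fin n → ℂ) :
    curv g z (∑ α, c α • V α) (∑ α, c α • V α) (∑ α, c α • V α) (∑ α, c α • V α) =
      ∑ α, c α * ∑ β, star (c β) * ∑ γ, c γ * ∑ η, star (c η) *
        curv g z (V α) (V β) (V γ) (V η) := by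
  have a1 : ∀ u u' v w t, curv g z (u + u') v w t = curv g z u v w t + curv g z u' v w t := by
    intros
    simp only [curv, Pi.add_apply, mul_add, add_mul, Finset.sum_add_distrib]
  have a2 : ∀ u v v' w t, curv g z u (v + v') w t = curv g z u v w t + curv g z u v' w t := by
    intros
    simp only [curv, Pi.add_apply, star_add, mul_add, add_mul, Finset.sum_add_distrib]
  have a3 : ∀ u v w w' t, curv g z u v (w + w') t = curv g z u v w t + curv g z u v w' t := by
    intros
    simp only [curv, Pi.add_apply, mul_add, add_mul, Finset.sum_add_distrib]
  have a4 : ∀ u v w t t', curv g z u v w (t + t') = curv g z u v w t + curv g z u v w t' := by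
    intros
    simp only [curv, Pi.add_apply, star_add, mul_add, Finset.sum_add_distrib]
  have s1 : ∀ a u v w t, curv g z (a • u) v w t = a * curv g z u v w t := fun a u v w t => by
    simpa using curv_smul g z a 1 1 1 u v w t
  have s2 : ∀ a u v w t, curv g z u (a • v) w t = star a * curv g z u v w t :=
    fun a u v w t => by simpa using curv_smul g z 1 a 1 1 u v w t
  have s3 : ∀ a u v w t, curv g z u v (a • w) t = a * curv g z u v w t := fun a u v w t => by
    simpa using curv_smul g z 1 1 a 1 u v w t
  have s4 : ∀ a u v w t, curv g z u v w (a • t) = star a * curv g z u v w t :=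
    fun a u v w t => by simpa using curv_smul g z 1 1 1 a u v w t
  rw [sum_smul_eq_of_additive (f := fun u => curv g z u _ _ _) (s := fun a => a)
    (fun u v => a1 u v _ _ _) (fun a u => s1 a u _ _ _)]
  refine Finset.sum_congr rfl fun α _ => ?_
  congr 1
  rw [sum_smul_eq_of_additive (f := fun u => curv g z _ u _ _) (s := star)
    (fun u v => a2 _ u v _ _) (fun a u => s2 a _ u _ _)]
  refine Finset.sum_congr rfl fun β _ => ?_
  congr 1
  rw [sum_smul_eq_of_additive (f := fun u => curv g z _ _ u _) (s := fun a => a)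
    (fun u v => a3 _ _ u v _) (fun a u => s3 a _ _ u _)]
  refine Finset.sum_congr rfl fun γ _ => ?_
  congr 1
  exact sum_smul_eq_of_additive (f := fun u => curv g z _ _ _ u) (s := star)
    (fun u v => a4 _ _ _ u v) (fun a u => s4 a _ _ _ u) c V

/-- A unit vector is a combination of an orthonormal frame with coefficients of modulus `≤ 1`. -/
theorem exists_coeff_of_orthonormal {n : ℕ} (g : (Fin n → ℂ) → Matrix (Fin n) (Fin n) ℂ)
    (z : Fin n → ℂ) {V : Fin n → Fin n → ℂ}
    (hV : ∀ α β, herm g z (V α) (V β) = if α = β then 1 else 0) {v : Fin n → ℂ}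
    (hv : herm g z v v = 1) : ∃ c : Fin n → ℂ, v = ∑ α, c α • V α ∧ ∀ α, ‖c α‖ ≤ 1 := by
  have hli : LinearIndependent ℂ V := by
    rw [Fintype.linearIndependent_iff]
    intro c hc β
    have h := herm_sum_sum g z c (Pi.single β 1) V
    have h2 : ∑ α, (Pi.single β 1 : Fin n → ℂ) α • V α = V β := by simp [Pi.single_apply]
    rw [hc, h2] at h
    simp only [hV] at h
    simpa [herm, Pi.single_apply, apply_ite] using h.symm
  rcases isEmpty_or_nonempty (Fin n) with hn | hn
  · exact ⟨fun _ => 0, funext fun i => hn.elim i, fun _ => by simp⟩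
  let b := basisOfLinearIndependentOfCardEqFinrank hli (by simp)
  have hb : ∀ α, b α = V α := fun α => by simp [b]
  have hsum : v = ∑ α, b.repr v α • V α := by
    conv_lhs => rw [← b.sum_repr v]
    simp only [hb]
  refine ⟨fun α => b.repr v α, hsum, fun α => ?_⟩
  have h := herm_sum_sum g z (fun α => b.repr v α) (fun α => b.repr v α) V
  rw [← hsum, hv] at h
  simp only [hV, mul_ite, mul_one, mul_zero, Finset.sum_ite_eq, Finset.mem_univ, if_true] at h
  have h2 : (1 : ℝ) = ∑ α, ‖b.repr v α‖ ^ 2 := by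
    have : ((1 : ℝ) : ℂ) = ((∑ α, ‖b.repr v α‖ ^ 2 : ℝ) : ℂ) := by
      push_cast
      rw [h]
      exact Finset.sum_congr rfl fun α _ => Complex.mul_conj' _
    exact_mod_cast this
  have h3 : ‖b.repr v α‖ ^ 2 ≤ 1 := by
    rw [h2]
    exact Finset.single_le_sum (f := fun α => ‖b.repr v α‖ ^ 2) (fun _ _ => sq_nonneg _)
      (Finset.mem_univ α)
  exact (sq_le_one_iff₀ (norm_nonneg _)).1 h3

theorem norm_sum_mul_le {m : ℕ} {c f : Fin m → ℂ} {K : ℝ} (hc : ∀ α, ‖c α‖ ≤ 1)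
    (hf : ∀ α, ‖f α‖ ≤ K) : ‖∑ α, c α * f α‖ ≤ m * K := by
  refine (norm_sum_le _ _).trans ?_
  refine (Finset.sum_le_card_nsmul _ _ K fun α _ => ?_).trans_eq (by simp)
  rw [norm_mul]
  calc ‖c α‖ * ‖f α‖ ≤ 1 * K := by gcongr; exacts [hc α, hf α]
    _ = K := one_mul K

theorem norm_curv_le {n : ℕ} (g : (Fin n → ℂ) → Matrix (Fin n) (Fin n) ℂ)
    (z : Fin n → ℂ) {V : Fin n → Fin n → ℂ} {K : ℝ}
    (hV : ∀ α β, herm g z (V α) (V β) = if α = β then 1 else 0)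
    (hK : ∀ α β γ η, ‖curv g z (V α) (V β) (V γ) (V η)‖ ≤ K) {v : Fin n → ℂ}
    (hv : herm g z v v = 1) : ‖curv g z v v v v‖ ≤ n * (n * (n * (n * K))) := by
  obtain ⟨c, rfl, hc⟩ := exists_coeff_of_orthonormal g z hV hv
  rw [curv_sum]
  have hc' : ∀ α, ‖star (c α)‖ ≤ 1 := fun α => by rw [norm_star]; exact hc α
  exact norm_sum_mul_le hc fun α => norm_sum_mul_le hc' fun β => norm_sum_mul_le hc fun γ =>
    norm_sum_mul_le hc' fun η => hK α β γ η

/-- The endpoint `d = 1`, which is not attained in the domain, is included: every denominator is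
still nonzero there. This keeps the curvature bounded up to the boundary. -/
theorem continuousOn_curvTable {p lam : ℝ} (hp : 0 < p) (hlam : 0 < lam) (α γ : Fin 3) :
    ContinuousOn (fun d => curvTable p lam d α γ) (Set.Icc 0 1) := by
  have hS : ∀ d ∈ Set.Icc (0 : ℝ) 1, S p lam d ≠ 0 := fun d hd => (S_pos hp hlam hd.1 hd.2).ne'
  have hE : ∀ d ∈ Set.Icc (0 : ℝ) 1, e0 p lam + e1 p lam * d ≠ 0 :=
    fun d hd => (e_pos hp hlam hd.1 hd.2).ne'
  have hQ : ∀ d ∈ Set.Icc (0 : ℝ) 1, Q p lam d ≠ 0 := fun d hd => (Q_pos hp hlam hd.1 hd.2).ne'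
  have hL : ∀ d ∈ Set.Icc (0 : ℝ) 1, p * linL p lam d ≠ 0 :=
    fun d hd => mul_ne_zero hp.ne' (linL_pos hp hlam hd.1 hd.2).ne'
  have hA1 : ∀ d ∈ Set.Icc (0 : ℝ) 1, A1 p lam d ≠ 0 := fun d hd => (A1_pos hp hlam hd.1 hd.2).ne'
  have hA2 : ∀ d ∈ Set.Icc (0 : ℝ) 1, A2 p lam d ≠ 0 := fun d hd => (A2_pos hp hlam hd.1 hd.2).ne'
  have hA4 : ∀ d ∈ Set.Icc (0 : ℝ) 1, A4 p lam d ≠ 0 := fun d hd => (A4_pos hp hlam hd.1 hd.2).ne'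
  have cS : ContinuousOn (S p lam) (Set.Icc 0 1) := by unfold S; fun_prop
  have cQ : ContinuousOn (Q p lam) (Set.Icc 0 1) := by unfold Q; fun_prop
  have cL : ContinuousOn (linL p lam) (Set.Icc 0 1) := by unfold linL; fun_prop
  have cA1 : ContinuousOn (A1 p lam) (Set.Icc 0 1) := by
    unfold A1
    exact (ContinuousOn.div (by fun_prop) cS hS).add continuousOn_const
  have cA2 : ContinuousOn (A2 p lam) (Set.Icc 0 1) := by
    unfold A2
    exact continuousOn_const.add (ContinuousOn.div (by fun_prop) (cS.pow 2)
      fun d hd => pow_ne_zero 2 (hS d hd))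
  have cA4 : ContinuousOn (A4 p lam) (Set.Icc 0 1) := cQ.div (continuousOn_const.mul cL) hL
  have cdiv : ∀ (a : ℝ), ContinuousOn (fun d => a / S p lam d ^ 2) (Set.Icc 0 1) := fun a =>
    continuousOn_const.div (cS.pow 2) fun d hd => pow_ne_zero 2 (hS d hd)
  have cH1 : ContinuousOn (H1 p lam) (Set.Icc 0 1) := by
    unfold H1
    exact ((continuousOn_const.add (continuousOn_const.mul (ContinuousOn.div (by fun_prop) cS
      hS))).sub (continuousOn_const.mul (ContinuousOn.div (by fun_prop) (cS.pow 2)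
      fun d hd => pow_ne_zero 2 (hS d hd)))).neg
  have cH2 : ContinuousOn (H2 p lam) (Set.Icc 0 1) := by
    unfold H2
    have h1 : ContinuousOn (fun d => e0 p lam * e1 p lam / (e0 p lam + e1 p lam * d) ^ 2)
        (Set.Icc 0 1) := ContinuousOn.div (by fun_prop) (by fun_prop)
          fun d hd => pow_ne_zero 2 (hE d hd)
    have h2 := cdiv (u3 p lam * u4 p lam)
    fun_prop
  have cH5 : ContinuousOn (H5 p lam) (Set.Icc 0 1) := by
    unfold H5
    have h1 : ContinuousOn (fun d => 2 * u3 p lam * u4 p lam * (u3 p lam + u4 p lam) *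
        (u3 p lam * (2 * d - 1) + u4 p lam * d * (2 - d)) / S p lam d ^ 4) (Set.Icc 0 1) :=
      ContinuousOn.div (by fun_prop) (cS.pow 4) fun d hd => pow_ne_zero 4 (hS d hd)
    have h2 : ContinuousOn (fun d => 4 * d * (1 - d) ^ 2 * u3 p lam ^ 2 * u4 p lam ^ 2 *
        (u3 p lam + u4 p lam) ^ 2 / (S p lam d ^ 6 * A2 p lam d)) (Set.Icc 0 1) :=
      ContinuousOn.div (by fun_prop) ((cS.pow 6).mul cA2)
        fun d hd => mul_ne_zero (pow_ne_zero 6 (hS d hd)) (hA2 d hd)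
    fun_prop
  have cF1 : ContinuousOn (F1 p lam) (Set.Icc 0 1) := by
    unfold F1
    have h1 : ContinuousOn (fun d => d * (1 - d) *
        (u3 p lam * u6 p lam - u4 p lam * u5 p lam) / S p lam d ^ 2) (Set.Icc 0 1) :=
      ContinuousOn.div (by fun_prop) (cS.pow 2) fun d hd => pow_ne_zero 2 (hS d hd)
    fun_prop
  have cF2 : ContinuousOn (F2 p lam) (Set.Icc 0 1) := by
    unfold F2
    have h1 : ContinuousOn (fun d => (q0 p lam * q1 p lam + 4 * q0 p lam * q2 p lam * d +
        q1 p lam * q2 p lam * d ^ 2) / Q p lam d ^ 2) (Set.Icc 0 1) :=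
      ContinuousOn.div (by fun_prop) (cQ.pow 2) fun d hd => pow_ne_zero 2 (hQ d hd)
    have h2 := cdiv (u3 p lam * u4 p lam)
    fun_prop
  have cF3 : ContinuousOn (F3 p lam) (Set.Icc 0 1) := by
    unfold F3
    fun_prop
  have n1 := fun d hd => pow_ne_zero 2 (hA1 d hd)
  have n2 := fun d hd => pow_ne_zero 2 (hA2 d hd)
  have n4 := fun d hd => pow_ne_zero 2 (hA4 d hd)
  have n12 := fun d hd => mul_ne_zero (hA1 d hd) (hA2 d hd)
  have n14 := fun d hd => mul_ne_zero (hA1 d hd) (hA4 d hd)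
  have n24 := fun d hd => mul_ne_zero (hA2 d hd) (hA4 d hd)
  fin_cases α <;> fin_cases γ
  · exact cH1.div (cA1.pow 2) n1
  · exact cH2.div (cA1.mul cA2) n12
  · exact cF1.div (cA1.mul cA4) n14
  · exact cH2.div (cA1.mul cA2) n12
  · exact cH5.div (cA2.pow 2) n2
  · exact cF2.div (cA2.mul cA4) n24
  · exact cF1.div (cA1.mul cA4) n14
  · exact cF2.div (cA2.mul cA4) n24
  · exact cF3.div (cA4.pow 2) n4

theorem exists_bound_curvTable {p lam : ℝ} (hp : 0 < p) (hlam : 0 < lam) :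
    ∃ K, 0 ≤ K ∧ ∀ d, 0 ≤ d → d ≤ 1 → ∀ α γ, |curvTable p lam d α γ| ≤ K := by
  choose K hK using fun α γ : Fin 3 =>
    isCompact_Icc.exists_bound_of_continuousOn (continuousOn_curvTable hp hlam α γ)
  have hK0 : ∀ α γ, 0 ≤ K α γ := fun α γ =>
    (norm_nonneg _).trans (hK α γ 0 ⟨le_rfl, zero_le_one⟩)
  refine ⟨∑ α, ∑ γ, K α γ, Finset.sum_nonneg fun α _ => Finset.sum_nonneg fun γ _ => hK0 α γ,
    fun d h0 h1 α γ => (hK α γ d ⟨h0, h1⟩).trans ?_⟩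
  exact (Finset.single_le_sum (f := K α) (fun γ _ => hK0 α γ) (Finset.mem_univ γ)).trans
    (Finset.single_le_sum (f := fun α => ∑ γ, K α γ)
      (fun α _ => Finset.sum_nonneg fun γ _ => hK0 α γ) (Finset.mem_univ α))

/-! ### The norms of the monomials -/

theorem setLIntegral_Ioo_scale {T : ℝ} (hT : 0 < T) (g : ℝ → ENNReal) :
    ∫⁻ s in Set.Ioo 0 T, g s = ENNReal.ofReal T * ∫⁻ x in Set.Ioo (0 : ℝ) 1, g (T * x) := by
  have himg : (fun x => T * x) '' Set.Ioo (0 : ℝ) 1 = Set.Ioo 0 T := by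
    rw [Set.image_mul_left_Ioo hT]; simp
  rw [← himg, lintegral_image_eq_lintegral_abs_deriv_mul (f' := fun _ => T) measurableSet_Ioo
    (fun x _ => by simpa using ((hasDerivAt_id x).const_mul T).hasDerivWithinAt)
    (fun x _ y _ h => mul_left_cancel₀ hT.ne' h), lintegral_const_mul' _ _ (by simp),
    abs_of_pos hT]

/-- Read off from the total mass one of the Beta distribution. -/
theorem lintegral_rpow_mul_one_sub_rpow {α β : ℝ} (hα : 0 < α) (hβ : 0 < β) :
    ∫⁻ x in Set.Ioo (0 : ℝ) 1, ENNReal.ofReal (x ^ (α - 1) * (1 - x) ^ (β - 1)) =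
      ENNReal.ofReal (ProbabilityTheory.beta α β) := by
  have hb := ProbabilityTheory.beta_pos hα hβ
  have h := ProbabilityTheory.lintegral_betaPDF_eq_one hα hβ
  rw [ProbabilityTheory.lintegral_betaPDF] at h
  have h2 : ∀ x : ℝ, ENNReal.ofReal (1 / ProbabilityTheory.beta α β * x ^ (α - 1) *
      (1 - x) ^ (β - 1)) = ENNReal.ofReal (1 / ProbabilityTheory.beta α β) *
        ENNReal.ofReal (x ^ (α - 1) * (1 - x) ^ (β - 1)) := fun x => by
    rw [mul_assoc, ENNReal.ofReal_mul (by positivity)]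
  simp only [h2] at h
  rw [lintegral_const_mul' _ _ (by simp)] at h
  rw [one_div, ENNReal.ofReal_inv_of_pos hb] at h
  have h0 : ENNReal.ofReal (ProbabilityTheory.beta α β) ≠ 0 := by simpa using hb
  have h3 := congrArg (ENNReal.ofReal (ProbabilityTheory.beta α β) * ·) h
  simpa [← mul_assoc, ENNReal.mul_inv_cancel h0] using h3

theorem lintegral_pow_mul_sub_rpow {T β : ℝ} (hT : 0 < T) (hβ : 0 ≤ β) (b : ℕ) :
    ∫⁻ s in Set.Ioo 0 T, ENNReal.ofReal (s ^ b * (T - s) ^ β) =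
      ENNReal.ofReal (T ^ (b + β + 1) * ProbabilityTheory.beta (b + 1) (β + 1)) := by
  have h := lintegral_rpow_mul_one_sub_rpow (α := b + 1) (β := β + 1) (by positivity)
    (by positivity)
  rw [setLIntegral_Ioo_scale hT, ENNReal.ofReal_mul (by positivity), ← h, add_assoc,
    Real.rpow_add hT, Real.rpow_natCast, Real.rpow_add_one hT.ne',
    ← lintegral_const_mul' _ _ (by simp), ← lintegral_const_mul' _ _ (by simp)]
  refine setLIntegral_congr_fun measurableSet_Ioo fun x hx => ?_
  have h1 : T - T * x = T * (1 - x) := by ring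
  have hx1 : 0 ≤ 1 - x := by linarith [hx.2]
  rw [h1, Real.mul_rpow hT.le hx1, add_sub_cancel_right, add_sub_cancel_right, Real.rpow_natCast,
    ← ENNReal.ofReal_mul hT.le, ← ENNReal.ofReal_mul (by positivity)]
  congr 1
  ring

theorem lintegral_pow_Ioo {T : ℝ} (hT : 0 < T) (b : ℕ) :
    ∫⁻ s in Set.Ioo 0 T, ENNReal.ofReal (s ^ b) = ENNReal.ofReal (T ^ (b + 1) / (b + 1)) := by
  have h := lintegral_pow_mul_sub_rpow hT le_rfl b
  simp only [Real.rpow_zero, mul_one] at h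
  rw [h, add_zero, zero_add, ProbabilityTheory.beta, Real.Gamma_one,
    Real.Gamma_add_one (by positivity : (b : ℝ) + 1 ≠ 0)]
  have hg : Real.Gamma ((b : ℝ) + 1) ≠ 0 := (Real.Gamma_pos_of_pos (by positivity)).ne'
  congr 1
  have : T ^ ((b : ℝ) + 1) = T ^ (b + 1) := by exact_mod_cast Real.rpow_natCast T (b + 1)
  rw [this]
  field_simp

theorem lintegral_comp_sq (f : ℝ → ENNReal) :
    ∫⁻ r in Set.Ioi (0 : ℝ), ENNReal.ofReal (2 * r) * f (r ^ 2) = ∫⁻ s in Set.Ioi (0 : ℝ), f s := by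
  have himg : (fun x : ℝ => x ^ 2) '' Set.Ioi (0 : ℝ) = Set.Ioi 0 := by
    ext s
    constructor
    · rintro ⟨x, hx, rfl⟩; exact pow_pos (Set.mem_Ioi.1 hx) 2
    · intro hs; exact ⟨Real.sqrt s, Real.sqrt_pos.2 hs, Real.sq_sqrt (le_of_lt hs)⟩
  conv_rhs => rw [← himg]
  rw [lintegral_image_eq_lintegral_abs_deriv_mul (f' := fun x => 2 * x) measurableSet_Ioi
    (fun x _ => by simpa using (hasDerivAt_pow 2 x).hasDerivWithinAt)
    (fun x hx y hy h => (pow_left_inj₀ (le_of_lt hx) (le_of_lt hy) two_ne_zero).1 h)]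
  refine setLIntegral_congr_fun measurableSet_Ioi fun x hx => ?_
  have : 0 < x := hx
  rw [abs_of_pos (by positivity)]

/-- In polar coordinates the angle contributes `2π`, and the substitution `s = r²` absorbs `r dr`.
-/
theorem lintegral_comp_normSq {f : ℝ → ENNReal} (hf : Measurable f) :
    ∫⁻ w : ℂ, f (Complex.normSq w) = ENNReal.ofReal Real.pi * ∫⁻ s in Set.Ioi (0 : ℝ), f s := by
  rw [← Complex.lintegral_comp_polarCoord_symm, polarCoord_target, Measure.volume_eq_prod,
    ← Measure.prod_restrict, lintegral_prod]
  · have h1 : ∀ r θ : ℝ, Complex.normSq (Complex.polarCoord.symm (r, θ)) = r ^ 2 := by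
      intro r θ
      rw [Complex.normSq_eq_norm_sq, Complex.norm_polarCoord_symm, sq_abs]
    simp only [h1, lintegral_const, Measure.restrict_apply MeasurableSet.univ, Set.univ_inter,
      Real.volume_Ioo, sub_neg_eq_add, smul_eq_mul]
    rw [← lintegral_comp_sq f, ← lintegral_const_mul' _ _ (by simp)]
    refine setLIntegral_congr_fun measurableSet_Ioi fun x hx => ?_
    rw [← two_mul, ENNReal.ofReal_mul zero_le_two, ENNReal.ofReal_mul zero_le_two]
    ring
  · refine Measurable.aemeasurable ?_
    have : Measurable fun p : ℝ × ℝ => Complex.normSq (Complex.polarCoord.symm p) := by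
      have : (fun p : ℝ × ℝ => Complex.normSq (Complex.polarCoord.symm p)) = fun p => p.1 ^ 2 := by
        ext p
        rw [Complex.normSq_eq_norm_sq, Complex.norm_polarCoord_symm, sq_abs]
      rw [this]; fun_prop
    have h2 := hf.comp this
    simp only [smul_eq_mul]
    exact (ENNReal.measurable_ofReal.comp measurable_fst).mul h2

theorem lintegral_fin_three {f : (Fin 3 → ℂ) → ENNReal} (hf : Measurable f) :
    ∫⁻ v, f v = ∫⁻ z : ℂ, ∫⁻ y : ℂ, ∫⁻ x : ℂ, f ![x, y, z] := by
  have h1 := (volume_preserving_piFinSuccAbove (fun _ : Fin 3 => ℂ) 2).symm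
  rw [← h1.lintegral_comp hf, Measure.volume_eq_prod, lintegral_prod]
  swap
  · exact (hf.comp (MeasurableEquiv.measurable _)).aemeasurable
  refine lintegral_congr fun z => ?_
  have h2 := (volume_preserving_piFinSuccAbove (fun _ : Fin 2 => ℂ) 1).symm
  have hm : Measurable fun u : Fin 2 → ℂ =>
      f ((MeasurableEquiv.piFinSuccAbove (fun _ : Fin 3 => ℂ) 2).symm (z, u)) :=
    (hf.comp (MeasurableEquiv.measurable _)).comp (by fun_prop)
  rw [← h2.lintegral_comp hm, Measure.volume_eq_prod, lintegral_prod]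
  swap
  · exact (hm.comp (MeasurableEquiv.measurable _)).aemeasurable
  refine lintegral_congr fun y => ?_
  have h3 := (volume_preserving_funUnique (Fin 1) ℂ).symm
  have hm3 : Measurable fun u : Fin 1 → ℂ =>
      f ((MeasurableEquiv.piFinSuccAbove (fun _ : Fin 3 => ℂ) 2).symm (z,
        (MeasurableEquiv.piFinSuccAbove (fun _ : Fin 2 => ℂ) 1).symm (y, u))) :=
    (hm.comp (MeasurableEquiv.measurable _)).comp (by fun_prop)
  refine (h3.lintegral_comp hm3).symm.trans ?_
  refine lintegral_congr fun x => ?_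
  congr 1
  ext i
  fin_cases i <;> rfl

/-- The monomial `x^a y^b z^c`. -/
def mono (j : ℕ × ℕ × ℕ) (v : Fin 3 → ℂ) : ℂ := v 0 ^ j.1 * v 1 ^ j.2.1 * v 2 ^ j.2.2

/-- The squared norm of the monomial in the Bergman space of `E_{p,λ}`. -/
noncomputable def monoNorm (p lam : ℝ) (j : ℕ × ℕ × ℕ) : ℝ :=
  Real.pi ^ 3 / (j.1 + 1) *
    ProbabilityTheory.beta (j.2.1 + 1) ((j.1 + 1) / p + 1) *
    ProbabilityTheory.beta (j.2.2 + 1) (lam * ((j.1 + 1) / p + j.2.1 + 1) + 1)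

theorem monoNorm_pos {p lam : ℝ} (hp : 0 < p) (hlam : 0 < lam) (j : ℕ × ℕ × ℕ) :
    0 < monoNorm p lam j := by
  refine mul_pos (mul_pos (by positivity) ?_) ?_ <;>
    exact ProbabilityTheory.beta_pos (by positivity) (by positivity)

theorem normSq_mono (j : ℕ × ℕ × ℕ) (v : Fin 3 → ℂ) : Complex.normSq (mono j v) =
    Complex.normSq (v 0) ^ j.1 * Complex.normSq (v 1) ^ j.2.1 * Complex.normSq (v 2) ^ j.2.2 := by
  simp [mono]

theorem measurableSet_region (p lam : ℝ) : MeasurableSet {u : ℝ × ℝ × ℝ |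
    u.2.2 < 1 ∧ u.1 ^ p + u.2.1 < (1 - u.2.2) ^ lam} := by
  have h1 : Measurable fun u : ℝ × ℝ × ℝ => u.2.2 := measurable_snd.snd
  have h2 : Measurable fun u : ℝ × ℝ × ℝ => u.1 ^ p + u.2.1 :=
    (measurable_fst.pow_const p).add measurable_snd.fst
  exact (measurableSet_lt h1 measurable_const).inter
    (measurableSet_lt h2 ((measurable_const.sub h1).pow_const lam))

/-- In squared moduli one integrates over `0 < r < ((1-t)^λ - s)^(1/p)`, then `0 < s < (1-t)^λ`,
then `0 < t < 1`. The first is an integral of a power, the other two are Beta integrals; each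
earlier step supplies the exponent of the next. -/
theorem lintegral_domainE {p lam : ℝ} (hp : 0 < p) (hlam : 0 < lam) (j : ℕ × ℕ × ℕ) :
    ∫⁻ v in domainE p lam, ENNReal.ofReal (Complex.normSq (mono j v)) =
      ENNReal.ofReal (monoNorm p lam j) := by
  obtain ⟨a, b, c⟩ := j
  set D : Set (ℝ × ℝ × ℝ) := {u | u.2.2 < 1 ∧ u.1 ^ p + u.2.1 < (1 - u.2.2) ^ lam} with hDdef
  have hD : MeasurableSet D := measurableSet_region p lam
  set F : ℝ × ℝ × ℝ → ENNReal :=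
    D.indicator fun u => ENNReal.ofReal (u.1 ^ a * u.2.1 ^ b * u.2.2 ^ c) with hF
  have hFm : Measurable F := Measurable.indicator (by fun_prop) hD
  have h1 : ∫⁻ v in domainE p lam, ENNReal.ofReal (Complex.normSq (mono (a, b, c) v)) =
      ∫⁻ v : Fin 3 → ℂ, F (Complex.normSq (v 0), Complex.normSq (v 1), Complex.normSq (v 2)) := by
    rw [← lintegral_indicator (isOpen_domainE hp hlam).measurableSet]
    refine lintegral_congr fun v => ?_
    have hiff : v ∈ domainE p lam ↔
        (Complex.normSq (v 0), Complex.normSq (v 1), Complex.normSq (v 2)) ∈ D :=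
      mem_domainE_iff hlam
    by_cases hv : v ∈ domainE p lam
    · rw [Set.indicator_of_mem hv, hF, Set.indicator_of_mem (hiff.1 hv), normSq_mono]
    · rw [Set.indicator_of_notMem hv, hF, Set.indicator_of_notMem fun h => hv (hiff.2 h)]
  have hmeas : Measurable fun v : Fin 3 → ℂ =>
      F (Complex.normSq (v 0), Complex.normSq (v 1), Complex.normSq (v 2)) := by
    have := Complex.continuous_normSq.measurable
    refine hFm.comp (Measurable.prodMk (this.comp (measurable_pi_apply 0)) (Measurable.prodMk
      (this.comp (measurable_pi_apply 1)) (this.comp (measurable_pi_apply 2))))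
  have hr : ∀ s t : ℝ, 0 < s → 0 < t → ∫⁻ r in Set.Ioi (0 : ℝ), F (r, s, t) =
      if t < 1 ∧ s < (1 - t) ^ lam then
        ENNReal.ofReal (t ^ c / (a + 1) * (s ^ b * ((1 - t) ^ lam - s) ^ ((a + 1) / p))) else 0 := by
    intro s t hs ht
    split_ifs with h
    · have hT : 0 < (1 - t) ^ lam - s := sub_pos.2 h.2
      have e1 : ∫⁻ r in Set.Ioi (0 : ℝ), F (r, s, t) =
          ∫⁻ r in Set.Ioo (0 : ℝ) (((1 - t) ^ lam - s) ^ p⁻¹),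
            ENNReal.ofReal (s ^ b * t ^ c) * ENNReal.ofReal (r ^ a) := by
        rw [← lintegral_indicator measurableSet_Ioi, ← lintegral_indicator measurableSet_Ioo]
        refine lintegral_congr fun r => ?_
        by_cases hr0 : 0 < r
        · rw [Set.indicator_of_mem (Set.mem_Ioi.2 hr0)]
          have hiff : (r, s, t) ∈ D ↔ r ∈ Set.Ioo (0 : ℝ) (((1 - t) ^ lam - s) ^ p⁻¹) := by
            rw [Set.mem_Ioo, Real.lt_rpow_inv_iff_of_pos hr0.le hT.le hp, lt_sub_iff_add_lt]
            exact ⟨fun hh => ⟨hr0, hh.2⟩, fun hh => ⟨h.1, hh.2⟩⟩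
          by_cases hm : (r, s, t) ∈ D
          · rw [Set.indicator_of_mem (hiff.1 hm), hF, Set.indicator_of_mem hm,
              ← ENNReal.ofReal_mul (by positivity)]
            congr 1
            ring
          · rw [Set.indicator_of_notMem fun hh => hm (hiff.2 hh), hF, Set.indicator_of_notMem hm]
        · rw [Set.indicator_of_notMem (by simpa using hr0),
            Set.indicator_of_notMem fun hh => hr0 hh.1]
      rw [e1, lintegral_const_mul' _ _ (by simp), lintegral_pow_Ioo (Real.rpow_pos_of_pos hT _),
        ← ENNReal.ofReal_mul (by positivity), ← Real.rpow_mul_natCast hT.le]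
      congr 1
      push_cast
      rw [show p⁻¹ * ((a : ℝ) + 1) = (a + 1) / p by ring]
      ring
    · have : ∀ r ∈ Set.Ioi (0 : ℝ), F (r, s, t) = 0 := by
        intro r hr0
        rw [hF, Set.indicator_of_notMem]
        intro hh
        have := Real.rpow_nonneg (le_of_lt hr0) p
        exact h ⟨hh.1, by linarith [hh.2]⟩
      rw [setLIntegral_congr_fun measurableSet_Ioi this]
      simp
  have hs : ∀ t : ℝ, 0 < t → ∫⁻ s in Set.Ioi (0 : ℝ), ∫⁻ r in Set.Ioi (0 : ℝ), F (r, s, t) =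
      if t < 1 then ENNReal.ofReal (1 / (a + 1) * ProbabilityTheory.beta (b + 1) ((a + 1) / p + 1)) *
        ENNReal.ofReal (t ^ c * (1 - t) ^ (lam * ((a + 1) / p + b + 1))) else 0 := by
    intro t ht
    rw [setLIntegral_congr_fun measurableSet_Ioi fun s hs => hr s t hs ht]
    split_ifs with h
    · have hT : 0 < (1 - t) ^ lam := Real.rpow_pos_of_pos (sub_pos.2 h) _
      have e1 : ∫⁻ s in Set.Ioi (0 : ℝ), (if t < 1 ∧ s < (1 - t) ^ lam then
          ENNReal.ofReal (t ^ c / (a + 1) * (s ^ b * ((1 - t) ^ lam - s) ^ (((a : ℝ) + 1) / p)))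
          else 0) =
          ∫⁻ s in Set.Ioo (0 : ℝ) ((1 - t) ^ lam), ENNReal.ofReal (t ^ c / (a + 1)) *
            ENNReal.ofReal (s ^ b * ((1 - t) ^ lam - s) ^ (((a : ℝ) + 1) / p)) := by
        rw [← lintegral_indicator measurableSet_Ioi, ← lintegral_indicator measurableSet_Ioo]
        refine lintegral_congr fun s => ?_
        by_cases hs0 : 0 < s
        · rw [Set.indicator_of_mem (Set.mem_Ioi.2 hs0)]
          by_cases hs1 : s < (1 - t) ^ lam
          · rw [if_pos ⟨h, hs1⟩, Set.indicator_of_mem (Set.mem_Ioo.2 ⟨hs0, hs1⟩),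
              ENNReal.ofReal_mul (by positivity)]
          · rw [if_neg fun hh => hs1 hh.2, Set.indicator_of_notMem fun hh => hs1 hh.2]
        · rw [Set.indicator_of_notMem (by simpa using hs0),
            Set.indicator_of_notMem fun hh => hs0 hh.1]
      rw [e1, lintegral_const_mul' _ _ (by simp), lintegral_pow_mul_sub_rpow hT (by positivity),
        ← ENNReal.ofReal_mul (by positivity), ← ENNReal.ofReal_mul
          (mul_nonneg (by positivity) (ProbabilityTheory.beta_pos (by positivity)
            (by positivity)).le), ← Real.rpow_mul (sub_pos.2 h).le]
      congr 1
      rw [show lam * ((b : ℝ) + (a + 1) / p + 1) = lam * ((a + 1) / p + b + 1) by ring]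
      ring
    · have : ∀ s ∈ Set.Ioi (0 : ℝ), (if t < 1 ∧ s < (1 - t) ^ lam then
          ENNReal.ofReal (t ^ c / (a + 1) * (s ^ b * ((1 - t) ^ lam - s) ^ (((a : ℝ) + 1) / p)))
          else 0) = 0 := fun s _ => if_neg fun hh => h hh.1
      rw [setLIntegral_congr_fun measurableSet_Ioi this]
      simp
  rw [h1, lintegral_fin_three hmeas]
  simp only [Matrix.cons_val_zero, Matrix.cons_val_one, Matrix.cons_val]
  have i1 : ∀ z y : ℂ, ∫⁻ x : ℂ, F (Complex.normSq x, Complex.normSq y, Complex.normSq z) =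
      ENNReal.ofReal Real.pi *
        ∫⁻ r in Set.Ioi (0 : ℝ), F (r, Complex.normSq y, Complex.normSq z) := fun z y =>
    lintegral_comp_normSq (f := fun r => F (r, Complex.normSq y, Complex.normSq z))
      (hFm.comp (measurable_id.prodMk measurable_const))
  have m1 : Measurable fun u : ℝ × ℝ => ∫⁻ r in Set.Ioi (0 : ℝ), F (r, u.1, u.2) :=
    Measurable.lintegral_prod_right' (f := fun u : (ℝ × ℝ) × ℝ => F (u.2, u.1.1, u.1.2))
      (hFm.comp (measurable_snd.prodMk (measurable_fst.fst.prodMk measurable_fst.snd)))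
  have i2 : ∀ z : ℂ, ∫⁻ y : ℂ, ∫⁻ r in Set.Ioi (0 : ℝ),
      F (r, Complex.normSq y, Complex.normSq z) = ENNReal.ofReal Real.pi *
        ∫⁻ s in Set.Ioi (0 : ℝ), ∫⁻ r in Set.Ioi (0 : ℝ), F (r, s, Complex.normSq z) := fun z =>
    lintegral_comp_normSq (f := fun s => ∫⁻ r in Set.Ioi (0 : ℝ), F (r, s, Complex.normSq z))
      (m1.comp (measurable_id.prodMk measurable_const))
  have m2 : Measurable fun t : ℝ => ∫⁻ s in Set.Ioi (0 : ℝ), ∫⁻ r in Set.Ioi (0 : ℝ),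
      F (r, s, t) :=
    Measurable.lintegral_prod_right' (f := fun u : ℝ × ℝ => ∫⁻ r in Set.Ioi (0 : ℝ), F (r, u.2, u.1))
      (m1.comp (measurable_snd.prodMk measurable_fst))
  have i3 := lintegral_comp_normSq m2
  simp only [i1, lintegral_const_mul' _ _ ENNReal.ofReal_ne_top, i2, i3]
  rw [setLIntegral_congr_fun measurableSet_Ioi fun t ht => hs t ht]
  have e3 : ∫⁻ t in Set.Ioi (0 : ℝ), (if t < 1 then
        ENNReal.ofReal (1 / (a + 1) * ProbabilityTheory.beta (b + 1) ((a + 1) / p + 1)) *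
        ENNReal.ofReal (t ^ c * (1 - t) ^ (lam * (((a : ℝ) + 1) / p + b + 1))) else 0) =
      ENNReal.ofReal (1 / (a + 1) * ProbabilityTheory.beta (b + 1) ((a + 1) / p + 1)) *
        ∫⁻ t in Set.Ioo (0 : ℝ) 1,
          ENNReal.ofReal (t ^ c * (1 - t) ^ (lam * (((a : ℝ) + 1) / p + b + 1))) := by
    rw [← lintegral_const_mul' _ _ (by simp), ← lintegral_indicator measurableSet_Ioi,
      ← lintegral_indicator measurableSet_Ioo]
    refine lintegral_congr fun t => ?_
    by_cases ht0 : 0 < t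
    · rw [Set.indicator_of_mem (Set.mem_Ioi.2 ht0)]
      by_cases ht1 : t < 1
      · rw [if_pos ht1, Set.indicator_of_mem (Set.mem_Ioo.2 ⟨ht0, ht1⟩)]
      · rw [if_neg ht1, Set.indicator_of_notMem fun hh => ht1 hh.2]
    · rw [Set.indicator_of_notMem (by simpa using ht0),
        Set.indicator_of_notMem fun hh => ht0 hh.1]
  have hb : 0 < ProbabilityTheory.beta ((b : ℝ) + 1) ((a + 1) / p + 1) :=
    ProbabilityTheory.beta_pos (by positivity) (by positivity)
  rw [e3, lintegral_pow_mul_sub_rpow one_pos (by positivity), Real.one_rpow, one_mul,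
    ← ENNReal.ofReal_mul (by positivity), ← ENNReal.ofReal_mul Real.pi_pos.le,
    ← ENNReal.ofReal_mul Real.pi_pos.le, ← ENNReal.ofReal_mul Real.pi_pos.le, monoNorm]
  congr 1
  ring

/-! ### Summation of the series of the Bergman kernel -/

theorem hasSum_prod_of_nonneg {ι κ : Type*} {f : ι × κ → ℝ} {g : ι → ℝ} {s : ℝ} (hf : ∀ x, 0 ≤ f x)
    (hg : ∀ i, HasSum (fun k => f (i, k)) (g i)) (hs : HasSum g s) : HasSum f s := by
  have h : Summable f := (summable_prod_of_nonneg hf).2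
    ⟨fun i => (hg i).summable, by simpa only [fun i => (hg i).tsum_eq] using hs.summable⟩
  have h2 := h.hasSum.prod_fiberwise hg
  rw [← h2.unique hs]
  exact h.hasSum

theorem Gamma_add_natCast_eq {a : ℝ} (ha : 0 < a) (n : ℕ) :
    Real.Gamma (a + n) = (ascPochhammer ℝ n).eval a * Real.Gamma a := by
  induction n with
  | zero => simp
  | succ n ih =>
    have h : a + n ≠ 0 := by positivity
    rw [ascPochhammer_succ_eval, Nat.cast_succ, ← add_assoc, Real.Gamma_add_one h, ih]
    ring

theorem ringChoose_eq {a : ℝ} (ha : 0 < a) (n : ℕ) :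
    Ring.choose (a + n - 1) n = Real.Gamma (a + n) / (n.factorial * Real.Gamma a) := by
  have h1 := Ring.factorial_nsmul_multichoose_eq_ascPochhammer a n
  rw [Ring.multichoose_eq, nsmul_eq_mul, ← Polynomial.eval₂_smulOneHom_eq_smeval] at h1
  have h2 : Polynomial.eval₂ RingHom.smulOneHom a (ascPochhammer ℕ n) =
      (ascPochhammer ℝ n).eval a := by
    rw [← ascPochhammer_map (Nat.castRingHom ℝ), Polynomial.eval_map]
    congr 1
    exact Subsingleton.elim _ _
  have hG := (Real.Gamma_pos_of_pos ha).ne'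
  have hf : (n.factorial : ℝ) ≠ 0 := by exact_mod_cast n.factorial_ne_zero
  rw [Gamma_add_natCast_eq ha, ← h2, ← h1]
  field_simp

theorem hasSum_pow_mul_Gamma {a x : ℝ} (ha : 0 < a) (h0 : 0 ≤ x) (h1 : x < 1) :
    HasSum (fun n : ℕ => x ^ n * (Real.Gamma (a + n) / (n.factorial * Real.Gamma a)))
      ((1 - x) ^ (-a)) := by
  have h := (Real.one_div_one_sub_rpow_hasFPowerSeriesOnBall_zero a).hasSum (y := x) (by
    simp [Metric.mem_eball, edist_dist, abs_of_nonneg h0, h1])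
  rw [zero_add, one_div, ← Real.rpow_neg (by linarith)] at h
  refine h.congr_fun ?_
  intro n
  simp [ringChoose_eq ha]

/-- This turns a power series in reciprocals of Beta values into the binomial series of
`(1-x)^(-(m+2))`. -/
theorem inv_beta_eq {m : ℝ} (hm : 0 ≤ m) (n : ℕ) :
    (ProbabilityTheory.beta (n + 1) (m + 1))⁻¹ =
      (m + 1) * (Real.Gamma (m + 2 + n) / (n.factorial * Real.Gamma (m + 2))) := by
  have h1 : Real.Gamma (m + 2) = (m + 1) * Real.Gamma (m + 1) := by
    rw [← Real.Gamma_add_one (by positivity)]; ring_nf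
  have h2 := (Real.Gamma_pos_of_pos (by positivity : 0 < m + 1)).ne'
  have hf : (n.factorial : ℝ) ≠ 0 := by exact_mod_cast n.factorial_ne_zero
  have h3 : m + 1 ≠ 0 := by positivity
  rw [ProbabilityTheory.beta, h1, Real.Gamma_nat_eq_factorial, inv_div,
    show (n : ℝ) + 1 + (m + 1) = m + 2 + n by ring]
  field_simp

theorem mul_inv_beta_eq {m : ℝ} (hm : 0 ≤ m) (n : ℕ) :
    (n + m + 2) * (ProbabilityTheory.beta (n + 1) (m + 1))⁻¹ =
      (m + 1) * (m + 2) * (Real.Gamma (m + 3 + n) / (n.factorial * Real.Gamma (m + 3))) := by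
  have h1 : Real.Gamma (m + 3) = (m + 2) * Real.Gamma (m + 2) := by
    rw [← Real.Gamma_add_one (by positivity)]; ring_nf
  have h4 : Real.Gamma (m + 3 + n) = (m + 2 + n) * Real.Gamma (m + 2 + n) := by
    rw [← Real.Gamma_add_one (by positivity)]; ring_nf
  have h2 := (Real.Gamma_pos_of_pos (by positivity : 0 < m + 2)).ne'
  have hf : (n.factorial : ℝ) ≠ 0 := by exact_mod_cast n.factorial_ne_zero
  have h3 : m + 2 ≠ 0 := by positivity
  rw [inv_beta_eq hm, h1, h4]
  field_simp
  ring

theorem hasSum_pow_div_beta {m x : ℝ} (hm : 0 ≤ m) (h0 : 0 ≤ x) (h1 : x < 1) :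
    HasSum (fun n : ℕ => x ^ n * (ProbabilityTheory.beta (n + 1) (m + 1))⁻¹)
      ((m + 1) * (1 - x) ^ (-(m + 2))) := by
  refine ((hasSum_pow_mul_Gamma (a := m + 2) (by positivity) h0 h1).mul_left (m + 1)).congr_fun ?_
  intro n
  rw [inv_beta_eq hm]
  ring

/-- Split `λ(m+n+1)+1 = λ(n+m+2) + (1-λ)`: the first part raises the binomial exponent by one
(`mul_inv_beta_eq`), the second is the previous series. -/
theorem hasSum_pow_div_beta_linear {m x lam : ℝ} (hm : 0 ≤ m) (h0 : 0 ≤ x) (h1 : x < 1) :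
    HasSum (fun n : ℕ => x ^ n * (ProbabilityTheory.beta (n + 1) (m + 1))⁻¹ *
        (lam * (m + n + 1) + 1))
      ((m + 1) * (1 - x) ^ (-(m + 3)) * (lam * (m + 1) + 1 + x * (lam - 1))) := by
  have hx : 0 < 1 - x := by linarith
  have hA := (hasSum_pow_div_beta hm h0 h1).mul_left (1 - lam)
  have hB := (hasSum_pow_mul_Gamma (a := m + 3) (by positivity) h0 h1).mul_left
    (lam * ((m + 1) * (m + 2)))
  have hE : (1 - x) ^ (-(m + 2)) = (1 - x) ^ (-(m + 3)) * (1 - x) := by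
    rw [← Real.rpow_add_one hx.ne']; ring_nf
  have hS := hB.add hA
  rw [hE, show lam * ((m + 1) * (m + 2)) * (1 - x) ^ (-(m + 3)) +
    (1 - lam) * ((m + 1) * ((1 - x) ^ (-(m + 3)) * (1 - x))) = (m + 1) * (1 - x) ^ (-(m + 3)) *
      (lam * (m + 1) + 1 + x * (lam - 1)) by ring] at hS
  refine hS.congr_fun fun n => ?_
  have := mul_inv_beta_eq hm n
  linear_combination lam * x ^ n * this

/-- The cubic in `n` is expanded in the binomials `C(n+1,1)`, `C(n+2,2)`, `C(n+3,3)`, whose series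
are the second, third and fourth powers of `1/(1-ξ)`. -/
theorem hasSum_serP {p lam τ ξ : ℝ} (h0 : 0 ≤ ξ) (h1 : ξ < 1) :
    HasSum (fun n : ℕ => ξ ^ n * ((n + 1) * (n + 1 + p) * (lam * (n + 1 + p) + τ)))
      (serP p lam τ (1 - ξ)⁻¹) := by
  have hn : ‖ξ‖ < 1 := by rwa [Real.norm_of_nonneg h0]
  have c1 := (hasSum_choose_mul_geometric_of_norm_lt_one 1 hn).mul_left
    (lam * (p - 1) ^ 2 + τ * (p - 1))
  have c2 := (hasSum_choose_mul_geometric_of_norm_lt_one 2 hn).mul_left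
    (2 * (lam * (2 * p - 3) + τ))
  have c3 := (hasSum_choose_mul_geometric_of_norm_lt_one 3 hn).mul_left (6 * lam)
  have hS := (c3.add c2).add c1
  have e : 6 * lam * (1 / (1 - ξ) ^ (3 + 1)) + 2 * (lam * (2 * p - 3) + τ) *
      (1 / (1 - ξ) ^ (2 + 1)) + (lam * (p - 1) ^ 2 + τ * (p - 1)) * (1 / (1 - ξ) ^ (1 + 1)) =
      serP p lam τ (1 - ξ)⁻¹ := by
    simp [serP]
  rw [e] at hS
  refine hS.congr_fun fun n => ?_
  have e1 : (((n + 1).choose 1 : ℕ) : ℝ) = n + 1 := by simp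
  have e2 : (((n + 2).choose 2 : ℕ) : ℝ) = (n + 2) * (n + 1) / 2 := by
    rw [Nat.cast_choose_two]; push_cast; ring
  have e3 : (((n + 3).choose 3 : ℕ) : ℝ) = (n + 3) * (n + 2) * (n + 1) / 6 := by
    have := Nat.add_one_mul_choose_eq (n + 2) 2
    have h3 : ((n + 3 : ℕ) : ℝ) * (((n + 2).choose 2 : ℕ) : ℝ) = (((n + 3).choose 3 : ℕ) : ℝ) * 3 := by
      exact_mod_cast this
    rw [e2] at h3
    push_cast at h3
    linarith
  rw [e1, e2, e3]
  ring

/-- The closed form of the Bergman kernel of `E_{p,λ}`. -/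
noncomputable def kerF (p lam : ℝ) (v : Fin 3 → ℝ) : ℝ :=
  1 / (Real.pi ^ 3 * p ^ 2) * (1 - v 2) ^ (-(2 + lam + lam / p)) *
    (1 - sigF lam v) ^ (-(3 + 1 / p)) * serP p lam (tauF p lam v) (invF p lam v)

/-- The terms are nonnegative, so the sum may be iterated. The sum over `c` produces a power of
`1-t` and a factor linear in `b`; the sum over `b` is then a series in `σ`, and the sum over `a` a
series in `ξ`. -/
theorem hasSum_mono_div {p lam : ℝ} (hp : 0 < p) (hlam : 0 < lam) {z : Fin 3 → ℂ}
    (hz : z ∈ domainE p lam) :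
    HasSum (fun j => Complex.normSq (mono j z) / monoNorm p lam j) (kerF p lam (sqMod z)) := by
  have ht1 := ((mem_domainE_iff hlam).1 hz).1
  have hσ := sigF_sqMod_mem hlam hz
  have hξ1 := xi_sqMod_lt hp hlam hz
  have hr0 : 0 ≤ sqMod z 0 := Complex.normSq_nonneg _
  have hs0 : 0 ≤ sqMod z 1 := Complex.normSq_nonneg _
  have ht0 : 0 ≤ sqMod z 2 := Complex.normSq_nonneg _
  have hT : 0 < 1 - sqMod z 2 := by linarith
  have hS : 0 < 1 - sigF lam (sqMod z) := by linarith [hσ.2]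
  have hρ : 0 ≤ rhoF p lam (sqMod z) := by rw [rhoF]; positivity
  refine hasSum_prod_of_nonneg (g := fun a : ℕ => ((a : ℝ) + 1) / Real.pi ^ 3 * sqMod z 0 ^ a *
      (1 - sqMod z 2) ^ (-(lam * ((a + 1) / p + 1) + 2)) * (((a + 1) / p + 1) *
        (1 - sigF lam (sqMod z)) ^ (-((a + 1) / p + 3)) *
          (lam * ((a + 1) / p + 1) + 1 + sigF lam (sqMod z) * (lam - 1))))
    (fun j => div_nonneg (Complex.normSq_nonneg _) (monoNorm_pos hp hlam j).le) (fun a => ?_) ?_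
  · refine hasSum_prod_of_nonneg (g := fun b : ℕ => ((a : ℝ) + 1) / Real.pi ^ 3 * sqMod z 0 ^ a *
      sqMod z 1 ^ b * (ProbabilityTheory.beta (b + 1) ((a + 1) / p + 1))⁻¹ *
        ((lam * ((a + 1) / p + b + 1) + 1) *
          (1 - sqMod z 2) ^ (-(lam * ((a + 1) / p + b + 1) + 2))))
      (fun j => div_nonneg (Complex.normSq_nonneg _) (monoNorm_pos hp hlam _).le) (fun b => ?_) ?_
    · refine ((hasSum_pow_div_beta (m := lam * ((a + 1) / p + b + 1)) (by positivity)
        ht0 ht1).mul_left _).congr_fun fun c => ?_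
      rw [normSq_mono, monoNorm, div_eq_mul_inv, mul_inv, mul_inv, inv_div]
      simp only [sqMod]
      ring
    · refine ((hasSum_pow_div_beta_linear (m := (a + 1) / p) (x := sigF lam (sqMod z)) (lam := lam)
        (by positivity) hσ.1 hσ.2).mul_left _).congr_fun fun b => ?_
      rw [show -(lam * (((a : ℝ) + 1) / p + b + 1) + 2) = -(lam * ((a + 1) / p + 1) + 2) +
        -lam * b by ring, Real.rpow_add hT, Real.rpow_mul_natCast hT.le, sigF, mul_pow]
      ring
  · refine ((hasSum_serP (p := p) (lam := lam) (τ := tauF p lam (sqMod z))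
      (mul_nonneg hr0 hρ) hξ1).mul_left (1 / (Real.pi ^ 3 * p ^ 2) *
        (1 - sqMod z 2) ^ (-(2 + lam + lam / p)) *
        (1 - sigF lam (sqMod z)) ^ (-(3 + 1 / p)))).congr_fun fun a => ?_
    rw [show -(lam * (((a : ℝ) + 1) / p + 1) + 2) = -(2 + lam + lam / p) + -(lam / p) * a by ring,
      show -(((a : ℝ) + 1) / p + 3) = -(3 + 1 / p) + -(1 / p) * a by ring, Real.rpow_add hT,
      Real.rpow_add hS, Real.rpow_mul_natCast hT.le, Real.rpow_mul_natCast hS.le, tauF, rhoF,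
      mul_pow, mul_pow]
    field_simp
    ring

theorem log_kerF {p lam : ℝ} (hp : 0 < p) (hlam : 0 < lam) {z : Fin 3 → ℂ}
    (hz : z ∈ domainE p lam) : Real.log (kerF p lam (sqMod z)) =
      potF p lam (Real.log (1 / (Real.pi ^ 3 * p ^ 2))) (sqMod z) := by
  have ht1 := ((mem_domainE_iff hlam).1 hz).1
  have hσ := sigF_sqMod_mem hlam hz
  have hξ1 := xi_sqMod_lt hp hlam hz
  have hT : 0 < 1 - sqMod z 2 := by linarith
  have hS : 0 < 1 - sigF lam (sqMod z) := by linarith [hσ.2]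
  have hr0 : 0 ≤ sqMod z 0 := Complex.normSq_nonneg _
  have hρ : 0 ≤ rhoF p lam (sqMod z) := by rw [rhoF]; positivity
  have hi : 1 ≤ invF p lam (sqMod z) :=
    (one_le_inv₀ (by linarith)).2 (by linarith [mul_nonneg hr0 hρ])
  have hser : 0 < serP p lam (tauF p lam (sqMod z)) (invF p lam (sqMod z)) :=
    serP_pos hp hlam (tau_pos hp hlam hσ.1 hσ.2.le) hi
  rw [kerF, Real.log_mul (by positivity) hser.ne', Real.log_mul (by positivity) (by positivity),
    Real.log_mul (by positivity) (by positivity), Real.log_rpow hT, Real.log_rpow hS, potF]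
  ring

/-! ### Integration over the torus -/

/-- The point `exp (iθ)` of the unit circle. -/
noncomputable def expI (θ : ℝ) : ℂ := Complex.exp (θ * Complex.I)

theorem norm_expI (θ : ℝ) : ‖expI θ‖ = 1 := Complex.norm_exp_ofReal_mul_I θ

theorem expI_ne_zero (θ : ℝ) : expI θ ≠ 0 := Complex.exp_ne_zero _

theorem continuous_expI : Continuous expI := by unfold expI; fun_prop

theorem conj_expI_mul (θ : ℝ) : conj (expI θ) * expI θ = 1 := by
  rw [Complex.conj_mul', norm_expI]; simp

/-- The normalized Lebesgue measure on `(0, 2π]`. -/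
noncomputable def circleMeas : Measure ℝ :=
  ENNReal.ofReal (2 * Real.pi)⁻¹ • volume.restrict (Set.Ioc 0 (2 * Real.pi))

instance : IsProbabilityMeasure circleMeas where
  measure_univ := by
    rw [circleMeas, Measure.smul_apply, Measure.restrict_apply_univ, Real.volume_Ioc, sub_zero,
      smul_eq_mul, ← ENNReal.ofReal_mul (by positivity), inv_mul_cancel₀ (by positivity)]
    simp

theorem integral_circleMeas (f : ℂ → ℂ) (R : ℝ) :
    ∫ θ, f (R * expI θ) ∂circleMeas = Real.circleAverage f 0 R := by
  rw [circleMeas, integral_smul_measure, Real.circleAverage_def,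
    intervalIntegral.integral_of_le Real.two_pi_pos.le,
    ENNReal.toReal_ofReal (by positivity)]
  simp only [circleMap_zero, expI]

theorem integral_cauchy {f : ℂ → ℂ} {U : Set ℂ} {R : ℝ} {w : ℂ} (hf : DifferentiableOn ℂ f U)
    (hU : Metric.closedBall 0 R ⊆ U) (hw : ‖w‖ < R) :
    ∫ θ, (1 - w / (R * expI θ))⁻¹ * f (R * expI θ) ∂circleMeas = f w := by
  have hR : 0 < R := (norm_nonneg _).trans_lt hw
  have h1 : DiffContOnCl ℂ f (Metric.ball 0 |R|) := by
    rw [abs_of_pos hR]; exact hf.diffContOnCl_ball hU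
  rw [← h1.circleAverage_smul_div (w := w) (by simpa [abs_of_pos hR] using hw),
    ← integral_circleMeas]
  refine integral_congr_ae (Filter.Eventually.of_forall fun θ => ?_)
  have hz : (R : ℂ) * expI θ ≠ 0 := mul_ne_zero (by exact_mod_cast hR.ne') (expI_ne_zero θ)
  simp only [smul_eq_mul, sub_zero]
  rw [one_sub_div hz, inv_div]

theorem integral_expI_pow (k : ℕ) : ∫ θ, expI θ ^ k ∂circleMeas = if k = 0 then 1 else 0 := by
  have h := integral_circleMeas (fun z => z ^ k) 1
  have h1 : DiffContOnCl ℂ (fun z : ℂ => z ^ k) (Metric.ball 0 |1|) :=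
    (differentiable_pow k).diffContOnCl
  rw [h1.circleAverage] at h
  simpa [zero_pow_eq] using h

theorem integral_conj_expI_pow_mul (j k : ℕ) :
    ∫ θ, conj (expI θ ^ j) * expI θ ^ k ∂circleMeas = if j = k then 1 else 0 := by
  rcases le_total j k with h | h
  · obtain ⟨m, rfl⟩ := Nat.exists_eq_add_of_le h
    have : ∀ θ, conj (expI θ ^ j) * expI θ ^ (j + m) = expI θ ^ m := fun θ => by
      rw [map_pow, pow_add, ← mul_assoc, ← mul_pow, conj_expI_mul, one_pow, one_mul]
    simp only [this, integral_expI_pow]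
    simp
  · obtain ⟨m, rfl⟩ := Nat.exists_eq_add_of_le h
    have : ∀ θ, conj (expI θ ^ (k + m)) * expI θ ^ k = conj (expI θ ^ m) := fun θ => by
      rw [map_pow, map_pow, pow_add, mul_right_comm, ← mul_pow, conj_expI_mul, one_pow, one_mul]
    simp only [this, integral_conj, integral_expI_pow]
    simp

/-- The normalized measure on the parameters of the torus. -/
noncomputable def torusMeas : Measure (ℝ × ℝ × ℝ) := circleMeas.prod (circleMeas.prod circleMeas)

instance : IsProbabilityMeasure torusMeas := by unfold torusMeas; infer_instance

/-- The point of the torus with parameters `θ`. -/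
noncomputable def torusPt (θ : ℝ × ℝ × ℝ) : Fin 3 → ℂ := ![expI θ.1, expI θ.2.1, expI θ.2.2]

theorem norm_torusPt (θ : ℝ × ℝ × ℝ) (i : Fin 3) : ‖torusPt θ i‖ = 1 := by
  fin_cases i <;> exact norm_expI _

theorem continuous_torusPt : Continuous torusPt := by
  refine continuous_pi fun i => ?_
  fin_cases i
  · exact continuous_expI.comp continuous_fst
  · exact continuous_expI.comp continuous_snd.fst
  · exact continuous_expI.comp continuous_snd.snd

theorem mono_mul (j : ℕ × ℕ × ℕ) (v w : Fin 3 → ℂ) : mono j (v * w) = mono j v * mono j w := by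
  simp only [mono, Pi.mul_apply]; ring

theorem continuous_mono (j : ℕ × ℕ × ℕ) : Continuous (mono j) := by unfold mono; fun_prop

theorem differentiable_mono (j : ℕ × ℕ × ℕ) : Differentiable ℂ (mono j) := by
  unfold mono; fun_prop

theorem norm_mono (j : ℕ × ℕ × ℕ) (v : Fin 3 → ℂ) :
    ‖mono j v‖ = ‖v 0‖ ^ j.1 * ‖v 1‖ ^ j.2.1 * ‖v 2‖ ^ j.2.2 := by
  simp [mono]

theorem norm_mono_torusPt (j : ℕ × ℕ × ℕ) (θ : ℝ × ℝ × ℝ) : ‖mono j (torusPt θ)‖ = 1 := by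
  simp [norm_mono, norm_torusPt]

theorem mono_ne_zero {v : Fin 3 → ℂ} (hv : ∀ i, v i ≠ 0) (j : ℕ × ℕ × ℕ) : mono j v ≠ 0 :=
  mul_ne_zero (mul_ne_zero (pow_ne_zero _ (hv 0)) (pow_ne_zero _ (hv 1))) (pow_ne_zero _ (hv 2))

theorem integral_conj_mono_mul_mono (j k : ℕ × ℕ × ℕ) :
    ∫ θ, conj (mono j (torusPt θ)) * mono k (torusPt θ) ∂torusMeas = if j = k then 1 else 0 := by
  have h : ∀ θ : ℝ × ℝ × ℝ, conj (mono j (torusPt θ)) * mono k (torusPt θ) =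
      (conj (expI θ.1 ^ j.1) * expI θ.1 ^ k.1) *
        ((conj (expI θ.2.1 ^ j.2.1) * expI θ.2.1 ^ k.2.1) *
          (conj (expI θ.2.2 ^ j.2.2) * expI θ.2.2 ^ k.2.2)) := fun θ => by
    simp only [mono, torusPt, Matrix.cons_val_zero, Matrix.cons_val_one, Matrix.cons_val, map_mul]
    ring
  simp only [h, torusMeas]
  rw [integral_prod_mul (fun θ => conj (expI θ ^ j.1) * expI θ ^ k.1)
    (fun θ : ℝ × ℝ => (conj (expI θ.1 ^ j.2.1) * expI θ.1 ^ k.2.1) *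
          (conj (expI θ.2 ^ j.2.2) * expI θ.2 ^ k.2.2)),
    integral_prod_mul (fun θ => conj (expI θ ^ j.2.1) * expI θ ^ k.2.1)
    (fun θ => conj (expI θ ^ j.2.2) * expI θ ^ k.2.2)]
  simp only [integral_conj_expI_pow_mul, Prod.ext_iff]
  split_ifs <;> simp_all

/-! ### Power series expansion on complete Reinhardt domains -/

/-- Complete Reinhardt domains. -/
structure IsReinhardt (Ω : Set (Fin 3 → ℂ)) : Prop where
  isOpen : IsOpen Ω
  complete : ∀ ⦃v⦄, v ∈ Ω → ∀ ⦃w : Fin 3 → ℂ⦄, (∀ i, ‖w i‖ ≤ ‖v i‖) → w ∈ Ω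

theorem IsReinhardt.mul_torusPt {Ω : Set (Fin 3 → ℂ)} (h : IsReinhardt Ω) {v : Fin 3 → ℂ}
    (hv : v ∈ Ω) (θ : ℝ × ℝ × ℝ) : v * torusPt θ ∈ Ω :=
  h.complete hv fun i => by simp [norm_torusPt]

theorem IsReinhardt.exists_bound {Ω : Set (Fin 3 → ℂ)} (h : IsReinhardt Ω)
    {F : (Fin 3 → ℂ) → ℂ} (hF : ContinuousOn F Ω) {v : Fin 3 → ℂ} (hv : v ∈ Ω) :
    ∃ M, 0 ≤ M ∧ ∀ w : Fin 3 → ℂ, (∀ i, ‖w i‖ ≤ ‖v i‖) → ‖F w‖ ≤ M := by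
  have hK : IsCompact (Set.univ.pi fun i => Metric.closedBall (0 : ℂ) ‖v i‖) :=
    isCompact_univ_pi fun i => isCompact_closedBall _ _
  obtain ⟨M, hM⟩ := hK.exists_bound_of_continuousOn (hF.mono fun w hw =>
    h.complete hv fun i => by simpa using hw i (Set.mem_univ i))
  refine ⟨max M 0, le_max_right _ _, fun w hw => (hM w fun i _ => ?_).trans (le_max_left _ _)⟩
  simpa using hw i

theorem differentiable_vec (i : Fin 3) (v : Fin 3 → ℂ) :
    Differentiable ℂ fun x : ℂ => Function.update v i x := by
  refine differentiable_pi.2 fun k => ?_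
  by_cases hk : k = i
  · subst hk; simp
  · simp [Function.update_of_ne hk]

theorem IsReinhardt.integral_cauchy_update {Ω : Set (Fin 3 → ℂ)} (h : IsReinhardt Ω)
    {F : (Fin 3 → ℂ) → ℂ} (hF : DifferentiableOn ℂ F Ω) (i : Fin 3) (v : Fin 3 → ℂ) {R : ℝ}
    (hv : Function.update v i (R : ℂ) ∈ Ω) (hw : ‖v i‖ < R) :
    ∫ θ, (1 - v i / (R * expI θ))⁻¹ * F (Function.update v i (R * expI θ)) ∂circleMeas = F v := by
  have h1 := integral_cauchy (f := fun x => F (Function.update v i x))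
    (U := {x | Function.update v i x ∈ Ω}) (R := R) (w := v i)
    (hF.comp (differentiable_vec i v).differentiableOn fun x hx => hx) (fun x hx => ?_) hw
  · rwa [Function.update_eq_self] at h1
  · refine h.complete hv fun k => ?_
    by_cases hk : k = i
    · subst hk
      simpa [abs_of_nonneg ((norm_nonneg _).trans hw.le)] using hx
    · simp [Function.update_of_ne hk]

/-- The Fourier coefficient of index `j` of `θ ↦ F (θ v)`. -/
noncomputable def torusCoeff (F : (Fin 3 → ℂ) → ℂ) (j : ℕ × ℕ × ℕ) (v : Fin 3 → ℂ) : ℂ :=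
  ∫ θ, conj (mono j (torusPt θ)) * F (v * torusPt θ) ∂torusMeas

theorem IsReinhardt.continuous_comp_torus {Ω : Set (Fin 3 → ℂ)} (h : IsReinhardt Ω)
    {F : (Fin 3 → ℂ) → ℂ} (hF : ContinuousOn F Ω) {v : Fin 3 → ℂ} (hv : v ∈ Ω) :
    Continuous fun θ => F (v * torusPt θ) :=
  hF.comp_continuous (continuous_const.mul continuous_torusPt) (h.mul_torusPt hv)

theorem IsReinhardt.norm_torusCoeff_le {Ω : Set (Fin 3 → ℂ)} (h : IsReinhardt Ω)
    {F : (Fin 3 → ℂ) → ℂ} (hF : ContinuousOn F Ω) {v : Fin 3 → ℂ} (hv : v ∈ Ω) :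
    ∃ M, ∀ j, ‖torusCoeff F j v‖ ≤ M := by
  obtain ⟨M, -, hM⟩ := h.exists_bound hF hv
  refine ⟨M, fun j => ?_⟩
  have := norm_integral_le_of_norm_le_const (μ := torusMeas) (C := M)
    (f := fun θ => conj (mono j (torusPt θ)) * F (v * torusPt θ))
    (Filter.Eventually.of_forall fun θ => by
      rw [norm_mul, RCLike.norm_conj, norm_mono_torusPt, one_mul]
      exact hM _ fun i => by simp [norm_torusPt])
  simpa [torusCoeff] using this

theorem hasSum_mul_of_summable_norm {ι κ : Type*} {f : ι → ℂ} {g : κ → ℂ} {a b : ℂ}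
    (hf : HasSum f a) (hg : HasSum g b) (hf' : Summable fun i => ‖f i‖)
    (hg' : Summable fun k => ‖g k‖) :
    HasSum (fun x : ι × κ => f x.1 * g x.2) (a * b) ∧
      Summable fun x : ι × κ => ‖f x.1 * g x.2‖ :=
  have h := hf'.mul_norm hg'
  ⟨hf.mul hg h.of_norm, h⟩

theorem hasSum_mono {x : Fin 3 → ℂ} (hx : ∀ i, ‖x i‖ < 1) :
    HasSum (fun j => mono j x) ((1 - x 0)⁻¹ * ((1 - x 1)⁻¹ * (1 - x 2)⁻¹)) := by
  have hs : ∀ i, Summable fun n : ℕ => ‖x i ^ n‖ := fun i => by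
    simpa using summable_geometric_of_lt_one (norm_nonneg _) (hx i)
  have g : ∀ i, HasSum (fun n : ℕ => x i ^ n) (1 - x i)⁻¹ := fun i =>
    hasSum_geometric_of_norm_lt_one (hx i)
  have h12 := hasSum_mul_of_summable_norm (g 1) (g 2) (hs 1) (hs 2)
  refine (hasSum_mul_of_summable_norm (g 0) h12.1 (hs 0) h12.2).1.congr_fun fun j => ?_
  rw [mono, mul_assoc]

theorem summable_norm_mono {x : Fin 3 → ℂ} (hx : ∀ i, ‖x i‖ < 1) :
    Summable fun j => ‖mono j x‖ := (hasSum_mono hx).summable.norm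

theorem integrable_of_continuous_of_bound {X : Type*} [TopologicalSpace X] [MeasurableSpace X]
    [OpensMeasurableSpace X] [SecondCountableTopology X] {μ : Measure X} [IsFiniteMeasure μ]
    {f : X → ℂ} (hf : Continuous f) {M : ℝ} (hM : ∀ x, ‖f x‖ ≤ M) : Integrable f μ :=
  Integrable.of_bound hf.aestronglyMeasurable M (Filter.Eventually.of_forall hM)

/-- The point of `ℂ³` with real coordinates `ρ`. -/
def realPt (ρ : Fin 3 → ℝ) : Fin 3 → ℂ := fun i => (ρ i : ℂ)

theorem norm_inv_one_sub_le {x : ℂ} {b : ℝ} (hx : ‖x‖ ≤ b) (hb : b < 1) :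
    ‖(1 - x)⁻¹‖ ≤ (1 - b)⁻¹ := by
  rw [norm_inv]
  refine inv_anti₀ (by linarith) ?_
  have := norm_sub_norm_le (1 : ℂ) x
  rw [norm_one] at this
  linarith

/-- Cauchy's formula in one variable at a time. Fubini applies because the integrands are continuous
and bounded on a probability space. -/
theorem IsReinhardt.integral_cauchy_torus {Ω : Set (Fin 3 → ℂ)} (h : IsReinhardt Ω)
    {F : (Fin 3 → ℂ) → ℂ} (hF : DifferentiableOn ℂ F Ω) {ρ : Fin 3 → ℝ} (hρ : realPt ρ ∈ Ω)
    {w : Fin 3 → ℂ} (hw : ∀ i, ‖w i‖ < ρ i) :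
    ∫ θ, ((1 - w 0 / (ρ 0 * expI θ.1))⁻¹ * ((1 - w 1 / (ρ 1 * expI θ.2.1))⁻¹ *
      (1 - w 2 / (ρ 2 * expI θ.2.2))⁻¹)) * F (realPt ρ * torusPt θ) ∂torusMeas = F w := by
  have hρ0 : ∀ i, 0 < ρ i := fun i => (norm_nonneg _).trans_lt (hw i)
  have hnρ : ∀ i, ‖realPt ρ i‖ = ρ i := fun i => by simp [realPt, abs_of_pos (hρ0 i)]
  have hmem : ∀ v : Fin 3 → ℂ, (∀ i, ‖v i‖ ≤ ρ i) → v ∈ Ω := fun v hv =>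
    h.complete hρ fun i => (hv i).trans (hnρ i).ge
  set k : Fin 3 → ℝ → ℂ := fun i θ => (1 - w i / (ρ i * expI θ))⁻¹ with hk
  have hx : ∀ i θ, ‖w i / (ρ i * expI θ)‖ = ‖w i‖ / ρ i := fun i θ => by
    simp [norm_expI, abs_of_pos (hρ0 i)]
  have hlt : ∀ i, ‖w i‖ / ρ i < 1 := fun i => (div_lt_one (hρ0 i)).2 (hw i)
  have hkc : ∀ i, Continuous (k i) := fun i => by
    have hden : ∀ θ, (ρ i : ℂ) * expI θ ≠ 0 := fun θ =>
      mul_ne_zero (by exact_mod_cast (hρ0 i).ne') (expI_ne_zero θ)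
    refine Continuous.inv₀ (continuous_const.sub
      (continuous_const.div (continuous_const.mul continuous_expI) hden)) fun θ h0 => ?_
    have := hx i θ
    rw [← sub_eq_zero.1 h0, norm_one] at this
    exact (hlt i).ne this.symm
  have hkb : ∀ i θ, ‖k i θ‖ ≤ (1 - ‖w i‖ / ρ i)⁻¹ := fun i θ =>
    norm_inv_one_sub_le (hx i θ).le (hlt i)
  have hkp : ∀ i, 0 ≤ (1 - ‖w i‖ / ρ i)⁻¹ := fun i => (norm_nonneg _).trans (hkb i 0)
  obtain ⟨M, hM0, hM⟩ := h.exists_bound hF.continuousOn hρ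
  have hFc := h.continuous_comp_torus hF.continuousOn hρ
  have hFb : ∀ θ, ‖F (realPt ρ * torusPt θ)‖ ≤ M := fun θ => hM _ fun i => by simp [norm_torusPt]
  have hint : Integrable (fun θ : ℝ × ℝ × ℝ => (k 0 θ.1 * (k 1 θ.2.1 * k 2 θ.2.2)) *
      F (realPt ρ * torusPt θ)) torusMeas := by
    refine integrable_of_continuous_of_bound (M := ((1 - ‖w 0‖ / ρ 0)⁻¹ *
      ((1 - ‖w 1‖ / ρ 1)⁻¹ * (1 - ‖w 2‖ / ρ 2)⁻¹)) * M) ?_ fun θ => ?_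
    · exact (((hkc 0).comp continuous_fst).mul (((hkc 1).comp continuous_snd.fst).mul
        ((hkc 2).comp continuous_snd.snd))).mul hFc
    · rw [norm_mul, norm_mul, norm_mul]
      gcongr <;> first | exact hkp _ | exact hkb _ _ | exact hFb _ | skip
      exact mul_nonneg (hkp _) (mul_nonneg (hkp _) (hkp _))
  have hint2 : ∀ θ₀, Integrable (fun θ : ℝ × ℝ => k 1 θ.1 * (k 2 θ.2 *
      F (realPt ρ * torusPt (θ₀, θ)))) (circleMeas.prod circleMeas) := fun θ₀ => by
    refine integrable_of_continuous_of_bound (M := (1 - ‖w 1‖ / ρ 1)⁻¹ *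
      ((1 - ‖w 2‖ / ρ 2)⁻¹ * M)) ?_ fun θ => ?_
    · exact ((hkc 1).comp continuous_fst).mul (((hkc 2).comp continuous_snd).mul
        (hFc.comp (continuous_const.prodMk continuous_id)))
    · rw [norm_mul, norm_mul]
      gcongr <;> first | exact hkp _ | exact hkb _ _ | exact hFb _
  rw [torusMeas, integral_prod _ hint]
  have hv0 : ∀ θ : ℝ, ‖(ρ 0 : ℂ) * expI θ‖ ≤ ρ 0 := fun θ => by
    simp [norm_expI, abs_of_pos (hρ0 0)]
  have hv1 : ∀ θ : ℝ, ‖(ρ 1 : ℂ) * expI θ‖ ≤ ρ 1 := fun θ => by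
    simp [norm_expI, abs_of_pos (hρ0 1)]
  have hr : ∀ i, ‖(ρ i : ℂ)‖ ≤ ρ i := fun i => by simp [abs_of_pos (hρ0 i)]
  rw [← h.integral_cauchy_update hF 0 w (R := ρ 0) (hmem _ fun i => ?_) (hw 0)]
  swap
  · fin_cases i
    · simpa using hr 0
    · simpa using (hw 1).le
    · simpa using (hw 2).le
  refine integral_congr_ae (Filter.Eventually.of_forall fun θ₀ => ?_)
  simp only [mul_assoc]
  rw [integral_const_mul, integral_prod _ (hint2 θ₀)]
  congr 1
  rw [← h.integral_cauchy_update hF 1 (Function.update w 0 (ρ 0 * expI θ₀)) (R := ρ 1)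
    (hmem _ fun i => ?_) (by simpa using hw 1)]
  swap
  · fin_cases i
    · simpa using hv0 θ₀
    · simpa using hr 1
    · simpa using (hw 2).le
  refine integral_congr_ae (Filter.Eventually.of_forall fun θ₁ => ?_)
  simp only
  rw [integral_const_mul, ← h.integral_cauchy_update hF 2
    (Function.update (Function.update w 0 (ρ 0 * expI θ₀)) 1 (ρ 1 * expI θ₁)) (R := ρ 2)
    (hmem _ fun i => ?_) (by simpa using hw 2)]
  swap
  · fin_cases i
    · simpa using hv0 θ₀
    · simpa using hv1 θ₁
    · simpa using hr 2
  refine congr_arg₂ _ (by simp [hk]) (integral_congr_ae (Filter.Eventually.of_forall fun θ₂ => ?_))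
  simp only
  refine congr_arg₂ _ (by simp [hk]) (congrArg F ?_)
  ext i
  fin_cases i <;> simp [realPt, torusPt]

/-- The Cauchy kernel on the torus is expanded in a geometric series and integrated termwise; the
integrals of the norms are dominated by `M ∑ |qʲ|`. -/
theorem IsReinhardt.hasSum_torusCoeff {Ω : Set (Fin 3 → ℂ)} (h : IsReinhardt Ω)
    {F : (Fin 3 → ℂ) → ℂ} (hF : DifferentiableOn ℂ F Ω) {ρ : Fin 3 → ℝ} (hρ : realPt ρ ∈ Ω)
    (hρ0 : ∀ i, 0 < ρ i) {q : Fin 3 → ℂ} (hq : ∀ i, ‖q i‖ < 1) :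
    HasSum (fun j => mono j q * torusCoeff F j (realPt ρ)) (F (q * realPt ρ)) := by
  obtain ⟨M, hM0, hM⟩ := h.exists_bound hF.continuousOn hρ
  have hFc := h.continuous_comp_torus hF.continuousOn hρ
  have hFb : ∀ θ, ‖F (realPt ρ * torusPt θ)‖ ≤ M := fun θ => hM _ fun i => by simp [norm_torusPt]
  have hmc : ∀ j, Continuous fun θ => conj (mono j (torusPt θ)) := fun j =>
    Complex.continuous_conj.comp ((continuous_mono j).comp continuous_torusPt)
  have hb : ∀ j θ, ‖conj (mono j (torusPt θ)) * F (realPt ρ * torusPt θ)‖ ≤ M := fun j θ => by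
    rw [norm_mul, RCLike.norm_conj, norm_mono_torusPt, one_mul]
    exact hFb θ
  have hint : ∀ j, Integrable (fun θ => mono j q * (conj (mono j (torusPt θ)) *
      F (realPt ρ * torusPt θ))) torusMeas := fun j =>
    (integrable_of_continuous_of_bound ((hmc j).mul hFc) (hb j)).const_mul _
  have hsum : Summable fun j => ∫ θ, ‖mono j q * (conj (mono j (torusPt θ)) *
      F (realPt ρ * torusPt θ))‖ ∂torusMeas := by
    refine Summable.of_nonneg_of_le (fun j => integral_nonneg fun θ => norm_nonneg _) (fun j => ?_)
      ((summable_norm_mono hq).mul_right M)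
    have : ∫ θ, ‖mono j q * (conj (mono j (torusPt θ)) *
        F (realPt ρ * torusPt θ))‖ ∂torusMeas ≤ ∫ _, ‖mono j q‖ * M ∂torusMeas :=
      integral_mono (hint j).norm (integrable_const _) fun θ => by
        simp only [norm_mul (mono j q)]
        exact mul_le_mul_of_nonneg_left (hb j θ) (norm_nonneg _)
    simpa using this
  have key := hasSum_integral_of_summable_integral_norm hint hsum
  simp only [integral_const_mul] at key
  have hw : ∀ i, ‖(q * realPt ρ) i‖ < ρ i := fun i => by
    simpa [realPt, abs_of_pos (hρ0 i)] using mul_lt_mul_of_pos_right (hq i) (hρ0 i)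
  rw [← h.integral_cauchy_torus hF hρ hw]
  convert! key using 1
  refine integral_congr_ae (Filter.Eventually.of_forall fun θ => ?_)
  have hx : ∀ i, ‖(q * fun i => conj (torusPt θ i)) i‖ < 1 := fun i => by
    simpa [norm_torusPt] using hq i
  have e1 : ∀ i (e : ℂ), ‖e‖ = 1 → (q * realPt ρ) i / (ρ i * e) = q i * conj e := fun i e he => by
    have h1 : (ρ i : ℂ) ≠ 0 := by exact_mod_cast (hρ0 i).ne'
    have h2 : conj e * e = 1 := by rw [Complex.conj_mul', he]; simp
    have h3 : e ≠ 0 := by rintro rfl; simp at he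
    simp only [Pi.mul_apply, realPt]
    field_simp
    linear_combination -q i * h2
  have h4 := ((hasSum_mono hx).mul_right (F (realPt ρ * torusPt θ))).tsum_eq
  simp only
  rw [e1 0 _ (norm_expI _), e1 1 _ (norm_expI _), e1 2 _ (norm_expI _)]
  refine Eq.trans h4.symm (tsum_congr fun j => ?_)
  rw [mono_mul, mul_assoc]
  congr 2
  simp [mono]

/-- The Fourier coefficients scale like the monomials: insert the expansion at `q * torusPt θ` and
use orthogonality of the characters of the torus. -/
theorem IsReinhardt.torusCoeff_mul {Ω : Set (Fin 3 → ℂ)} (h : IsReinhardt Ω)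
    {F : (Fin 3 → ℂ) → ℂ} (hF : DifferentiableOn ℂ F Ω) {ρ : Fin 3 → ℝ} (hρ : realPt ρ ∈ Ω)
    (hρ0 : ∀ i, 0 < ρ i) {q : Fin 3 → ℂ} (hq : ∀ i, ‖q i‖ < 1) (j : ℕ × ℕ × ℕ) :
    torusCoeff F j (q * realPt ρ) = mono j q * torusCoeff F j (realPt ρ) := by
  obtain ⟨M, hM⟩ := h.norm_torusCoeff_le hF.continuousOn hρ
  have hmc : ∀ j, Continuous fun θ => mono j (torusPt θ) := fun j =>
    (continuous_mono j).comp continuous_torusPt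
  have hb : ∀ k θ, ‖conj (mono j (torusPt θ)) * mono k (torusPt θ)‖ ≤ 1 := fun k θ => by
    rw [norm_mul, RCLike.norm_conj, norm_mono_torusPt, norm_mono_torusPt, one_mul]
  have hint : ∀ k, Integrable (fun θ => (mono k q * torusCoeff F k (realPt ρ)) *
      (conj (mono j (torusPt θ)) * mono k (torusPt θ))) torusMeas := fun k =>
    (integrable_of_continuous_of_bound ((Complex.continuous_conj.comp (hmc j)).mul (hmc k))
      (hb k)).const_mul _
  have hsum : Summable fun k => ∫ θ, ‖(mono k q * torusCoeff F k (realPt ρ)) *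
      (conj (mono j (torusPt θ)) * mono k (torusPt θ))‖ ∂torusMeas := by
    refine Summable.of_nonneg_of_le (fun j => integral_nonneg fun θ => norm_nonneg _) (fun k => ?_)
      ((summable_norm_mono hq).mul_right M)
    have e : ∀ θ, ‖(mono k q * torusCoeff F k (realPt ρ)) *
      (conj (mono j (torusPt θ)) * mono k (torusPt θ))‖ =
        ‖mono k q‖ * ‖torusCoeff F k (realPt ρ)‖ := fun θ => by
      rw [norm_mul, norm_mul, norm_mul, RCLike.norm_conj, norm_mono_torusPt, norm_mono_torusPt,
        one_mul, mul_one]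
    simp only [e]
    simpa using mul_le_mul_of_nonneg_left (hM k) (norm_nonneg (mono k q))
  have key := hasSum_integral_of_summable_integral_norm hint hsum
  simp only [integral_const_mul, integral_conj_mono_mul_mono] at key
  have h1 : torusCoeff F j (q * realPt ρ) = ∫ θ, ∑' k, (mono k q * torusCoeff F k (realPt ρ)) *
      (conj (mono j (torusPt θ)) * mono k (torusPt θ)) ∂torusMeas := by
    refine integral_congr_ae (Filter.Eventually.of_forall fun θ => ?_)
    have hx : ∀ i, ‖(q * torusPt θ) i‖ < 1 := fun i => by simpa [norm_torusPt] using hq i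
    have h4 := ((h.hasSum_torusCoeff hF hρ hρ0 hx).mul_left (conj (mono j (torusPt θ)))).tsum_eq
    simp only
    rw [mul_right_comm q, ← h4]
    refine tsum_congr fun k => ?_
    rw [mono_mul]
    ring
  rw [h1]
  refine key.unique ?_
  have := hasSum_ite_eq j (mono j q * torusCoeff F j (realPt ρ))
  refine this.congr_fun fun k => ?_
  by_cases hjk : k = j
  · subst hjk; simp
  · simp [hjk, Ne.symm hjk]

theorem IsReinhardt.exists_realPt {Ω : Set (Fin 3 → ℂ)} (h : IsReinhardt Ω) {w : Fin 3 → ℂ}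
    (hw : w ∈ Ω) : ∃ ρ : Fin 3 → ℝ, realPt ρ ∈ Ω ∧ ∀ i, ‖w i‖ < ρ i := by
  have hc : Continuous fun ε : ℝ => realPt fun i => ‖w i‖ + ε := by unfold realPt; fun_prop
  have h0 : (realPt fun i => ‖w i‖ + 0) ∈ Ω := h.complete hw fun i => by simp [realPt]
  have hev := hc.continuousAt.eventually (h.isOpen.mem_nhds h0)
  obtain ⟨ε, hε, hε0⟩ := ((hev.filter_mono nhdsWithin_le_nhds).and
    (self_mem_nhdsWithin : Set.Ioi (0 : ℝ) ∈ nhdsWithin 0 (Set.Ioi 0))).exists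
  exact ⟨fun i => ‖w i‖ + ε, hε, fun i => lt_add_of_pos_right _ hε0⟩

/-- `torusCoeff F j (realPt ρ) / mono j (realPt ρ)` does not depend on the polyradius, so a single
family of coefficients serves on all of `Ω`. -/
theorem IsReinhardt.exists_powerSeries {Ω : Set (Fin 3 → ℂ)} (h : IsReinhardt Ω)
    {F : (Fin 3 → ℂ) → ℂ} (hF : DifferentiableOn ℂ F Ω) :
    ∃ a : ℕ × ℕ × ℕ → ℂ, ∀ w ∈ Ω, HasSum (fun j => a j * mono j w) (F w) ∧
      ∀ j, torusCoeff F j w = a j * mono j w := by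
  by_cases hne : ∃ w, w ∈ Ω
  swap
  · exact ⟨0, fun w hw => (hne ⟨w, hw⟩).elim⟩
  obtain ⟨w₀, hw₀⟩ := hne
  obtain ⟨r, hr, hr0⟩ := h.exists_realPt hw₀
  replace hr0 : ∀ i, 0 < r i := fun i => (norm_nonneg _).trans_lt (hr0 i)
  have hne : ∀ {ρ : Fin 3 → ℝ}, (∀ i, 0 < ρ i) → ∀ i, realPt ρ i ≠ 0 := fun h0 i => by
    simpa [realPt] using (h0 i).ne'
  refine ⟨fun j => torusCoeff F j (realPt r) / mono j (realPt r), fun w hw => ?_⟩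
  obtain ⟨ρ, hρ, hwρ⟩ := h.exists_realPt hw
  have hρ0 : ∀ i, 0 < ρ i := fun i => (norm_nonneg _).trans_lt (hwρ i)
  have hs0 : ∀ i, 0 < min (r i) (ρ i) / 2 := fun i => half_pos (lt_min (hr0 i) (hρ0 i))
  have hdiv : ∀ {v : Fin 3 → ℂ} {ρ : Fin 3 → ℝ}, (∀ i, 0 < ρ i) →
      (fun i => v i / realPt ρ i) * realPt ρ = v := fun h0 => by
    ext i; exact div_mul_cancel₀ _ (hne h0 i)
  have hlt : ∀ {v : Fin 3 → ℂ} {ρ : Fin 3 → ℝ}, (∀ i, ‖v i‖ < ρ i) →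
      ∀ i, ‖v i / realPt ρ i‖ < 1 := fun hv i => by
    have := (norm_nonneg _).trans_lt (hv i)
    rw [norm_div, realPt, Complex.norm_real, Real.norm_of_nonneg this.le, div_lt_one this]
    exact hv i
  have hs : ∀ i, ‖realPt (fun i => min (r i) (ρ i) / 2) i‖ < r i ∧
      ‖realPt (fun i => min (r i) (ρ i) / 2) i‖ < ρ i := fun i => by
    rw [realPt, Complex.norm_real, Real.norm_of_nonneg (hs0 i).le]
    constructor <;> linarith [min_le_left (r i) (ρ i), min_le_right (r i) (ρ i), hr0 i, hρ0 i]
  -- Both polyradii are compared with the smaller one `min (r i) (ρ i) / 2`, at which homogeneity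
  -- applies from either side.
  have hcoef : ∀ j, torusCoeff F j (realPt ρ) / mono j (realPt ρ) =
      torusCoeff F j (realPt r) / mono j (realPt r) := fun j => by
    have e1 := h.torusCoeff_mul hF hr hr0 (hlt fun i => (hs i).1) j
    have e2 := h.torusCoeff_mul hF hρ hρ0 (hlt fun i => (hs i).2) j
    rw [hdiv hr0] at e1
    rw [hdiv hρ0, e1] at e2
    have f1 := mono_mul j (fun i => realPt (fun i => min (r i) (ρ i) / 2) i / realPt r i) (realPt r)
    have f2 := mono_mul j (fun i => realPt (fun i => min (r i) (ρ i) / 2) i / realPt ρ i) (realPt ρ)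
    rw [hdiv hr0] at f1
    rw [hdiv hρ0, f1] at f2
    have n1 := mono_ne_zero (hne hr0) j
    have n2 := mono_ne_zero (hne hρ0) j
    have n3 := mono_ne_zero (hne hs0) j
    rw [f1] at n3
    rw [div_eq_div_iff n2 n1]
    refine mul_left_cancel₀ (left_ne_zero_of_mul n3) ?_
    linear_combination torusCoeff F j (realPt ρ) * f2 - mono j (realPt ρ) * e2
  have hw1 : ∀ j, torusCoeff F j (realPt r) / mono j (realPt r) * mono j w =
      mono j (fun i => w i / realPt ρ i) * torusCoeff F j (realPt ρ) := fun j => by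
    have f := mono_mul j (fun i => w i / realPt ρ i) (realPt ρ)
    rw [hdiv hρ0] at f
    have n2 := mono_ne_zero (hne hρ0) j
    rw [← hcoef, f]
    field_simp
  constructor
  · have := h.hasSum_torusCoeff hF hρ hρ0 (hlt hwρ)
    rw [hdiv hρ0] at this
    exact this.congr_fun hw1
  · intro j
    have := h.torusCoeff_mul hF hρ hρ0 (hlt hwρ) j
    rw [hdiv hρ0] at this
    rw [this, hw1]

/-! ### Parseval's identity in a dense span -/

/-- The closed span of `v` is a Hilbert space with basis `v`. Working in this closure inside `L²`
makes completeness of the Bergman space unnecessary. -/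
theorem hasSum_norm_inner_sq {ι H : Type*} [NormedAddCommGroup H] [InnerProductSpace ℂ H]
    [CompleteSpace H] {v : ι → H} (hv : Orthonormal ℂ v) {y : H}
    (hy : y ∈ (Submodule.span ℂ (Set.range v)).topologicalClosure) :
    HasSum (fun i => ‖inner ℂ (v i) y‖ ^ 2) (‖y‖ ^ 2) := by
  set K := (Submodule.span ℂ (Set.range v)).topologicalClosure with hK
  have : CompleteSpace K :=
    (Submodule.isClosed_topologicalClosure _).completeSpace_coe
  have hmem : ∀ i, v i ∈ K := fun i =>
    Submodule.le_topologicalClosure _ (Submodule.subset_span ⟨i, rfl⟩)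
  have ho : Orthonormal ℂ (fun i => (⟨v i, hmem i⟩ : K)) := by
    classical
    rw [orthonormal_iff_ite] at hv ⊢
    exact fun i j => hv i j
  have hd : ⊤ ≤ (Submodule.span ℂ (Set.range fun i => (⟨v i, hmem i⟩ : K))).topologicalClosure := by
    rintro ⟨x, hx⟩ -
    rw [← SetLike.mem_coe, Submodule.topologicalClosure_coe, closure_subtype]
    have h1 : (Subtype.val '' (Submodule.span ℂ (Set.range fun i => (⟨v i, hmem i⟩ : K)) : Set K)) =
        (Submodule.span ℂ (Set.range v) : Set H) := by
      have := congrArg (fun S : Submodule ℂ H => (S : Set H))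
        (Submodule.map_span K.subtype (Set.range fun i => (⟨v i, hmem i⟩ : K)))
      simp only [Submodule.map_coe, ← Set.range_comp] at this
      exact this
    rw [h1]
    exact hx
  let b := HilbertBasis.mk ho hd
  have hb : ∀ i, ((b i : K) : H) = v i := fun i => by
    have : b i = ⟨v i, hmem i⟩ := congrFun (HilbertBasis.coe_mk ho hd) i
    rw [this]
  have h := b.hasSum_inner_mul_inner ⟨y, hy⟩ ⟨y, hy⟩
  simp only [Submodule.coe_inner, hb] at h
  have h2 := Complex.hasSum_re h
  rw [inner_self_eq_norm_sq_to_K] at h2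
  have e : (((‖y‖ : ℝ) : ℂ) ^ 2).re = ‖y‖ ^ 2 := by
    rw [← Complex.ofReal_pow, Complex.ofReal_re]
  refine (e ▸ h2).congr_fun fun i => ?_
  rw [← inner_conj_symm y (v i), RCLike.conj_mul]
  simp [← Complex.ofReal_pow]

theorem summable_smul_of_orthonormal {ι H : Type*} [NormedAddCommGroup H] [InnerProductSpace ℂ H]
    [CompleteSpace H] {v : ι → H} (hv : Orthonormal ℂ v) {c : ι → ℂ}
    (hc : Summable fun i => ‖c i‖ ^ 2) : Summable fun i => c i • v i := by
  have := (hv.orthogonalFamily.summable_iff_norm_sq_summable c).2 hc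
  simpa using this

/-! ### Rotations -/

theorem IsReinhardt.measurePreserving_mul {Ω : Set (Fin 3 → ℂ)} (h : IsReinhardt Ω)
    {t : Fin 3 → ℂ} (ht : ∀ i, ‖t i‖ = 1) :
    MeasurePreserving (fun v => v * t) (volume.restrict Ω) (volume.restrict Ω) := by
  have h1 : MeasurePreserving (fun v : Fin 3 → ℂ => v * t) volume volume := by
    refine volume_preserving_pi (f := fun i x => x * t i) fun i => ?_
    let c : Circle := ⟨t i, mem_sphere_zero_iff_norm.2 (ht i)⟩
    have h2 := (rotation c).measurePreserving
    have e : ⇑(rotation c) = fun x : ℂ => x * t i := by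
      ext x; rw [rotation_apply, mul_comm]
    rwa [e] at h2
  have h3 := h1.restrict_preimage h.isOpen.measurableSet
  have e : (fun v : Fin 3 → ℂ => v * t) ⁻¹' Ω = Ω := by
    ext v
    exact ⟨fun hv => h.complete hv fun i => by simp [ht], fun hv =>
      h.complete hv fun i => by simp [ht]⟩
  rwa [e] at h3

theorem measurableEmbedding_mul {t : Fin 3 → ℂ} (ht : ∀ i, ‖t i‖ = 1) :
    MeasurableEmbedding fun v : Fin 3 → ℂ => v * t := by
  refine Continuous.measurableEmbedding (continuous_id.mul continuous_const) fun v w hvw => ?_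
  ext i
  have h0 : t i ≠ 0 := fun h0 => by simpa [h0] using ht i
  exact mul_right_cancel₀ h0 (congrFun hvw i)

/-- The integral over `Ω` is unchanged by rotating the integrand; averaging over all rotations and
exchanging the integrals leaves the Fourier coefficient. -/
theorem IsReinhardt.setIntegral_conj_mono_mul {Ω : Set (Fin 3 → ℂ)} (h : IsReinhardt Ω)
    {F : (Fin 3 → ℂ) → ℂ} (hF : ContinuousOn F Ω) {j : ℕ × ℕ × ℕ}
    (hG : Integrable (fun v => conj (mono j v) * F v) (volume.restrict Ω)) :
    ∫ v in Ω, conj (mono j v) * F v = ∫ v in Ω, conj (mono j v) * torusCoeff F j v := by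
  set G : (Fin 3 → ℂ) → ℂ := fun v => conj (mono j v) * F v with hGdef
  have hGc : ContinuousOn G Ω :=
    (Complex.continuous_conj.comp (continuous_mono j)).continuousOn.mul hF
  have hmeas : AEStronglyMeasurable (Function.uncurry fun θ v => G (v * torusPt θ))
      (torusMeas.prod (volume.restrict Ω)) := by
    have e : torusMeas.prod (volume.restrict Ω) =
        (torusMeas.prod (volume : Measure (Fin 3 → ℂ))).restrict (Set.univ ×ˢ Ω) := by
      rw [← Measure.prod_restrict, Measure.restrict_univ]
    rw [e]
    refine ContinuousOn.aestronglyMeasurable ?_ (MeasurableSet.univ.prod h.isOpen.measurableSet)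
    refine hGc.comp (f := fun x : (ℝ × ℝ × ℝ) × (Fin 3 → ℂ) => x.2 * torusPt x.1)
      (continuous_snd.mul (continuous_torusPt.comp continuous_fst)).continuousOn fun x hx => ?_
    exact h.mul_torusPt hx.2 _
  have hint : Integrable (Function.uncurry fun θ v => G (v * torusPt θ))
      (torusMeas.prod (volume.restrict Ω)) := by
    refine (integrable_prod_iff hmeas).2 ⟨Filter.Eventually.of_forall fun θ => ?_, ?_⟩
    · exact ((h.measurePreserving_mul (norm_torusPt θ)).integrable_comp_emb
        (measurableEmbedding_mul (norm_torusPt θ))).2 hG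
    -- By rotation invariance the integral of the norm is constant in `θ`.
    · have : ∀ θ, ∫ v in Ω, ‖G (v * torusPt θ)‖ = ∫ v in Ω, ‖G v‖ := fun θ =>
        (h.measurePreserving_mul (norm_torusPt θ)).integral_comp
          (measurableEmbedding_mul (norm_torusPt θ)) fun v => ‖G v‖
      simp only [Function.uncurry_apply_pair, this]
      exact integrable_const _
  have hrot : ∀ θ, ∫ v in Ω, G (v * torusPt θ) = ∫ v in Ω, G v := fun θ =>
    (h.measurePreserving_mul (norm_torusPt θ)).integral_comp
      (measurableEmbedding_mul (norm_torusPt θ)) G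
  have hswap := integral_integral_swap hint
  simp only [hrot, integral_const, probReal_univ, one_smul] at hswap
  rw [hswap]
  refine integral_congr_ae (Filter.Eventually.of_forall fun v => ?_)
  change ∫ θ, G (v * torusPt θ) ∂torusMeas = conj (mono j v) *
    ∫ θ, conj (mono j (torusPt θ)) * F (v * torusPt θ) ∂torusMeas
  rw [← integral_const_mul]
  refine integral_congr_ae (Filter.Eventually.of_forall fun θ => ?_)
  change conj (mono j (v * torusPt θ)) * F (v * torusPt θ) = _
  rw [mono_mul, map_mul, mul_assoc]

/-! ### The orthonormal basis of monomials -/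

/-- A complete Reinhardt domain on which the monomials have squared norms `N j`. -/
structure HasMonoNorm (Ω : Set (Fin 3 → ℂ)) (N : ℕ × ℕ × ℕ → ℝ) : Prop extends IsReinhardt Ω where
  pos : ∀ j, 0 < N j
  lintegral_eq : ∀ j, ∫⁻ v in Ω, ENNReal.ofReal (Complex.normSq (mono j v)) = ENNReal.ofReal (N j)

variable {Ω : Set (Fin 3 → ℂ)} {N : ℕ × ℕ × ℕ → ℝ}

theorem HasMonoNorm.integrable (h : HasMonoNorm Ω N) (j : ℕ × ℕ × ℕ) :
    Integrable (fun v => ‖mono j v‖ ^ 2) (volume.restrict Ω) := by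
  refine (lintegral_ofReal_ne_top_iff_integrable
    ((continuous_mono j).norm.pow 2).aestronglyMeasurable
    (Filter.Eventually.of_forall fun v => sq_nonneg _)).1 ?_
  change ∫⁻ v in Ω, ENNReal.ofReal (‖mono j v‖ ^ 2) ≠ _
  simp only [← Complex.normSq_eq_norm_sq, h.lintegral_eq]
  exact ENNReal.ofReal_ne_top

theorem HasMonoNorm.integral_eq (h : HasMonoNorm Ω N) (j : ℕ × ℕ × ℕ) :
    ∫ v in Ω, ‖mono j v‖ ^ 2 = N j := by
  rw [integral_eq_lintegral_of_nonneg_ae (Filter.Eventually.of_forall fun v => sq_nonneg _)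
    ((continuous_mono j).norm.pow 2).aestronglyMeasurable]
  simp only [← Complex.normSq_eq_norm_sq, h.lintegral_eq]
  exact ENNReal.toReal_ofReal (h.pos j).le

theorem HasMonoNorm.memLp (h : HasMonoNorm Ω N) (j : ℕ × ℕ × ℕ) :
    MemLp (mono j) 2 (volume.restrict Ω) :=
  (memLp_two_iff_integrable_sq_norm (continuous_mono j).aestronglyMeasurable).2 (h.integrable j)

theorem HasMonoNorm.integral_conj_mul (h : HasMonoNorm Ω N) {F : (Fin 3 → ℂ) → ℂ}
    (hF : ContinuousOn F Ω) (hF2 : MemLp F 2 (volume.restrict Ω)) {j : ℕ × ℕ × ℕ} {a : ℂ}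
    (ha : ∀ v ∈ Ω, torusCoeff F j v = a * mono j v) :
    ∫ v in Ω, conj (mono j v) * F v = a * N j := by
  have hc : MemLp (fun v => conj (mono j v)) 2 (volume.restrict Ω) := (h.memLp j).star
  rw [h.setIntegral_conj_mono_mul hF (hc.integrable_mul hF2), ← h.integral_eq j,
    ← integral_complex_ofReal, ← integral_const_mul]
  refine setIntegral_congr_fun h.isOpen.measurableSet fun v hv => ?_
  simp only [ha v hv]
  rw [mul_left_comm, Complex.conj_mul']
  push_cast
  rfl

/-- The normalized monomials as elements of the Bergman space. -/
noncomputable def HasMonoNorm.basisElt (h : HasMonoNorm Ω N) (j : ℕ × ℕ × ℕ) : bergmanSpace Ω :=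
  ⟨((Real.sqrt (N j) : ℂ))⁻¹ • (h.memLp j).toLp,
    (bergmanSpace Ω).smul_mem _ ⟨mono j, (differentiable_mono j).differentiableOn,
      (h.memLp j).coeFn_toLp⟩⟩

theorem HasMonoNorm.coeFn_basisElt (h : HasMonoNorm Ω N) (j : ℕ × ℕ × ℕ) :
    ((h.basisElt j : Lp ℂ 2 (volume.restrict Ω)) : (Fin 3 → ℂ) → ℂ) =ᵐ[volume.restrict Ω]
      fun v => (Real.sqrt (N j) : ℂ)⁻¹ * mono j v := by
  refine (Lp.coeFn_smul _ _).trans ?_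
  filter_upwards [(h.memLp j).coeFn_toLp] with v hv
  simp [hv]

theorem HasMonoNorm.inner_basisElt (h : HasMonoNorm Ω N) {f : Lp ℂ 2 (volume.restrict Ω)}
    {F : (Fin 3 → ℂ) → ℂ} (hF : ContinuousOn F Ω) (hfF : f =ᵐ[volume.restrict Ω] F)
    {j : ℕ × ℕ × ℕ} {a : ℂ} (ha : ∀ v ∈ Ω, torusCoeff F j v = a * mono j v) :
    inner ℂ (h.basisElt j : Lp ℂ 2 (volume.restrict Ω)) f = Real.sqrt (N j) * a := by
  have hF2 : MemLp F 2 (volume.restrict Ω) := (memLp_congr_ae hfF).1 (Lp.memLp f)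
  have hs : (Real.sqrt (N j) : ℂ) ≠ 0 := by exact_mod_cast (Real.sqrt_pos.2 (h.pos j)).ne'
  have hs2 : (Real.sqrt (N j) : ℂ) * Real.sqrt (N j) = N j := by
    exact_mod_cast Real.mul_self_sqrt (h.pos j).le
  have h1 : inner ℂ (h.basisElt j : Lp ℂ 2 (volume.restrict Ω)) f =
      (Real.sqrt (N j) : ℂ)⁻¹ * ∫ v in Ω, conj (mono j v) * F v := by
    rw [L2.inner_def, ← integral_const_mul]
    refine integral_congr_ae ?_
    filter_upwards [h.coeFn_basisElt j, hfF] with v h2 h3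
    rw [h2, h3, RCLike.inner_apply, map_mul, map_inv₀, Complex.conj_ofReal]
    ring
  rw [h1, h.integral_conj_mul hF hF2 ha, ← hs2]
  field_simp

theorem torusCoeff_mono (j k : ℕ × ℕ × ℕ) (v : Fin 3 → ℂ) :
    torusCoeff (mono k) j v = (if j = k then 1 else 0) * mono j v := by
  have e : ∀ θ, conj (mono j (torusPt θ)) * mono k (v * torusPt θ) =
      mono k v * (conj (mono j (torusPt θ)) * mono k (torusPt θ)) := fun θ => by
    rw [mono_mul]; ring
  simp only [torusCoeff, e, integral_const_mul, integral_conj_mono_mul_mono]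
  split_ifs with hjk
  · rw [hjk]; ring
  · ring

theorem HasMonoNorm.orthonormal (h : HasMonoNorm Ω N) :
    Orthonormal ℂ fun j => (h.basisElt j : Lp ℂ 2 (volume.restrict Ω)) := by
  rw [orthonormal_iff_ite]
  intro j k
  have hs : (Real.sqrt (N k) : ℂ) ≠ 0 := by exact_mod_cast (Real.sqrt_pos.2 (h.pos k)).ne'
  have hcoef : ∀ v ∈ Ω, torusCoeff (fun v => (Real.sqrt (N k) : ℂ)⁻¹ * mono k v) j v =
      ((Real.sqrt (N k) : ℂ)⁻¹ * if j = k then 1 else 0) * mono j v := fun v _ => by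
    rw [mul_assoc, ← torusCoeff_mono, torusCoeff, torusCoeff, ← integral_const_mul]
    refine integral_congr_ae (Filter.Eventually.of_forall fun θ => ?_)
    simp only
    ring
  rw [h.inner_basisElt (continuous_const.mul (continuous_mono k)).continuousOn
    (h.coeFn_basisElt k) hcoef]
  split_ifs with hjk
  · subst hjk; field_simp
  · simp

/-- The inner products with the basis are the power series coefficients up to normalization, so the
expansion converges pointwise to the holomorphic representative. By Bessel's inequality it also
converges in `L²`, and the two limits must agree. -/
theorem HasMonoNorm.hasSum_inner_smul (h : HasMonoNorm Ω N) (f : bergmanSpace Ω) :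
    HasSum (fun j => inner ℂ (h.basisElt j : Lp ℂ 2 (volume.restrict Ω)) f •
      (h.basisElt j : Lp ℂ 2 (volume.restrict Ω))) f ∧
    ∀ z ∈ Ω, HasSum (fun j => (Real.sqrt (N j) : ℂ)⁻¹ * mono j z *
      inner ℂ (h.basisElt j : Lp ℂ 2 (volume.restrict Ω)) f) (holRep f z) := by
  obtain ⟨hFd, hfF⟩ := f.2.choose_spec
  change DifferentiableOn ℂ (holRep f) Ω at hFd
  change _ =ᵐ[volume.restrict Ω] holRep f at hfF
  obtain ⟨a, ha⟩ := h.exists_powerSeries hFd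
  have hin : ∀ j, inner ℂ (h.basisElt j : Lp ℂ 2 (volume.restrict Ω)) f = Real.sqrt (N j) * a j :=
    fun j => h.inner_basisElt hFd.continuousOn hfF fun v hv => (ha v hv).2 j
  have hs : ∀ j, (Real.sqrt (N j) : ℂ) ≠ 0 := fun j => by
    exact_mod_cast (Real.sqrt_pos.2 (h.pos j)).ne'
  have hpt : ∀ z ∈ Ω, HasSum (fun j => (Real.sqrt (N j) : ℂ)⁻¹ * mono j z *
      inner ℂ (h.basisElt j : Lp ℂ 2 (volume.restrict Ω)) f) (holRep f z) := fun z hz => by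
    refine (ha z hz).1.congr_fun fun j => ?_
    rw [hin]
    have := hs j
    field_simp
  refine ⟨?_, hpt⟩
  have hsum := (summable_smul_of_orthonormal h.orthonormal
    (h.orthonormal.inner_products_summable (f : Lp ℂ 2 (volume.restrict Ω)))).hasSum
  convert hsum using 1
  -- Along a sequence of finite partial sums `L²` convergence gives a subsequence converging almost
  -- everywhere; its limit is compared with the pointwise sum.
  obtain ⟨s, hs⟩ := (Filter.atTop : Filter (Finset (ℕ × ℕ × ℕ))).exists_seq_tendsto
  obtain ⟨ns, hns, hlim⟩ := (tendstoInMeasure_of_tendsto_Lp (hsum.comp hs)).exists_seq_tendsto_ae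
  have hcoe : ∀ᵐ v ∂volume.restrict Ω, ∀ n, (((∑ j ∈ s n,
      inner ℂ (h.basisElt j : Lp ℂ 2 (volume.restrict Ω)) f •
        (h.basisElt j : Lp ℂ 2 (volume.restrict Ω)) : Lp ℂ 2 (volume.restrict Ω))) :
          (Fin 3 → ℂ) → ℂ) v = ∑ j ∈ s n, (Real.sqrt (N j) : ℂ)⁻¹ * mono j v *
      inner ℂ (h.basisElt j : Lp ℂ 2 (volume.restrict Ω)) f := by
    rw [ae_all_iff]
    intro n
    have h1 : ∀ᵐ v ∂volume.restrict Ω, ∀ j, (((inner ℂ (h.basisElt j : Lp ℂ 2 (volume.restrict Ω)) f •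
        (h.basisElt j : Lp ℂ 2 (volume.restrict Ω)) : Lp ℂ 2 (volume.restrict Ω))) :
          (Fin 3 → ℂ) → ℂ) v = (Real.sqrt (N j) : ℂ)⁻¹ * mono j v *
      inner ℂ (h.basisElt j : Lp ℂ 2 (volume.restrict Ω)) f := by
      rw [ae_all_iff]
      intro j
      filter_upwards [Lp.coeFn_smul (inner ℂ (h.basisElt j : Lp ℂ 2 (volume.restrict Ω)) f)
        (h.basisElt j : Lp ℂ 2 (volume.restrict Ω)), h.coeFn_basisElt j] with v e1 e2
      rw [e1, Pi.smul_apply, e2, smul_eq_mul, mul_comm]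
    filter_upwards [Lp.coeFn_finsetSum (s n) fun j =>
      inner ℂ (h.basisElt j : Lp ℂ 2 (volume.restrict Ω)) f •
        (h.basisElt j : Lp ℂ 2 (volume.restrict Ω)), h1] with v e1 e2
    rw [e1, Finset.sum_apply]
    exact Finset.sum_congr rfl fun j _ => e2 j
  refine Lp.ext ?_
  filter_upwards [hfF, hlim, hcoe, ae_restrict_mem h.isOpen.measurableSet] with v e1 e2 e3 hv
  rw [e1]
  refine tendsto_nhds_unique (((hpt v hv).comp hs).comp hns.tendsto_atTop) (e2.congr fun n => ?_)
  exact e3 (ns n)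

/-! ### The Bergman kernel as a sum over the monomials -/

theorem coe_mem_closure_span {Ω : Set (Fin 3 → ℂ)} {s : Set (bergmanSpace Ω)}
    (hs : (Submodule.span ℂ s).topologicalClosure = ⊤) (f : bergmanSpace Ω) :
    (f : Lp ℂ 2 (volume.restrict Ω)) ∈ (Submodule.span ℂ (Set.range fun x : s =>
      ((x : bergmanSpace Ω) : Lp ℂ 2 (volume.restrict Ω)))).topologicalClosure := by
  have h1 : (Subtype.val '' (Submodule.span ℂ s : Set (bergmanSpace Ω))) =
      (Submodule.span ℂ (Set.range fun x : s =>
        ((x : bergmanSpace Ω) : Lp ℂ 2 (volume.restrict Ω))) : Set _) := by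
    have e : (Set.range fun x : s => ((x : bergmanSpace Ω) : Lp ℂ 2 (volume.restrict Ω))) =
        (bergmanSpace Ω).subtype '' s := by
      ext y; simp
    rw [e, ← Submodule.map_span, Submodule.map_coe]
    rfl
  have h2 : f ∈ closure (Submodule.span ℂ s : Set (bergmanSpace Ω)) := by
    rw [← Submodule.topologicalClosure_coe, hs]; trivial
  rw [← SetLike.mem_coe, Submodule.topologicalClosure_coe, ← h1]
  exact closure_subtype.1 h2

theorem HasMonoNorm.isOrthonormalBasis {Ω : Set (Fin 3 → ℂ)} {N : ℕ × ℕ × ℕ → ℝ}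
    (h : HasMonoNorm Ω N) : IsOrthonormalBasis (Set.range h.basisElt) := by
  have ho : Orthonormal ℂ h.basisElt := by
    have := h.orthonormal
    rw [orthonormal_iff_ite] at this ⊢
    exact this
  refine ⟨ho.toSubtypeRange, ?_⟩
  rw [eq_top_iff]
  rintro f -
  rw [← SetLike.mem_coe, Submodule.topologicalClosure_coe]
  have hlim : Filter.Tendsto (fun s : Finset (ℕ × ℕ × ℕ) => ∑ j ∈ s,
      inner ℂ (h.basisElt j : Lp ℂ 2 (volume.restrict Ω)) f • h.basisElt j) Filter.atTop
      (nhds f) := by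
    rw [tendsto_subtype_rng]
    refine Filter.Tendsto.congr (fun s => ?_) (h.hasSum_inner_smul f).1
    simp
  refine mem_closure_of_tendsto hlim (Filter.Eventually.of_forall fun s => ?_)
  exact Submodule.sum_mem _ fun j _ => Submodule.smul_mem _ _ (Submodule.subset_span ⟨j, rfl⟩)

/-- The vector `y = ∑ conj(eⱼ(z)) eⱼ` represents evaluation at `z`. Parseval's identity for `y` in
any orthonormal basis gives `∑ |f(z)|² = ‖y‖²`, and the monomial basis evaluates the right side. -/
theorem HasMonoNorm.bergmanKernel_eq {Ω : Set (Fin 3 → ℂ)} {N : ℕ × ℕ × ℕ → ℝ}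
    (h : HasMonoNorm Ω N) {z : Fin 3 → ℂ} (hz : z ∈ Ω) {K : ℝ}
    (hK : HasSum (fun j => Complex.normSq (mono j z) / N j) K) : bergmanKernel Ω z = K := by
  set c : ℕ × ℕ × ℕ → ℂ := fun j => conj ((Real.sqrt (N j) : ℂ)⁻¹ * mono j z) with hc
  have hc2 : ∀ j, ‖c j‖ ^ 2 = Complex.normSq (mono j z) / N j := fun j => by
    rw [hc, RCLike.norm_conj, norm_mul, mul_pow, norm_inv, Complex.norm_real, inv_pow,
      Real.norm_of_nonneg (Real.sqrt_nonneg _), Real.sq_sqrt (h.pos j).le,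
      Complex.normSq_eq_norm_sq]
    ring
  have hsum : Summable fun j => c j • (h.basisElt j : Lp ℂ 2 (volume.restrict Ω)) :=
    summable_smul_of_orthonormal h.orthonormal (by simpa only [hc2] using hK.summable)
  obtain ⟨y, hy⟩ := hsum
  have hin : ∀ f : bergmanSpace Ω, ‖inner ℂ (f : Lp ℂ 2 (volume.restrict Ω)) y‖ =
      ‖holRep f z‖ := fun f => by
    have h1 := (innerSL ℂ (f : Lp ℂ 2 (volume.restrict Ω))).hasSum hy
    have h2 := ((h.hasSum_inner_smul f).2 z hz).star
    have : inner ℂ (f : Lp ℂ 2 (volume.restrict Ω)) y = star (holRep f z) := by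
      refine h1.unique (h2.congr_fun fun j => ?_)
      rw [innerSL_apply_apply, inner_smul_right, star_mul', RCLike.star_def,
        inner_conj_symm]
    rw [this, norm_star]
  have hmem : ∀ s : Set (bergmanSpace Ω), IsOrthonormalBasis s →
      HasSum (fun f : s => ‖holRep (f : bergmanSpace Ω) z‖ ^ 2) (‖y‖ ^ 2) := fun s hs => by
    have ho : Orthonormal ℂ fun f : s =>
        ((f : bergmanSpace Ω) : Lp ℂ 2 (volume.restrict Ω)) := by
      classical
      have := hs.1
      rw [orthonormal_iff_ite] at this ⊢
      exact this
    refine (hasSum_norm_inner_sq ho (y := y) ?_).congr_fun fun f => by rw [hin]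
    -- `y` is a limit of combinations of monomials, each of which lies in the closed span of `s`.
    refine (Submodule.isClosed_topologicalClosure _).mem_of_tendsto hy
      (Filter.Eventually.of_forall fun t => ?_)
    exact Submodule.sum_mem _ fun j _ => Submodule.smul_mem _ _ (coe_mem_closure_span hs.2 _)
  have hyK : ‖y‖ ^ 2 = K := by
    refine (hasSum_norm_inner_sq h.orthonormal (y := y) ?_).unique (hK.congr_fun fun j => ?_)
    · refine (Submodule.isClosed_topologicalClosure _).mem_of_tendsto hy
        (Filter.Eventually.of_forall fun t => ?_)
      exact Submodule.sum_mem _ fun j _ => Submodule.smul_mem _ _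
        (Submodule.le_topologicalClosure _ (Submodule.subset_span ⟨j, rfl⟩))
    · have h1 := (innerSL ℂ (h.basisElt j : Lp ℂ 2 (volume.restrict Ω))).hasSum hy
      have h2 : inner ℂ (h.basisElt j : Lp ℂ 2 (volume.restrict Ω)) y = c j := by
        refine h1.unique ((hasSum_ite_eq j (c j)).congr_fun fun k => ?_)
        rw [innerSL_apply_apply, inner_smul_right, orthonormal_iff_ite.1 h.orthonormal j k]
        by_cases hjk : k = j
        · subst hjk; simp
        · simp [hjk, Ne.symm hjk]
      rw [← hc2, h2]
  have hex : ∃ s : Set (bergmanSpace Ω), IsOrthonormalBasis s := ⟨_, h.isOrthonormalBasis⟩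
  rw [bergmanKernel, dif_pos hex, (hmem _ hex.choose_spec).tsum_eq, hyK]

theorem hasMonoNorm_domainE {p lam : ℝ} (hp : 0 < p) (hlam : 0 < lam) :
    HasMonoNorm (domainE p lam) (monoNorm p lam) where
  isOpen := isOpen_domainE hp hlam
  complete := fun v hv w hw => by
    have h2 : (‖w 0‖ ^ (2 * p) + ‖w 1‖ ^ 2) ^ (1 / lam) + ‖w 2‖ ^ 2 ≤
        (‖v 0‖ ^ (2 * p) + ‖v 1‖ ^ 2) ^ (1 / lam) + ‖v 2‖ ^ 2 := by
      gcongr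
      · exact hw 0
      · exact hw 1
      · exact hw 2
    exact lt_of_le_of_lt h2 hv
  pos := monoNorm_pos hp hlam
  lintegral_eq := lintegral_domainE hp hlam

/-- The Bergman kernel of `E_{p,λ}` in closed form. -/
theorem exists_log_bergmanKernel {p lam : ℝ} (hp : 0 < p) (hlam : 0 < lam) :
    ∃ C, ∀ z ∈ domainE p lam, Real.log (bergmanKernel (domainE p lam) z) =
      potF p lam C (sqMod z) :=
  ⟨_, fun _ hz => by
    rw [(hasMonoNorm_domainE hp hlam).bergmanKernel_eq hz (hasSum_mono_div hp hlam hz),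
      log_kerF hp hlam hz]⟩

end Bergman

/-! ### The curvature formulas and the uniform bound -/

theorem mainTheorem6 (p lam : ℝ) (hp : 0 < p) (hlam : 0 < lam) :
    (∀ y z : ℝ, 0 ≤ y → y < 1 → 0 ≤ z → z < 1 →
      Bergman.pt y z ∈ Bergman.domainE p lam →
      let g := Bergman.bergmanMetric (Bergman.domainE p lam)
      let P := Bergman.pt y z
      let d : ℝ := y ^ 2 / (1 - z ^ 2) ^ lam
      let X := Bergman.frameX g P
      let Y := Bergman.frameY g P
      let Z := Bergman.frameZ g P
      let V := Bergman.frame g P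
      let R := Bergman.curv g P
      -- `X, Y, Z` is orthonormal
      (∀ α β : Fin 3, Bergman.herm g P (V α) (V β) = if α = β then 1 else 0) ∧
      -- holomorphic sectional and bisectional curvatures of the frame
      R X X X X = ((Bergman.H1 p lam d / Bergman.A1 p lam d ^ 2 : ℝ) : ℂ) ∧
      R Y Y Y Y = ((Bergman.H5 p lam d / Bergman.A2 p lam d ^ 2 : ℝ) : ℂ) ∧
      R Z Z Z Z = ((Bergman.F3 p lam d / Bergman.A4 p lam d ^ 2 : ℝ) : ℂ) ∧
      R X X Y Y = ((Bergman.H2 p lam d / (Bergman.A1 p lam d * Bergman.A2 p lam d) : ℝ) : ℂ) ∧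
      R X X Z Z = ((Bergman.F1 p lam d / (Bergman.A1 p lam d * Bergman.A4 p lam d) : ℝ) : ℂ) ∧
      R Y Y Z Z = ((Bergman.F2 p lam d / (Bergman.A2 p lam d * Bergman.A4 p lam d) : ℝ) : ℂ) ∧
      -- the components that coincide with one of these six
      (∀ α β : Fin 3, R (V α) (V α) (V β) (V β) = R (V β) (V β) (V α) (V α) ∧
        R (V α) (V β) (V β) (V α) = R (V α) (V α) (V β) (V β)) ∧
      -- all other components vanish
      (∀ α β γ η : Fin 3, ¬((α = β ∧ γ = η) ∨ (α = η ∧ γ = β)) →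
        R (V α) (V β) (V γ) (V η) = 0)) ∧
    -- the holomorphic sectional curvature is bounded, uniformly up to the boundary
    (∃ C : ℝ, ∀ y z : ℝ, 0 ≤ y → y < 1 → 0 ≤ z → z < 1 →
      Bergman.pt y z ∈ Bergman.domainE p lam →
      ∀ v : Fin 3 → ℂ,
        Bergman.herm (Bergman.bergmanMetric (Bergman.domainE p lam)) (Bergman.pt y z) v v = 1 →
        ‖Bergman.curv (Bergman.bergmanMetric (Bergman.domainE p lam)) (Bergman.pt y z) v v v v‖
          ≤ C) := by
  obtain ⟨C, hB⟩ := Bergman.exists_log_bergmanKernel hp hlam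
  constructor
  · intro y z _ _ _ _ hP g P d X Y Z V R
    obtain ⟨-, -, horth, hcurv⟩ := Bergman.frame_and_curv hp hlam hB hP (d := d) rfl
    refine ⟨horth, ?_, ?_, ?_, ?_, ?_, ?_, fun α β => ⟨?_, ?_⟩, fun α β γ η h => ?_⟩
    · exact hcurv 0 0 0 0
    · exact hcurv 1 1 1 1
    · exact hcurv 2 2 2 2
    · exact hcurv 0 0 1 1
    · exact hcurv 0 0 2 2
    · exact hcurv 1 1 2 2
    · refine (hcurv α α β β).trans (Eq.trans ?_ (hcurv β β α α).symm)
      rw [if_pos (Or.inl ⟨rfl, rfl⟩), if_pos (Or.inl ⟨rfl, rfl⟩)]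
      fin_cases α <;> fin_cases β <;> rfl
    · refine (hcurv α β β α).trans (Eq.trans ?_ (hcurv α α β β).symm)
      rw [if_pos (Or.inr ⟨rfl, rfl⟩), if_pos (Or.inl ⟨rfl, rfl⟩)]
    · exact (hcurv α β γ η).trans (if_neg h)
  · obtain ⟨K, hK0, hK⟩ := Bergman.exists_bound_curvTable hp hlam
    -- There are `3⁴` components, each bounded by `K`, with coefficients of modulus at most one.
    refine ⟨((3 : ℕ) : ℝ) * ((3 : ℕ) * ((3 : ℕ) * ((3 : ℕ) * K))), fun y z _ _ _ _ hP v hv => ?_⟩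
    obtain ⟨hd0, hd1, horth, hcurv⟩ := Bergman.frame_and_curv hp hlam hB hP rfl
    refine Bergman.norm_curv_le _ _ horth (K := K) (fun α β γ η => ?_) hv
    rw [hcurv]
    split_ifs
    · simpa using hK _ hd0 hd1.le α γ
    · simpa using hK0
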